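/- Notation. $\mathcal A=\{u+\sigma v:u,v\in\mathbb R\}$, $\sigma^2=1$, are the Lorentz numbers, with $e^{u+\sigma v}=e^u(\cosh v+\sigma\sinh v)$, $\cosh a=\frac12(e^a+e^{-a})$, $\sinh a=\frac12(e^a-e^{-a})$; $\mathcal A_{\mathbb C}=\mathcal A\otimes\mathbb C$; $\mathbb H^{\mathcal A_{\mathbb C}}$ is the algebra of quaternions $\zeta=\zeta_0+\zeta_1I+\zeta_2J+\zeta_3K$ over $\mathcal A_{\mathbb C}$; $\bar\zeta$ is the quaternionic conjugate, $\hat\zeta$ is obtained from $\zeta$ by $\sigma\mapsto-\sigma$, and $H(\zeta,\zeta')=\sum_k\zeta_k\zeta_k'$. Put $\mathbb H_0=\{p_0+ip_1I+p_2J+ip_3K:\ p_k\in\mathcal A\}$ and $Spin(2,2)=\{p\in\mathbb H_0:H(p,p)=1\}$; there $p^{-1}=\bar p$. The space $\mathbb R^{2,2}$, with metric $-dx_0^2+dx_1^2-dx_2^2+dx_3^2$, is identified with the set of the elements $q=\sigma i x_0+x_1I+ix_2J+x_3K$; the Clifford product of two vectors is $q\cdot q'=q\hat q'\in\mathbb H_0$,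 a vector acts on spinors $\xi\in\mathbb H_0$ by $q\cdot\xi=\sigma i\,q\hat\xi$, and $\langle\langle\xi,\xi'\rangle\rangle=\sigma i\,\bar\xi'\xi$. A differentiable map $\psi:\mathcal U\subset\mathcal A\to\mathcal A$ is conformal if $d\psi(\sigma h)=\sigma\, d\psi(h)$. A Lorentz structure on a surface is a smooth field $x\mapsto\sigma_x$ of endomorphisms of $T_xM$ with $\sigma_x^2=\mathrm{id}$, $\sigma_x\ne\pm\mathrm{id}$; a map $f$ from the surface to $\mathbb H_0$ or to $\mathcal A$ is conformal if $df(\sigma_xX)=\sigma\,df(X)$. A chart of the Lorentz structure is a smooth chart with values in $\mathcal A$ that is conformal. In such a chart $a=u+\sigma v$, a conformal map $g$ has a derivative $g'$ with $dg=g'\,da$. Setting. Let $M$ be a Lorentzian surface and $E\to M$ a bundle of rank $2$ with a Lorentzian fibre metric and a compatible connection, $M$ and $E$ being oriented in space and in time. Suppose that $(e_2,e_3)$ and $(e_0,e_1)$ are parallel, orthonormal, positively oriented frames of $TM$ (for the Levi-Civita connection) and of $E$, with $|e_0|^2=|e_2|^2=-1$, $|e_1|^2=|e_3|^2=1$ (so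 $M$ and $E$ are flat). Let $\tilde s$ be a spinorial frame above $(e_0,e_1,e_2,e_3)$; in $\tilde s$ a vector $\sum x_je_j$ of $E\oplus TM$ is represented by $[X]=\sigma i x_0+x_1I+ix_2J+x_3K$, and a section of $\Sigma=\Sigma E\otimes\Sigma M$ by a function with values in $\mathbb H_0$. Let $\varphi=[\tilde s,g]$ be a smooth section of $\Sigma$ with $H(\varphi,\varphi)=1$, that is $g:M\to Spin(2,2)$, satisfying the Dirac equation $-e_2\cdot\nabla_{e_2}\varphi+e_3\cdot\nabla_{e_3}\varphi=\vec H\cdot\varphi$ for some section $\vec H$ of $E$, and let $F:M\to\mathbb R^{2,2}$ be the immersion defined by $\varphi$, i.e. $dF(X)=\langle\langle X\cdot\varphi,\varphi\rangle\rangle$ for $X\in TM$. Let $G=dF(e_2)\cdot dF(e_3)$ be its Gauss map. Suppose that $dG_x$ is injective at every $x\in M$, and that $\Delta>0$ on $M$, where $\Delta$ is the determinant, with respect to the metric of $M$, of the quadratic form $\delta(X)=\frac12dG(X)\wedge dG(X)\in\Lambda^4\mathbb R^{2,2}\simeq\mathbb R$. Theorem. There is a unique Lorentz structure on $M$ for which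 $G$ is conformal, and: 1. $g$ is conformal for this Lorentz structure. Every point of $M$ has a neighbourhood with a chart $a$ of the Lorentz structure which is compatible with the orientation of $M$ and such that $H(g',g')\equiv1$ or $H(g',g')\equiv-1$ (an adapted chart). Two adapted charts $a_1,a_2$ satisfy $a_2=\pm a_1+b$, with a constant sign and a constant $b\in\mathcal A$, on every connected set where both are defined, and conversely $\pm a+b$ is an adapted chart if $a$ is. 2. In every adapted chart with connected domain, with image $\mathcal U\subset\mathcal A$, there are a smooth conformal map $\psi:\mathcal U\to\mathcal A$ and a constant $\varepsilon\in\{1,-1,\sigma,-\sigma\}$ such that, on all of $\mathcal U$, $$g'g^{-1}=\varepsilon(\cosh\psi\,J+i\sinh\psi\,K)\qquad\text{or, on all of }\mathcal U,\qquad g'g^{-1}=\varepsilon(\sinh\psi\,J+i\cosh\psi\,K).$$ Moreover, every point of $M$ has a neighbourhood with a chart of the Lorentz structure, compatible with the orientation of $M$ or with the opposite one, in which $H(g',g')\equiv1$ or $H(g',g')\equiv-1$ and one of these two formulas holds with $\varepsilon=1$. -/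

import Mathlib

open Bundle
open scoped Manifold ContDiff Quaternion

noncomputable section

/-! ### Lorentz numbers and the quaternions over the complexified Lorentz numbers -/

/-- The Lorentz numbers `u + σ v` with `u, v` real and `σ ^ 2 = 1`. -/
abbrev LorentzNum : Type := QuadraticAlgebra ℝ 1 0

/-- The complexified Lorentz numbers `u + σ v` with `u, v` complex and `σ ^ 2 = 1`. -/
abbrev LorentzNumC : Type := QuadraticAlgebra ℂ 1 0

/-- The quaternions with coefficients in the complexified Lorentz numbers. -/
abbrev QuatLC : Type := Quaternion LorentzNumC

namespace LorentzNum

/-- The coordinates `(u, v)` of `u + σ v`. -/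
def toProd : LorentzNum →ₗ[ℝ] ℝ × ℝ where
  toFun a := (a.re, a.im)
  map_add' _ _ := rfl
  map_smul' _ _ := rfl

theorem toProd_injective : Function.Injective toProd := fun a b h => by
  ext
  · exact congrArg Prod.fst h
  · exact congrArg Prod.snd h

instance : NormedAddCommGroup LorentzNum :=
  NormedAddCommGroup.induced LorentzNum (ℝ × ℝ) toProd toProd_injective

instance : NormedSpace ℝ LorentzNum := NormedSpace.induced ℝ LorentzNum (ℝ × ℝ) toProd

/-- The Lorentz number `σ`. -/
def sigma : LorentzNum := ⟨0, 1⟩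

theorem sigma_mul_sigma : sigma * sigma = 1 := by
  ext <;> simp [sigma, QuadraticAlgebra.re_one, QuadraticAlgebra.im_one]

/-- The exponential `e ^ (u + σ v) = e ^ u (cosh v + σ sinh v)`. -/
def exp (a : LorentzNum) : LorentzNum :=
  ⟨Real.exp a.re * Real.cosh a.im, Real.exp a.re * Real.sinh a.im⟩

/-- `cosh a = (e ^ a + e ^ (-a)) / 2`. -/
def cosh (a : LorentzNum) : LorentzNum := (1 / 2 : ℝ) • (exp a + exp (-a))

/-- `sinh a = (e ^ a - e ^ (-a)) / 2`. -/
def sinh (a : LorentzNum) : LorentzNum := (1 / 2 : ℝ) • (exp a - exp (-a))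

/-- The inclusion of the Lorentz numbers into the complexified ones. -/
def toC (a : LorentzNum) : LorentzNumC := ⟨(a.re : ℂ), (a.im : ℂ)⟩

/-- Conformal maps between open subsets of the Lorentz numbers. -/
def ConformalOn (ψ : LorentzNum → LorentzNum) (U : Set LorentzNum) : Prop :=
  ContDiffOn ℝ ∞ ψ U ∧
    ∀ a ∈ U, ∀ k : LorentzNum, fderiv ℝ ψ a (sigma * k) = sigma * fderiv ℝ ψ a k

end LorentzNum

namespace LorentzNumC

/-- The coordinates `(u, v)` of `u + σ v`. -/
def toProd : LorentzNumC →ₗ[ℝ] ℂ × ℂ where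
  toFun a := (a.re, a.im)
  map_add' _ _ := rfl
  map_smul' _ _ := rfl

theorem toProd_injective : Function.Injective toProd := fun a b h => by
  ext1
  · exact congrArg Prod.fst h
  · exact congrArg Prod.snd h

instance : NormedAddCommGroup LorentzNumC :=
  NormedAddCommGroup.induced LorentzNumC (ℂ × ℂ) toProd toProd_injective

instance : NormedSpace ℝ LorentzNumC := NormedSpace.induced ℝ LorentzNumC (ℂ × ℂ) toProd

/-- The element `σ`. -/
def sigma : LorentzNumC := ⟨0, 1⟩

/-- The complex unit `i`. -/
def i : LorentzNumC := ⟨Complex.I, 0⟩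

/-- `u + σ v ↦ u - σ v`. -/
def hat (a : LorentzNumC) : LorentzNumC := ⟨a.re, -a.im⟩

end LorentzNumC

namespace QuatLC

open LorentzNum (toC)
open LorentzNumC (sigma i)

/-- The four coefficients of a quaternion. -/
def toFun4 : QuatLC →ₗ[ℝ] (Fin 4 → LorentzNumC) where
  toFun ζ := ![ζ.re, ζ.imI, ζ.imJ, ζ.imK]
  map_add' ζ ξ := by ext j : 1; fin_cases j <;> simp
  map_smul' r ζ := by ext j : 1; fin_cases j <;> simp

theorem toFun4_injective : Function.Injective toFun4 := fun ζ ξ h => by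
  have h' : ∀ j, toFun4 ζ j = toFun4 ξ j := fun j => congrFun h j
  exact QuaternionAlgebra.ext (h' 0) (h' 1) (h' 2) (h' 3)

instance : NormedAddCommGroup QuatLC :=
  NormedAddCommGroup.induced QuatLC (Fin 4 → LorentzNumC) toFun4 toFun4_injective

instance : NormedSpace ℝ QuatLC := NormedSpace.induced ℝ QuatLC (Fin 4 → LorentzNumC) toFun4

/-- The quaternion unit `I`. -/
def unitI : QuatLC := ⟨0, 1, 0, 0⟩
/-- The quaternion unit `J`. -/
def unitJ : QuatLC := ⟨0, 0, 1, 0⟩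
/-- The quaternion unit `K`. -/
def unitK : QuatLC := ⟨0, 0, 0, 1⟩

theorem unit_relations : unitI * unitI = -1 ∧ unitJ * unitJ = -1 ∧ unitK * unitK = -1 ∧
    unitI * unitJ = unitK ∧ unitJ * unitI = -unitK := by
  refine ⟨?_, ?_, ?_, ?_, ?_⟩ <;> ext1 <;> simp only [Quaternion.re_mul, Quaternion.imI_mul, Quaternion.imJ_mul,
    Quaternion.imK_mul, Quaternion.re_neg, Quaternion.imI_neg, Quaternion.imJ_neg, Quaternion.imK_neg,
    Quaternion.re_one, Quaternion.imI_one, Quaternion.imJ_one, Quaternion.imK_one] <;>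
    simp [unitI, unitJ, unitK]

/-- `ζ ↦ ζ̂`, coefficientwise. The conjugate `ζ̄` is `star ζ`. -/
def hat (ζ : QuatLC) : QuatLC :=
  ⟨LorentzNumC.hat ζ.re, LorentzNumC.hat ζ.imI, LorentzNumC.hat ζ.imJ, LorentzNumC.hat ζ.imK⟩

/-- The bilinear form `H(ζ, ζ') = (ζ ζ̄' + ζ' ζ̄) / 2`, in coefficients. -/
def formH (ζ ζ' : QuatLC) : LorentzNumC :=
  ζ.re * ζ'.re + ζ.imI * ζ'.imI + ζ.imJ * ζ'.imJ + ζ.imK * ζ'.imK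

theorem two_formH (ζ ζ' : QuatLC) :
    ζ * star ζ' + ζ' * star ζ = ((2 * formH ζ ζ' : LorentzNumC) : QuatLC) := by
  ext1 <;> simp only [Quaternion.re_mul, Quaternion.imI_mul, Quaternion.imJ_mul,
    Quaternion.imK_mul, Quaternion.re_add, Quaternion.imI_add, Quaternion.imJ_add, Quaternion.imK_add,
    Quaternion.re_star, Quaternion.imI_star, Quaternion.imJ_star, Quaternion.imK_star,
    Quaternion.re_coe, Quaternion.imI_coe, Quaternion.imJ_coe, Quaternion.imK_coe, formH] <;> ring

/-- `H_0 = {p₀ 1 + i p₁ I + p₂ J + i p₃ K}` with Lorentz numbers `p₀, p₁, p₂, p₃`. -/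
def evenPart : Set QuatLC :=
  {ζ | ∃ p₀ p₁ p₂ p₃ : LorentzNum, ζ = ⟨toC p₀, i * toC p₁, toC p₂, i * toC p₃⟩}

/-- `Spin(2,2) = {p ∈ H_0 : H(p, p) = 1}`. -/
def Spin22 : Set QuatLC := {p | p ∈ evenPart ∧ formH p p = 1}

/-- The inverse of an element of `Spin(2,2)` is its conjugate. -/
theorem mul_star_of_mem_Spin22 {p : QuatLC} (hp : p ∈ Spin22) :
    p * star p = 1 ∧ star p * p = 1 := by
  have h := hp.2
  unfold formH at h
  constructor <;> ext1 <;> simp only [Quaternion.re_mul, Quaternion.imI_mul, Quaternion.imJ_mul,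
    Quaternion.imK_mul,
    Quaternion.re_star, Quaternion.imI_star, Quaternion.imJ_star, Quaternion.imK_star,
    Quaternion.re_one, Quaternion.imI_one, Quaternion.imJ_one, Quaternion.imK_one] <;>
    first | ring1 | exact Eq.trans (by ring1) h

/-- The Clifford map: the vector `x` of `ℝ^{2,2}` as the element
`σ i x₀ 1 + x₁ I + i x₂ J + x₃ K`. -/
def vec (x : Fin 4 → ℝ) : QuatLC :=
  ⟨toC ⟨0, x 0⟩ * i, toC ⟨x 1, 0⟩, i * toC ⟨x 2, 0⟩, toC ⟨x 3, 0⟩⟩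

/-- The Clifford product of two vectors, as an element of `Cl_0(2,2) ≃ H_0`: the product of the
antidiagonal matrices with rows `(0, q), (q̂, 0)` and `(0, q'), (q̂', 0)` is `diag (q q̂', q̂ q')`. -/
def cliffordMul (x y : Fin 4 → ℝ) : QuatLC := vec x * hat (vec y)

/-- The Clifford relation `x · x = -⟨x, x⟩`. -/
theorem cliffordMul_self (x : Fin 4 → ℝ) :
    cliffordMul x x =
      (-(-(x 0) ^ 2 + (x 1) ^ 2 - (x 2) ^ 2 + (x 3) ^ 2) : ℝ) • (1 : QuatLC) := by
  ext1 <;> ext1 <;> simp only [cliffordMul, Quaternion.re_mul, Quaternion.imI_mul, Quaternion.imJ_mul,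
    Quaternion.imK_mul, Quaternion.re_smul, Quaternion.imI_smul, Quaternion.imJ_smul, Quaternion.imK_smul,
    Quaternion.re_one, Quaternion.imI_one, Quaternion.imJ_one, Quaternion.imK_one] <;>
    simp [vec, hat, LorentzNumC.hat, toC, i, Complex.ext_iff, QuadraticAlgebra.re_one,
      QuadraticAlgebra.im_one, pow_two] <;> ring

/-- Clifford action of an odd element `q` on a spinor `ξ ∈ H_0`: `σ i q ξ̂`. -/
def cliffordAct (q ξ : QuatLC) : QuatLC := (sigma * i) • (q * hat ξ)

/-- The pairing `⟨⟨ξ, ξ'⟩⟩ = σ i ξ̄' ξ`. -/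
def pairing (ξ ξ' : QuatLC) : QuatLC := (sigma * i) • (star ξ' * ξ)

/-- The exterior product `Λ² × Λ² → Λ⁴ ≃ ℝ` on bivectors of `ℝ^{2,2}`, the bivectors being the
imaginary elements of `H_0`: here `iI, σiI, J, σJ, iK, σiK` are `e₂∧e₃, e₀∧e₁, e₃∧e₁, e₂∧e₀,
e₁∧e₂, e₀∧e₃` and `e₀∧e₁∧e₂∧e₃` is `1`; see `wedge_cliffordMul`. -/
def wedge (ξ η : QuatLC) : ℝ :=
  (ξ.imI.re.im * η.imI.im.im + ξ.imI.im.im * η.imI.re.im)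
    - (ξ.imJ.re.re * η.imJ.im.re + ξ.imJ.im.re * η.imJ.re.re)
    + (ξ.imK.re.im * η.imK.im.im + ξ.imK.im.im * η.imK.re.im)

/-- `(x ∧ y) ∧ (z ∧ w) = det (x, y, z, w) e₀∧e₁∧e₂∧e₃` (for orthogonal `x, y` the Clifford product
`x · y` is the bivector `x ∧ y`; in general they differ by a scalar, which `wedge` ignores). -/
theorem wedge_cliffordMul (x y z w : Fin 4 → ℝ) :
    wedge (cliffordMul x y) (cliffordMul z w) = (Matrix.of ![x, y, z, w]).det := by
  simp only [wedge, cliffordMul, Quaternion.imI_mul, Quaternion.imJ_mul,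
    Quaternion.imK_mul]
  simp [vec, hat, LorentzNumC.hat, toC, i, Matrix.det_succ_row_zero, Fin.sum_univ_succ,
    Fin.succAbove]
  ring

/-- `cosh ψ J + i sinh ψ K`. -/
def coshSinh (ψ : LorentzNum) : QuatLC :=
  toC (LorentzNum.cosh ψ) • unitJ + (i * toC (LorentzNum.sinh ψ)) • unitK

/-- `sinh ψ J + i cosh ψ K`. -/
def sinhCosh (ψ : LorentzNum) : QuatLC :=
  toC (LorentzNum.sinh ψ) • unitJ + (i * toC (LorentzNum.cosh ψ)) • unitK

end QuatLC

/-! ### Lorentzian metrics, connections and adapted frames -/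

/-- The model space of surfaces and of bundles of rank `2`. -/
abbrev Plane : Type := EuclideanSpace ℝ (Fin 2)

section Bundles

variable {M : Type*} [TopologicalSpace M] [ChartedSpace Plane M] [IsManifold (𝓡 2) ∞ M]

/-- A smooth fibre metric of signature `(1,1)` on a bundle of rank `2`. -/
structure LorentzMetric (V : M → Type*) [TopologicalSpace (TotalSpace Plane V)]
    [∀ x, AddCommGroup (V x)] [∀ x, Module ℝ (V x)] [∀ x, TopologicalSpace (V x)]
    [∀ x, IsTopologicalAddGroup (V x)] [∀ x, ContinuousSMul ℝ (V x)]
    [FiberBundle Plane V] [VectorBundle ℝ Plane V] where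
  inner (x : M) : V x →L[ℝ] V x →L[ℝ] ℝ
  symm (x : M) (v w : V x) : inner x v w = inner x w v
  exists_neg (x : M) : ∃ v : V x, inner x v v < 0
  exists_pos (x : M) : ∃ v : V x, 0 < inner x v v
  contMDiff : ContMDiff (𝓡 2) ((𝓡 2).prod 𝓘(ℝ, Plane →L[ℝ] Plane →L[ℝ] ℝ)) ∞
    (fun x ↦ TotalSpace.mk' (Plane →L[ℝ] Plane →L[ℝ] ℝ) x (inner x))

/-- The sections `s, t` are smooth and `|s|² = -1`, `|t|² = 1`, `⟨s, t⟩ = 0`. -/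
structure LorentzMetric.IsOrthonormalFrame {V : M → Type*} [TopologicalSpace (TotalSpace Plane V)]
    [∀ x, AddCommGroup (V x)] [∀ x, Module ℝ (V x)] [∀ x, TopologicalSpace (V x)]
    [∀ x, IsTopologicalAddGroup (V x)] [∀ x, ContinuousSMul ℝ (V x)]
    [FiberBundle Plane V] [VectorBundle ℝ Plane V]
    (b : LorentzMetric V) (s t : Π x : M, V x) : Prop where
  smooth_left : ContMDiff (𝓡 2) ((𝓡 2).prod 𝓘(ℝ, Plane)) ∞ (fun x ↦ TotalSpace.mk' Plane x (s x))
  smooth_right : ContMDiff (𝓡 2) ((𝓡 2).prod 𝓘(ℝ, Plane)) ∞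
    (fun x ↦ TotalSpace.mk' Plane x (t x))
  left_self (x : M) : b.inner x (s x) (s x) = -1
  right_self (x : M) : b.inner x (t x) (t x) = 1
  left_right (x : M) : b.inner x (s x) (t x) = 0

/-- `X ⟨s, t⟩ = ⟨∇_X s, t⟩ + ⟨s, ∇_X t⟩` (`∇_X s` at `x` is `cov s x X`). -/
def LorentzMetric.IsCompatible {V : M → Type*} [TopologicalSpace (TotalSpace Plane V)]
    [∀ x, AddCommGroup (V x)] [∀ x, Module ℝ (V x)] [∀ x, TopologicalSpace (V x)]
    [∀ x, IsTopologicalAddGroup (V x)] [∀ x, ContinuousSMul ℝ (V x)]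
    [FiberBundle Plane V] [VectorBundle ℝ Plane V]
    (b : LorentzMetric V) (cov : CovariantDerivative (𝓡 2) Plane V) : Prop :=
  ∀ (s t : Π x : M, V x) (x : M) (X : TangentSpace (𝓡 2) x),
    MDifferentiableAt (𝓡 2) ((𝓡 2).prod 𝓘(ℝ, Plane)) (fun y ↦ TotalSpace.mk' Plane y (s y)) x →
    MDifferentiableAt (𝓡 2) ((𝓡 2).prod 𝓘(ℝ, Plane)) (fun y ↦ TotalSpace.mk' Plane y (t y)) x →
    mvfderiv (𝓡 2) (fun y ↦ b.inner y (s y) (t y)) x X =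
      b.inner x (cov s x X) (t x) + b.inner x (s x) (cov t x X)

end Bundles

/-- A surface `M` with a Lorentzian metric and its Levi-Civita connection, a bundle `E` of rank `2`
on `M` with a Lorentzian fibre metric and a compatible connection, and orthonormal frames
`(e₂, e₃)` of `TM` and `(e₀, e₁)` of `E` with `e₂`, `e₀` timelike. `TM` and `E` carry the
orientations in space and in time for which these frames are positively oriented. -/
structure FramedLorentzSurface (M : Type*) [TopologicalSpace M] [ChartedSpace Plane M]
    [IsManifold (𝓡 2) ∞ M] (E : M → Type*) [TopologicalSpace (TotalSpace Plane E)]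
    [∀ x, AddCommGroup (E x)] [∀ x, Module ℝ (E x)] [∀ x, TopologicalSpace (E x)]
    [∀ x, IsTopologicalAddGroup (E x)] [∀ x, ContinuousSMul ℝ (E x)]
    [FiberBundle Plane E] [VectorBundle ℝ Plane E] where
  metM : LorentzMetric (fun x : M ↦ TangentSpace (𝓡 2) x)
  covM : CovariantDerivative (𝓡 2) Plane (fun x : M ↦ TangentSpace (𝓡 2) x)
  compatM : metM.IsCompatible covM
  torsionM : covM.torsion = 0
  metE : LorentzMetric E
  covE : CovariantDerivative (𝓡 2) Plane E
  compatE : metE.IsCompatible covE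
  e₀ : Π x : M, E x
  e₁ : Π x : M, E x
  e₂ : Π x : M, TangentSpace (𝓡 2) x
  e₃ : Π x : M, TangentSpace (𝓡 2) x
  frameE : metE.IsOrthonormalFrame e₀ e₁
  frameM : metM.IsOrthonormalFrame e₂ e₃

/-- A Lorentz structure on a surface: a smooth family of `σ_x : T_xM → T_xM` with `σ_x² = id` and
`σ_x ≠ ± id`. -/
structure LorentzStructure (M : Type*) [TopologicalSpace M] [ChartedSpace Plane M]
    [IsManifold (𝓡 2) ∞ M] where
  toFun (x : M) : TangentSpace (𝓡 2) x →L[ℝ] TangentSpace (𝓡 2) x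
  sq (x : M) (X : TangentSpace (𝓡 2) x) : toFun x (toFun x X) = X
  ne_id (x : M) : toFun x ≠ ContinuousLinearMap.id ℝ _
  ne_neg_id (x : M) : toFun x ≠ -ContinuousLinearMap.id ℝ _
  contMDiff : ContMDiff (𝓡 2) ((𝓡 2).prod 𝓘(ℝ, Plane →L[ℝ] Plane)) ∞
    (fun x ↦ TotalSpace.mk' (Plane →L[ℝ] Plane)
      (E := fun x : M ↦ TangentSpace (𝓡 2) x →L[ℝ] TangentSpace (𝓡 2) x) x (toFun x))

namespace LorentzStructure

variable {M : Type*} [TopologicalSpace M] [ChartedSpace Plane M] [IsManifold (𝓡 2) ∞ M]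

/-- `f : M → H^{A_C}` is conformal: `df (σ X) = σ df (X)`. -/
def IsConformal (τ : LorentzStructure M) (f : M → QuatLC) : Prop :=
  ∀ (x : M) (X : TangentSpace (𝓡 2) x),
    mvfderiv (𝓡 2) f x (τ.toFun x X) = LorentzNumC.sigma • mvfderiv (𝓡 2) f x X

/-- `c` is a chart, with values in the Lorentz numbers, of the Lorentz structure. -/
structure IsChart (τ : LorentzStructure M) (c : OpenPartialHomeomorph M LorentzNum) : Prop where
  smooth : ContMDiffOn (𝓡 2) 𝓘(ℝ, LorentzNum) ∞ c c.source
  smooth_symm : ContMDiffOn 𝓘(ℝ, LorentzNum) (𝓡 2) ∞ c.symm c.target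
  conformal : ∀ x ∈ c.source, ∀ X : TangentSpace (𝓡 2) x,
    mvfderiv (𝓡 2) c x (τ.toFun x X) = LorentzNum.sigma * mvfderiv (𝓡 2) c x X

end LorentzStructure

section Charts

variable {M : Type*} [TopologicalSpace M]

/-- The derivative `g'` of `g` in the chart `a = c`, defined by `dg = g' da`, as a function of `a`:
its value is `dg (∂_u)`. -/
def chartDeriv (g : M → QuatLC) (c : OpenPartialHomeomorph M LorentzNum) (a : LorentzNum) :
    QuatLC :=
  fderiv ℝ (g ∘ c.symm) a 1

/-- `g' g⁻¹` in the chart `c`, as a function of `a`. -/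
def chartLogDeriv (g : M → QuatLC) (c : OpenPartialHomeomorph M LorentzNum) (a : LorentzNum) :
    QuatLC :=
  chartDeriv g c a * star (g (c.symm a))

/-- `H(g', g') ≡ 1` or `H(g', g') ≡ -1` in the chart `c`. -/
def IsNormalizedChart (g : M → QuatLC) (c : OpenPartialHomeomorph M LorentzNum) : Prop :=
  (∀ a ∈ c.target, QuatLC.formH (chartDeriv g c a) (chartDeriv g c a) = 1) ∨
    (∀ a ∈ c.target, QuatLC.formH (chartDeriv g c a) (chartDeriv g c a) = -1)

end Charts

namespace FramedLorentzSurface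

variable {M : Type*} [TopologicalSpace M] [ChartedSpace Plane M]
  [IsManifold (𝓡 2) ∞ M] {E : M → Type*} [TopologicalSpace (TotalSpace Plane E)]
  [∀ x, AddCommGroup (E x)] [∀ x, Module ℝ (E x)] [∀ x, TopologicalSpace (E x)]
  [∀ x, IsTopologicalAddGroup (E x)] [∀ x, ContinuousSMul ℝ (E x)]
  [FiberBundle Plane E] [VectorBundle ℝ Plane E]

/-- The frame `(e₀, e₁, e₂, e₃)` is parallel. -/
def IsParallel (S : FramedLorentzSurface M E) : Prop :=
  ∀ (x : M) (X : TangentSpace (𝓡 2) x),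
    S.covE S.e₀ x X = 0 ∧ S.covE S.e₁ x X = 0 ∧ S.covM S.e₂ x X = 0 ∧ S.covM S.e₃ x X = 0

/-- The odd Clifford element `[X]` representing a tangent vector in a spinorial frame above
`(e₀, e₁, e₂, e₃)`. -/
def tangentCoord (S : FramedLorentzSurface M E) (x : M) (X : TangentSpace (𝓡 2) x) : QuatLC :=
  QuatLC.vec ![0, 0, -S.metM.inner x X (S.e₂ x), S.metM.inner x X (S.e₃ x)]

/-- The odd Clifford element `[ν]` representing a vector of `E` in a spinorial frame above
`(e₀, e₁, e₂, e₃)`. -/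
def normalCoord (S : FramedLorentzSurface M E) (x : M) (ν : E x) : QuatLC :=
  QuatLC.vec ![-S.metE.inner x ν (S.e₀ x), S.metE.inner x ν (S.e₁ x), 0, 0]

/-- Let `φ = [s̃, g]` be a spinor field, section of `ΣE ⊗ ΣM`, written in a spinorial frame `s̃`
above `(e₀, e₁, e₂, e₃)`. This is the component in `s̃` of `∇_X φ`, for the spinorial connection
`∇ = d + ½ ∑_{i<j} ε_i ε_j ⟨∇e_i, e_j⟩ e_i · e_j`; the elements `e₀ · e₁`, `e₂ · e₃` are `σiI`,
`iI`. -/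
def spinorDeriv (S : FramedLorentzSurface M E) (g : M → QuatLC) (x : M)
    (X : TangentSpace (𝓡 2) x) : QuatLC :=
  mvfderiv (𝓡 2) g x X
    - (1 / 2 : ℝ) •
      ((S.metE.inner x (S.covE S.e₀ x X) (S.e₁ x) •
            ((LorentzNumC.sigma * LorentzNumC.i) • QuatLC.unitI)
          + S.metM.inner x (S.covM S.e₂ x X) (S.e₃ x) • (LorentzNumC.i • QuatLC.unitI)) * g x)

/-- The component in `s̃` of `D φ = -e₂ · ∇_{e₂} φ + e₃ · ∇_{e₃} φ`. -/
def dirac (S : FramedLorentzSurface M E) (g : M → QuatLC) (x : M) : QuatLC :=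
  -QuatLC.cliffordAct (S.tangentCoord x (S.e₂ x)) (S.spinorDeriv g x (S.e₂ x))
    + QuatLC.cliffordAct (S.tangentCoord x (S.e₃ x)) (S.spinorDeriv g x (S.e₃ x))

/-- `g` represents, in a spinorial frame above `(e₀, e₁, e₂, e₃)`, a smooth spinor field `φ` with
`H(φ, φ) = 1` and `D φ = Hvec · φ`. -/
structure IsDiracSolution (S : FramedLorentzSurface M E) (Hvec : Π x : M, E x)
    (g : M → QuatLC) : Prop where
  smooth : ContMDiff (𝓡 2) 𝓘(ℝ, QuatLC) ∞ g
  mem_spin : ∀ x, g x ∈ QuatLC.Spin22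
  eq : ∀ x, S.dirac g x = QuatLC.cliffordAct (S.normalCoord x (Hvec x)) (g x)

/-- `ξ(X) = ⟨⟨X · φ, φ⟩⟩` for tangent vectors `X`. -/
def weierstrassForm (S : FramedLorentzSurface M E) (g : M → QuatLC) (x : M)
    (X : TangentSpace (𝓡 2) x) : QuatLC :=
  QuatLC.pairing (QuatLC.cliffordAct (S.tangentCoord x X) (g x)) (g x)

/-- `F` is the immersion into `ℝ^{2,2}` defined by `φ`: `dF = ξ`. -/
structure IsImmersionOf (S : FramedLorentzSurface M E) (g : M → QuatLC)
    (F : M → Fin 4 → ℝ) : Prop where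
  smooth : ContMDiff (𝓡 2) 𝓘(ℝ, Fin 4 → ℝ) ∞ F
  eq : ∀ (x : M) (X : TangentSpace (𝓡 2) x),
    QuatLC.vec (mvfderiv (𝓡 2) F x X) = S.weierstrassForm g x X

/-- The Gauss map `G = u₁ · u₂` of `F`, where `u₁ = dF(e₂)`, `u₂ = dF(e₃)` is a positively oriented
orthonormal basis of the tangent plane with `|u₁|² = -|u₂|² = -1`. -/
def gaussMap (S : FramedLorentzSurface M E) (F : M → Fin 4 → ℝ) (x : M) : QuatLC :=
  QuatLC.cliffordMul (mvfderiv (𝓡 2) F x (S.e₂ x)) (mvfderiv (𝓡 2) F x (S.e₃ x))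

/-- The symmetric bilinear form of the quadratic form `δ(X) = ½ dG(X) ∧ dG(X)`. -/
def deltaForm (S : FramedLorentzSurface M E) (F : M → Fin 4 → ℝ) (x : M)
    (X Y : TangentSpace (𝓡 2) x) : ℝ :=
  (1 / 2) * QuatLC.wedge (mvfderiv (𝓡 2) (S.gaussMap F) x X) (mvfderiv (𝓡 2) (S.gaussMap F) x Y)

/-- The invariant `Δ`, the determinant of `δ` with respect to the metric of `M`: the quotient of
the determinants of the matrices of `δ` and of the metric in the basis `(e₂, e₃)`. -/
def invariantDelta (S : FramedLorentzSurface M E) (F : M → Fin 4 → ℝ) (x : M) : ℝ :=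
  (S.deltaForm F x (S.e₂ x) (S.e₂ x) * S.deltaForm F x (S.e₃ x) (S.e₃ x)
      - S.deltaForm F x (S.e₂ x) (S.e₃ x) * S.deltaForm F x (S.e₃ x) (S.e₂ x))
    / (S.metM.inner x (S.e₂ x) (S.e₂ x) * S.metM.inner x (S.e₃ x) (S.e₃ x)
      - S.metM.inner x (S.e₂ x) (S.e₃ x) * S.metM.inner x (S.e₃ x) (S.e₂ x))

/-- The determinant of `(e₂, e₃)` in the basis `(∂_u, ∂_v)` of the chart `c`. -/
def chartDet (S : FramedLorentzSurface M E) (c : OpenPartialHomeomorph M LorentzNum) (x : M) : ℝ :=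
  (mvfderiv (𝓡 2) c x (S.e₂ x)).re * (mvfderiv (𝓡 2) c x (S.e₃ x)).im
    - (mvfderiv (𝓡 2) c x (S.e₂ x)).im * (mvfderiv (𝓡 2) c x (S.e₃ x)).re

/-- The chart `c` is compatible with the orientation of `M`. -/
def PreservesOrientation (S : FramedLorentzSurface M E)
    (c : OpenPartialHomeomorph M LorentzNum) : Prop :=
  ∀ x ∈ c.source, 0 < S.chartDet c x

/-- The chart `c` is compatible with the opposite orientation of `M`. -/
def ReversesOrientation (S : FramedLorentzSurface M E)
    (c : OpenPartialHomeomorph M LorentzNum) : Prop :=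
  ∀ x ∈ c.source, S.chartDet c x < 0

/-- A chart adapted to `g`: a chart of the Lorentz structure, compatible with the orientation,
with `H(g', g') ≡ ±1`. -/
structure IsAdaptedChart (S : FramedLorentzSurface M E) (τ : LorentzStructure M) (g : M → QuatLC)
    (c : OpenPartialHomeomorph M LorentzNum) : Prop where
  chart : τ.IsChart c
  orientation : S.PreservesOrientation c
  normalized : IsNormalizedChart g c

end FramedLorentzSurface

end

/-! The map g is studied through its right logarithmic derivative ω = dg g⁻¹. Since g takes values
in Spin(2,2), ω = i w I + P J + i Q K with one-forms w, P, Q valued in the Lorentz numbers. In a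
parallel frame the spinorial derivative is dg, and the J and K components of the Dirac equation say
that w = 0 (`dirac_component`). The structure equation dω = ω ∧ ω then splits (`logForm_closed`): dP
= dQ = 0, and the I component gives P ∧ Q = 0.

The Gauss map is G = g⁻¹ (iI) g, so dG = 2 g⁻¹ (Q J + i P K) g, and δ is twice the σ-part of P² -
Q². The null coordinates u + v and u - v identify the Lorentz numbers with ℝ × ℝ. On each factor P ∧
Q = 0, so P² - Q² is a signed square there, s₊ α₊² or s₋ α₋², and δ is the difference of the two.
The metric has determinant -1 in (e₂, e₃), hence Δ = s₊ s₋ (α₊ ∧ α₋)². Thus Δ > 0 means that α₊, α₋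
are independent and that the two signs agree (`forms_alternative`): P² - Q² = κ η² with κ = ±1 and η
an isomorphism onto the Lorentz numbers.

For κ = 1, write Q = f P with f² < 1 in both null coordinates. Closedness of P and Q gives df ∧ P =
0, so η = √(1 - f²) P is closed. The Poincaré lemma and the inverse function theorem give a
coordinate a with da = η (`exists_chart_of_closed_forms`). For κ = -1 the roles of P and Q are
exchanged. In either case ω = (m J + i n K) da with m² - n² = κ, that is, H(g', g') = κ.

Since da = κ (m P - n Q) is recovered linearly from ω, multiplication by σ in such coordinates does
not depend on the coordinate. This defines the Lorentz structure (`exists_lorentzStructure`), for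
which g, and hence G, is conformal; injectivity of dG makes it unique. A change of adapted charts
has derivative k with k² = ±1. As -1 is not a square of a Lorentz number, k is ±1 or ±σ, and the
orientation excludes ±σ, whose norm is -1.

Finally m and n are conformal, and m² - n² = 1 is a pair of real hyperbolas. The signs of their
branches, constant on a connected domain, assemble into ε, and ψ is arsinh (ε n) in each null
coordinate (`exists_hyperbolic_param`). As ε² = 1, the coordinate ε a removes ε, possibly at the
cost of the orientation. -/

noncomputable section

set_option linter.unusedSimpArgs false
set_option linter.style.longLine false

/-! ### Null coordinates on the Lorentz numbers. -/

namespace LorentzNum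

instance : FiniteDimensional ℝ LorentzNum := FiniteDimensional.of_injective toProd toProd_injective

instance : CompleteSpace LorentzNum := FiniteDimensional.complete ℝ LorentzNum

/-- The first null coordinate `u + v` of `u + σ v`, a ring homomorphism. -/
def plus : LorentzNum →ₗ[ℝ] ℝ where
  toFun a := a.re + a.im
  map_add' a b := by simp; ring
  map_smul' r a := by simp; ring

/-- The second null coordinate `u - v` of `u + σ v`, a ring homomorphism. -/
def minus : LorentzNum →ₗ[ℝ] ℝ where
  toFun a := a.re - a.im
  map_add' a b := by simp; ring
  map_smul' r a := by simp; ring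

theorem plus_apply (a : LorentzNum) : plus a = a.re + a.im := rfl
theorem minus_apply (a : LorentzNum) : minus a = a.re - a.im := rfl

@[simp] theorem plus_mul (a b : LorentzNum) : plus (a * b) = plus a * plus b := by
  simp [plus_apply]; ring
@[simp] theorem minus_mul (a b : LorentzNum) : minus (a * b) = minus a * minus b := by
  simp [minus_apply]; ring
@[simp] theorem plus_one : plus 1 = 1 := by simp [plus_apply, QuadraticAlgebra.re_one, QuadraticAlgebra.im_one]
@[simp] theorem minus_one : minus 1 = 1 := by
  simp [minus_apply, QuadraticAlgebra.re_one, QuadraticAlgebra.im_one]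
@[simp] theorem plus_sigma : plus sigma = 1 := by simp [plus_apply, sigma]
@[simp] theorem minus_sigma : minus sigma = -1 := by simp [minus_apply, sigma]
@[simp] theorem plus_pow (a : LorentzNum) (k : ℕ) : plus (a ^ k) = plus a ^ k := by
  induction k with
  | zero => simp
  | succ k ih => simp [pow_succ, ih]
@[simp] theorem minus_pow (a : LorentzNum) (k : ℕ) : minus (a ^ k) = minus a ^ k := by
  induction k with
  | zero => simp
  | succ k ih => simp [pow_succ, ih]

/-- `plus` and `minus` are ring homomorphisms which together identify the Lorentz numbers with `ℝ ×
ℝ`, so identities and inequalities are treated one factor at a time. -/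
theorem ext_pm {a b : LorentzNum} (h : plus a = plus b) (h' : minus a = minus b) : a = b := by
  simp only [plus_apply, minus_apply] at h h'
  ext <;> linarith

/-- The Lorentz number with given null coordinates. -/
def ofPM (x y : ℝ) : LorentzNum := ⟨(x + y) / 2, (x - y) / 2⟩

@[simp] theorem plus_ofPM (x y : ℝ) : plus (ofPM x y) = x := by simp [plus_apply, ofPM]; ring
@[simp] theorem minus_ofPM (x y : ℝ) : minus (ofPM x y) = y := by simp [minus_apply, ofPM]; ring

theorem isUnit_of_pm {a : LorentzNum} (h : plus a ≠ 0) (h' : minus a ≠ 0) :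
    ∃ b : LorentzNum, a * b = 1 :=
  ⟨ofPM (plus a)⁻¹ (minus a)⁻¹, ext_pm (by simp [h]) (by simp [h'])⟩

/-- Null coordinates as a continuous linear equivalence. -/
def pmEquiv : LorentzNum ≃L[ℝ] ℝ × ℝ :=
  LinearEquiv.toContinuousLinearEquiv
    { toLinearMap := plus.prod minus
      invFun := fun p => ofPM p.1 p.2
      left_inv := fun a => ext_pm (by simp) (by simp)
      right_inv := fun p => by simp }

@[simp] theorem pmEquiv_apply (a : LorentzNum) : pmEquiv a = (plus a, minus a) := rfl
@[simp] theorem pmEquiv_symm_apply (p : ℝ × ℝ) : pmEquiv.symm p = ofPM p.1 p.2 := rfl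

/-- The continuous linear form `plus`. -/
def plusL : LorentzNum →L[ℝ] ℝ := (ContinuousLinearMap.fst ℝ ℝ ℝ).comp (pmEquiv : LorentzNum →L[ℝ] ℝ × ℝ)
/-- The continuous linear form `minus`. -/
def minusL : LorentzNum →L[ℝ] ℝ := (ContinuousLinearMap.snd ℝ ℝ ℝ).comp (pmEquiv : LorentzNum →L[ℝ] ℝ × ℝ)
@[simp] theorem plusL_apply (a : LorentzNum) : plusL a = plus a := rfl
@[simp] theorem minusL_apply (a : LorentzNum) : minusL a = minus a := rfl

/-- The product of Lorentz numbers as a continuous bilinear map. -/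
def mulL : LorentzNum →L[ℝ] LorentzNum →L[ℝ] LorentzNum :=
  LinearMap.toContinuousLinearMap
    ((LinearMap.toContinuousLinearMap (E := LorentzNum) (F' := LorentzNum)).toLinearMap ∘ₗ
      LinearMap.mul ℝ LorentzNum)

@[simp] theorem mulL_apply (a b : LorentzNum) : mulL a b = a * b := rfl

/-- The extension of a real function to the Lorentz numbers, acting on null coordinates. -/
def lift (φ : ℝ → ℝ) (a : LorentzNum) : LorentzNum := ofPM (φ (plus a)) (φ (minus a))

@[simp] theorem plus_lift (φ : ℝ → ℝ) (a : LorentzNum) : plus (lift φ a) = φ (plus a) := by simp [lift]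
@[simp] theorem minus_lift (φ : ℝ → ℝ) (a : LorentzNum) : minus (lift φ a) = φ (minus a) := by
  simp [lift]

theorem lift_eq (φ : ℝ → ℝ) :
    lift φ = fun a => pmEquiv.symm (φ (plusL a), φ (minusL a)) := rfl

/-- A real function acts separately on the two null coordinates, so the derivative is multiplication
by a Lorentz number. This is why lifts of real functions are conformal. -/
theorem hasFDerivAt_lift {φ φ' : ℝ → ℝ} {a : LorentzNum}
    (h : HasDerivAt φ (φ' (plus a)) (plus a)) (h' : HasDerivAt φ (φ' (minus a)) (minus a)) :
    HasFDerivAt (lift φ) (mulL (lift φ' a)) a := by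
  have h1 : HasFDerivAt (fun a => φ (plusL a)) (φ' (plus a) • plusL) a :=
    HasDerivAt.comp_hasFDerivAt a (h₂ := φ) h plusL.hasFDerivAt
  have h2 : HasFDerivAt (fun a => φ (minusL a)) (φ' (minus a) • minusL) a :=
    HasDerivAt.comp_hasFDerivAt a (h₂ := φ) h' minusL.hasFDerivAt
  have h3 := (pmEquiv.symm.hasFDerivAt (x := (φ (plusL a), φ (minusL a)))).comp a (h1.prodMk h2)
  rw [lift_eq]
  refine h3.congr_fderiv ?_
  ext1 v
  apply ext_pm <;> simp

theorem contDiffAt_lift {φ : ℝ → ℝ} {a : LorentzNum} {k : WithTop ℕ∞}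
    (h : ContDiffAt ℝ k φ (plus a)) (h' : ContDiffAt ℝ k φ (minus a)) :
    ContDiffAt ℝ k (lift φ) a := by
  rw [lift_eq]
  exact pmEquiv.symm.contDiff.contDiffAt.comp a
    ((ContDiffAt.comp a (g := φ) h plusL.contDiff.contDiffAt).prodMk
      (ContDiffAt.comp a (g := φ) h' minusL.contDiff.contDiffAt))

@[simp] theorem plus_exp (a : LorentzNum) : plus (exp a) = Real.exp (plus a) := by
  simp [plus_apply, exp, Real.exp_add, Real.cosh_eq, Real.sinh_eq]; ring
@[simp] theorem minus_exp (a : LorentzNum) : minus (exp a) = Real.exp (minus a) := by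
  simp [minus_apply, exp, sub_eq_add_neg, Real.exp_add, Real.cosh_eq, Real.sinh_eq]; ring
@[simp] theorem plus_cosh (a : LorentzNum) : plus (cosh a) = Real.cosh (plus a) := by
  simp [cosh, Real.cosh_eq]; ring
@[simp] theorem minus_cosh (a : LorentzNum) : minus (cosh a) = Real.cosh (minus a) := by
  simp [cosh, Real.cosh_eq]; ring
@[simp] theorem plus_sinh (a : LorentzNum) : plus (sinh a) = Real.sinh (plus a) := by
  simp [sinh, Real.sinh_eq]; ring
@[simp] theorem minus_sinh (a : LorentzNum) : minus (sinh a) = Real.sinh (minus a) := by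
  simp [sinh, Real.sinh_eq]; ring

theorem contDiff_mul {E : Type*} [NormedAddCommGroup E] [NormedSpace ℝ E] {k : WithTop ℕ∞}
    {f g : E → LorentzNum} {x : E} (hf : ContDiffAt ℝ k f x) (hg : ContDiffAt ℝ k g x) :
    ContDiffAt ℝ k (fun y => f y * g y) x :=
  ((mulL.contDiff.contDiffAt).comp x hf).clm_apply hg

end LorentzNum

namespace LorentzNumC

instance : FiniteDimensional ℝ LorentzNumC :=
  FiniteDimensional.of_injective toProd toProd_injective

end LorentzNumC

/-! ### Coordinates on the even part H₀. -/

namespace QuatLC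

open LorentzNum (toC mulL)
open LorentzNumC (sigma i)

instance : FiniteDimensional ℝ QuatLC := FiniteDimensional.of_injective toFun4 toFun4_injective
/-- The product of quaternions as a continuous real bilinear map. -/
def mulL : QuatLC →L[ℝ] QuatLC →L[ℝ] QuatLC :=
  LinearMap.toContinuousLinearMap
    ((LinearMap.toContinuousLinearMap (E := QuatLC) (F' := QuatLC)).toLinearMap ∘ₗ
      LinearMap.mk₂ ℝ (fun a b : QuatLC => a * b) add_mul
        (fun r a b => by
          ext1 <;> simp only [Quaternion.re_mul, Quaternion.imI_mul, Quaternion.imJ_mul,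
      Quaternion.imK_mul, Quaternion.re_add, Quaternion.imI_add, Quaternion.imJ_add,
      Quaternion.imK_add, Quaternion.re_smul, Quaternion.imI_smul, Quaternion.imJ_smul,
      Quaternion.imK_smul, Quaternion.re_star, Quaternion.imI_star, Quaternion.imJ_star,
      Quaternion.imK_star, smul_mul_assoc, mul_smul_comm, smul_add,
            smul_sub])
        mul_add
        (fun r a b => by
          ext1 <;> simp only [Quaternion.re_mul, Quaternion.imI_mul, Quaternion.imJ_mul,
      Quaternion.imK_mul, Quaternion.re_add, Quaternion.imI_add, Quaternion.imJ_add,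
      Quaternion.imK_add, Quaternion.re_smul, Quaternion.imI_smul, Quaternion.imJ_smul,
      Quaternion.imK_smul, Quaternion.re_star, Quaternion.imI_star, Quaternion.imJ_star,
      Quaternion.imK_star, smul_mul_assoc, mul_smul_comm, smul_add,
            smul_sub]))

@[simp] theorem mulL_apply (a b : QuatLC) : mulL a b = a * b := rfl

/-- The quaternionic conjugation as a continuous linear map. -/
def starL : QuatLC →L[ℝ] QuatLC :=
  LinearMap.toContinuousLinearMap
    { toFun := fun a => star a
      map_add' := fun a b => star_add a b
      map_smul' := fun r a => by
        ext1 <;> simp }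

@[simp] theorem starL_apply (a : QuatLC) : starL a = star a := rfl

/-- The element `p₀ + i p₁ I + p₂ J + i p₃ K` of `H_0`. -/
def even (p₀ p₁ p₂ p₃ : LorentzNum) : QuatLC := ⟨toC p₀, i * toC p₁, toC p₂, i * toC p₃⟩

/-- The coefficient `p₀` of an element `p₀ + i p₁ I + p₂ J + i p₃ K`. -/
def coef₀ : QuatLC →L[ℝ] LorentzNum := LinearMap.toContinuousLinearMap
  { toFun := fun ζ => ⟨ζ.re.re.re, ζ.re.im.re⟩
    map_add' := fun _ _ => by ext <;> simp
    map_smul' := fun _ _ => by ext <;> simp }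
/-- The coefficient `p₁` of an element `p₀ + i p₁ I + p₂ J + i p₃ K`. -/
def coef₁ : QuatLC →L[ℝ] LorentzNum := LinearMap.toContinuousLinearMap
  { toFun := fun ζ => ⟨ζ.imI.re.im, ζ.imI.im.im⟩
    map_add' := fun _ _ => by ext <;> simp
    map_smul' := fun _ _ => by ext <;> simp }
/-- The coefficient `p₂` of an element `p₀ + i p₁ I + p₂ J + i p₃ K`. -/
def coef₂ : QuatLC →L[ℝ] LorentzNum := LinearMap.toContinuousLinearMap
  { toFun := fun ζ => ⟨ζ.imJ.re.re, ζ.imJ.im.re⟩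
    map_add' := fun _ _ => by ext <;> simp
    map_smul' := fun _ _ => by ext <;> simp }
/-- The coefficient `p₃` of an element `p₀ + i p₁ I + p₂ J + i p₃ K`. -/
def coef₃ : QuatLC →L[ℝ] LorentzNum := LinearMap.toContinuousLinearMap
  { toFun := fun ζ => ⟨ζ.imK.re.im, ζ.imK.im.im⟩
    map_add' := fun _ _ => by ext <;> simp
    map_smul' := fun _ _ => by ext <;> simp }

@[simp] theorem coef₀_even (a b c d : LorentzNum) : coef₀ (even a b c d) = a := by
  ext <;> simp [coef₀, even, toC]
@[simp] theorem coef₁_even (a b c d : LorentzNum) : coef₁ (even a b c d) = b := by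
  ext <;> simp [coef₁, even, toC, i]
@[simp] theorem coef₂_even (a b c d : LorentzNum) : coef₂ (even a b c d) = c := by
  ext <;> simp [coef₂, even, toC]
@[simp] theorem coef₃_even (a b c d : LorentzNum) : coef₃ (even a b c d) = d := by
  ext <;> simp [coef₃, even, toC, i]

theorem even_mem (a b c d : LorentzNum) : even a b c d ∈ evenPart := ⟨a, b, c, d, rfl⟩

theorem eq_even {ζ : QuatLC} (h : ζ ∈ evenPart) :
    ζ = even (coef₀ ζ) (coef₁ ζ) (coef₂ ζ) (coef₃ ζ) := by
  obtain ⟨a, b, c, d, rfl⟩ := h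
  change even a b c d = _
  rw [show (⟨toC a, i * toC b, toC c, i * toC d⟩ : QuatLC) = even a b c d from rfl]
  simp

theorem even_add (a b c d a' b' c' d' : LorentzNum) :
    even a b c d + even a' b' c' d' = even (a + a') (b + b') (c + c') (d + d') := by
  ext1 <;> ext1 <;> simp only [Quaternion.re_mul, Quaternion.imI_mul, Quaternion.imJ_mul,
      Quaternion.imK_mul, Quaternion.re_add, Quaternion.imI_add, Quaternion.imJ_add,
      Quaternion.imK_add, Quaternion.re_smul, Quaternion.imI_smul, Quaternion.imJ_smul,
      Quaternion.imK_smul, Quaternion.re_star, Quaternion.imI_star, Quaternion.imJ_star,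
      Quaternion.imK_star] <;>
    apply Complex.ext <;> simp [even, toC, i]

theorem even_mul (a b c d a' b' c' d' : LorentzNum) :
    even a b c d * even a' b' c' d' =
      even (a * a' + b * b' - c * c' + d * d') (a * b' + b * a' + c * d' - d * c')
        (a * c' + b * d' + c * a' - d * b') (a * d' + b * c' - c * b' + d * a') := by
  ext1 <;> ext1 <;> simp only [Quaternion.re_mul, Quaternion.imI_mul, Quaternion.imJ_mul,
      Quaternion.imK_mul, Quaternion.re_add, Quaternion.imI_add, Quaternion.imJ_add,
      Quaternion.imK_add, Quaternion.re_smul, Quaternion.imI_smul, Quaternion.imJ_smul,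
      Quaternion.imK_smul, Quaternion.re_star, Quaternion.imI_star, Quaternion.imJ_star,
      Quaternion.imK_star] <;>
    apply Complex.ext <;> simp [even, toC, i] <;> ring

theorem star_even (a b c d : LorentzNum) : star (even a b c d) = even a (-b) (-c) (-d) := by
  ext1 <;> ext1 <;> simp only [Quaternion.re_mul, Quaternion.imI_mul, Quaternion.imJ_mul,
      Quaternion.imK_mul, Quaternion.re_add, Quaternion.imI_add, Quaternion.imJ_add,
      Quaternion.imK_add, Quaternion.re_smul, Quaternion.imI_smul, Quaternion.imJ_smul,
      Quaternion.imK_smul, Quaternion.re_star, Quaternion.imI_star, Quaternion.imJ_star,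
      Quaternion.imK_star] <;>
    apply Complex.ext <;> simp [even, toC, i]

theorem formH_even (a b c d a' b' c' d' : LorentzNum) :
    formH (even a b c d) (even a' b' c' d') = toC (a * a' - b * b' + c * c' - d * d') := by
  ext1 <;> apply Complex.ext <;> simp [even, toC, i, formH] <;> ring

theorem toC_smul_even (k a b c d : LorentzNum) :
    toC k • even a b c d = even (k * a) (k * b) (k * c) (k * d) := by
  ext1 <;> ext1 <;> simp only [Quaternion.re_mul, Quaternion.imI_mul, Quaternion.imJ_mul,
      Quaternion.imK_mul, Quaternion.re_add, Quaternion.imI_add, Quaternion.imJ_add,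
      Quaternion.imK_add, Quaternion.re_smul, Quaternion.imI_smul, Quaternion.imJ_smul,
      Quaternion.imK_smul, Quaternion.re_star, Quaternion.imI_star, Quaternion.imJ_star,
      Quaternion.imK_star] <;>
    apply Complex.ext <;> simp [even, toC, i]

theorem toC_sigma : toC LorentzNum.sigma = sigma := by
  ext1 <;> simp [toC, LorentzNum.sigma, sigma]

theorem toC_injective : Function.Injective toC := fun a b h => by
  have h1 := congrArg QuadraticAlgebra.re h
  have h2 := congrArg QuadraticAlgebra.im h
  simp only [toC, Complex.ofReal_inj] at h1 h2
  ext <;> assumption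

theorem toC_one : toC 1 = 1 := by
  ext1 <;> simp [toC, QuadraticAlgebra.re_one, QuadraticAlgebra.im_one]

theorem coshSinh_eq (ψ : LorentzNum) :
    coshSinh ψ = even 0 0 (LorentzNum.cosh ψ) (LorentzNum.sinh ψ) := by
  ext1 <;> ext1 <;> simp only [coshSinh, Quaternion.re_mul, Quaternion.imI_mul, Quaternion.imJ_mul,
      Quaternion.imK_mul, Quaternion.re_add, Quaternion.imI_add, Quaternion.imJ_add,
      Quaternion.imK_add, Quaternion.re_smul, Quaternion.imI_smul, Quaternion.imJ_smul,
      Quaternion.imK_smul, Quaternion.re_star, Quaternion.imI_star, Quaternion.imJ_star,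
      Quaternion.imK_star] <;>
    apply Complex.ext <;> simp [even, toC, i, unitJ, unitK]

theorem sinhCosh_eq (ψ : LorentzNum) :
    sinhCosh ψ = even 0 0 (LorentzNum.sinh ψ) (LorentzNum.cosh ψ) := by
  ext1 <;> ext1 <;> simp only [sinhCosh, Quaternion.re_mul, Quaternion.imI_mul, Quaternion.imJ_mul,
      Quaternion.imK_mul, Quaternion.re_add, Quaternion.imI_add, Quaternion.imJ_add,
      Quaternion.imK_add, Quaternion.re_smul, Quaternion.imI_smul, Quaternion.imJ_smul,
      Quaternion.imK_smul, Quaternion.re_star, Quaternion.imI_star, Quaternion.imJ_star,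
      Quaternion.imK_star] <;>
    apply Complex.ext <;> simp [even, toC, i, unitJ, unitK]

/-- On imaginary elements the exterior product is minus the σ-part of `formH`, and it inherits the
invariance of that form. -/
theorem wedge_even (b c d b' c' d' : LorentzNum) :
    wedge (even 0 b c d) (even 0 b' c' d') = (b * b' - c * c' + d * d').im := by
  simp [wedge, even, toC, i]

end QuatLC

/-! ### Closed proportional one-forms. -/

namespace LorentzNum

section Forms

variable {E : Type*} [NormedAddCommGroup E] [NormedSpace ℝ E]

theorem fderiv_clm_apply_const {P : E → E →L[ℝ] LorentzNum} {y : E}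
    (h : DifferentiableAt ℝ P y) (w : E) :
    HasFDerivAt (fun z => P z w) ((fderiv ℝ P y).flip w) y := by
  have := h.hasFDerivAt.clm_apply (hasFDerivAt_const w y)
  refine this.congr_fderiv ?_
  ext1 v; simp

/-- The derivative of the ratio of two closed proportional forms is proportional to the first. -/
theorem ratio_closed {P Q : E → E →L[ℝ] LorentzNum} {f : E → LorentzNum} {y : E}
    (hP : DifferentiableAt ℝ P y) (hQ : DifferentiableAt ℝ Q y) (hf : DifferentiableAt ℝ f y)
    (cP : ∀ v w, fderiv ℝ P y v w = fderiv ℝ P y w v)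
    (cQ : ∀ v w, fderiv ℝ Q y v w = fderiv ℝ Q y w v)
    (h : ∀ᶠ z in nhds y, ∀ w, Q z w = f z * P z w) (v w : E) :
    fderiv ℝ f y v * P y w = fderiv ℝ f y w * P y v := by
  -- Product rule for Q = f P. After antisymmetrization the derivatives of P and Q disappear and df
  -- ∧ P = 0 remains.
  have key : ∀ v w, fderiv ℝ Q y v w = fderiv ℝ f y v * P y w + f y * fderiv ℝ P y v w := by
    intro v w
    have h1 := fderiv_clm_apply_const hQ w
    have h2 : HasFDerivAt (fun z => mulL (f z) (P z w)) _ y :=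
      (mulL.hasFDerivAt.comp y hf.hasFDerivAt).clm_apply (fderiv_clm_apply_const hP w)
    have h3 : (fun z => Q z w) =ᶠ[nhds y] fun z => mulL (f z) (P z w) := by
      filter_upwards [h] with z hz using hz w
    have h4 := h1.unique (h2.congr_of_eventuallyEq h3)
    have h5 := DFunLike.congr_fun h4 v
    simp at h5
    rw [h5]; ring
  have e1 := key v w
  have e2 := key w v
  rw [cQ v w, cP v w] at e1
  have := e1.symm.trans e2
  exact add_right_cancel this

/-- Multiplication of a closed form by a function of a proportional ratio gives a closed form. -/
theorem smul_closed {P : E → E →L[ℝ] LorentzNum} {s : E → LorentzNum} {y : E}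
    (hP : DifferentiableAt ℝ P y) (hs : DifferentiableAt ℝ s y)
    (cP : ∀ v w, fderiv ℝ P y v w = fderiv ℝ P y w v)
    (cs : ∀ v w, fderiv ℝ s y v * P y w = fderiv ℝ s y w * P y v) (v w : E) :
    fderiv ℝ (fun z => (mulL (s z)).comp (P z)) y v w =
      fderiv ℝ (fun z => (mulL (s z)).comp (P z)) y w v := by
  have hd : HasFDerivAt (fun z => (mulL (s z)).comp (P z)) _ y :=
    (mulL.hasFDerivAt.comp y hs.hasFDerivAt).clm_comp hP.hasFDerivAt
  rw [hd.fderiv]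
  have e1 := cs v w
  have e2 := cP v w
  simp [e1, e2]

end Forms

end LorentzNum

/-! ### A coordinate obtained by integrating a closed form. -/

open LorentzNum

/-- A smooth map with invertible differential at every point of an open set is locally a chart. -/
theorem exists_chart_of_hasFDerivAt {E F : Type*} [NormedAddCommGroup E] [NormedSpace ℝ E]
    [CompleteSpace E] [NormedAddCommGroup F] [NormedSpace ℝ F] {O : Set E} (hO : IsOpen O)
    {c : E → F} (hc : ContDiffOn ℝ ∞ c O) {y₀ : E} (hy₀ : y₀ ∈ O)
    (hinv : ∀ y ∈ O, ∃ L : E ≃L[ℝ] F, HasFDerivAt c (L : E →L[ℝ] F) y) :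
    ∃ e : OpenPartialHomeomorph E F, y₀ ∈ e.source ∧ e.source ⊆ O ∧ (∀ y, e y = c y) ∧
      ContDiffOn ℝ ∞ e.symm e.target := by
  obtain ⟨L, hL⟩ := hinv y₀ hy₀
  have hs : HasStrictFDerivAt c (L : E →L[ℝ] F) y₀ :=
    (hc.contDiffAt (hO.mem_nhds hy₀)).hasStrictFDerivAt' hL (by simp)
  let e := (hs.toOpenPartialHomeomorph c).restrOpen O hO
  have he : ∀ y, e y = c y := fun y => rfl
  refine ⟨e, ⟨hs.mem_toOpenPartialHomeomorph_source, hy₀⟩, fun y hy => hy.2, he, fun a ha => ?_⟩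
  -- Invertibility holds on all of `O`, so the inverse is smooth at every point of the target and
  -- not only at the image of `y₀`.
  have hsrc := e.map_target ha
  obtain ⟨L', hL'⟩ := hinv _ hsrc.2
  exact (e.contDiffAt_symm ha hL' (hc.contDiffAt (hO.mem_nhds hsrc.2))).contDiffWithinAt

/-- Two closed proportional forms with ratio of square less than `1` are the components, in an
adapted coordinate, of a vector of norm one. -/
theorem exists_chart_of_closed_forms {E : Type*} [NormedAddCommGroup E] [NormedSpace ℝ E]
    [CompleteSpace E] {P Q : E → E →L[ℝ] LorentzNum} {O : Set E} (hO : IsOpen O)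
    (hP : ContDiffOn ℝ ∞ P O) (hQ : ContDiffOn ℝ ∞ Q O)
    (cP : ∀ y ∈ O, ∀ v w, fderiv ℝ P y v w = fderiv ℝ P y w v)
    (cQ : ∀ y ∈ O, ∀ v w, fderiv ℝ Q y v w = fderiv ℝ Q y w v)
    (hPQ : ∀ y ∈ O, ∀ v w, P y v * Q y w = P y w * Q y v)
    {y₀ : E} (hy₀ : y₀ ∈ O) (L : E ≃L[ℝ] LorentzNum) (hL : P y₀ = L) (f₀ : LorentzNum)
    (hf₀ : ∀ v, Q y₀ v = f₀ * P y₀ v) (hp : plus f₀ ^ 2 < 1) (hm : minus f₀ ^ 2 < 1) :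
    ∃ c : OpenPartialHomeomorph E LorentzNum, y₀ ∈ c.source ∧ c.source ⊆ O ∧
      ContDiffOn ℝ ∞ c c.source ∧ ContDiffOn ℝ ∞ c.symm c.target ∧
      ∃ m n : E → LorentzNum, ∀ y ∈ c.source, m y ^ 2 - n y ^ 2 = 1 ∧
        ∀ v, P y v = m y * fderiv ℝ c y v ∧ Q y v = n y * fderiv ℝ c y v := by
  classical
  set O₁ : Set E := O ∩ P ⁻¹' Set.range ((↑) : (E ≃L[ℝ] LorentzNum) → E →L[ℝ] LorentzNum) with hO₁
  have hO₁o : IsOpen O₁ := hP.continuousOn.isOpen_inter_preimage hO ContinuousLinearEquiv.isOpen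
  -- The vector P⁻¹(1) turns the proportionality P ∧ Q = 0 into Q = f P, with a ratio as smooth as P
  -- and Q.
  set f : E → LorentzNum := fun y => Q y ((P y).inverse 1) with hf
  have fP : ∀ y ∈ O₁, ∀ w, Q y w = f y * P y w := by
    rintro y ⟨hy, ⟨M, hM⟩⟩ w
    have h1 := hPQ y hy ((P y).inverse 1) w
    have h2 : P y ((P y).inverse 1) = 1 := by
      rw [← hM, ContinuousLinearMap.inverse_equiv]; simp
    rw [h2, one_mul] at h1
    rw [h1, mul_comm]
  have f_smooth : ContDiffOn ℝ ∞ f O₁ := by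
    intro y hy
    obtain ⟨hyO, ⟨M, hM⟩⟩ := hy
    have hPy : ContDiffAt ℝ ∞ P y := hP.contDiffAt (hO.mem_nhds hyO)
    have hQy : ContDiffAt ℝ ∞ Q y := hQ.contDiffAt (hO.mem_nhds hyO)
    have hi : ContDiffAt ℝ ∞ (fun y => (P y).inverse) y := by
      have := contDiffAt_map_inverse (𝕜 := ℝ) (n := ∞) M
      rw [hM] at this
      exact this.comp y hPy
    exact (hQy.clm_apply (hi.clm_apply contDiffAt_const)).contDiffWithinAt
  have hy₁ : y₀ ∈ O₁ := ⟨hy₀, ⟨L, hL.symm⟩⟩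
  have hff : f y₀ = f₀ := by
    have h2 : P y₀ ((P y₀).inverse 1) = 1 := by
      rw [hL, ContinuousLinearMap.inverse_equiv]; simp
    simp only [hf]
    rw [hf₀, h2, mul_one]
  set D : Set LorentzNum := {a | plus a ^ 2 < 1 ∧ minus a ^ 2 < 1} with hD
  have hDo : IsOpen D :=
    (isOpen_lt ((plusL.continuous).pow 2) continuous_const).inter
      (isOpen_lt ((minusL.continuous).pow 2) continuous_const)
  set O₂ : Set E := O₁ ∩ f ⁻¹' D with hO₂
  have hO₂o : IsOpen O₂ := f_smooth.continuousOn.isOpen_inter_preimage hO₁o hDo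
  have hy₂ : y₀ ∈ O₂ := ⟨hy₁, by rw [Set.mem_preimage, hff]; exact ⟨hp, hm⟩⟩
  -- Shrinking to a ball provides the convexity needed for the Poincaré lemma.
  obtain ⟨r, hr, hB⟩ := Metric.isOpen_iff.1 hO₂o y₀ hy₂
  set B := Metric.ball y₀ r with hBdef
  have hBo : IsOpen B := Metric.isOpen_ball
  -- the integrating factor
  set r₀ : ℝ → ℝ := fun t => Real.sqrt (1 - t ^ 2) with hr₀
  set r₁ : ℝ → ℝ := fun t => -(2 * t) / (2 * Real.sqrt (1 - t ^ 2)) with hr₁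
  have hr₀d : ∀ t : ℝ, t ^ 2 < 1 → HasDerivAt r₀ (r₁ t) t := by
    intro t ht
    have h1 : HasDerivAt (fun t : ℝ => 1 - t ^ 2) (-(2 * t)) t := by
      simpa using ((hasDerivAt_id t).pow 2).const_sub 1
    exact h1.sqrt (by linarith)
  have hr₀c : ∀ t : ℝ, t ^ 2 < 1 → ContDiffAt ℝ ∞ r₀ t := by
    intro t ht
    have h1 : ContDiffAt ℝ ∞ (fun t : ℝ => 1 - t ^ 2) t := by fun_prop
    exact h1.sqrt (by linarith)
  set s : E → LorentzNum := fun y => lift r₀ (f y) with hs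
  have s_smooth : ∀ y ∈ B, ContDiffAt ℝ ∞ s y := by
    intro y hy
    have h2 := (hB hy)
    exact (contDiffAt_lift (hr₀c _ h2.2.1) (hr₀c _ h2.2.2)).comp y
      (f_smooth.contDiffAt (hO₁o.mem_nhds h2.1))
  set η : E → E →L[ℝ] LorentzNum := fun y => (mulL (s y)).comp (P y) with hη
  have Pc : ∀ y ∈ B, ContDiffAt ℝ ∞ P y := fun y hy => hP.contDiffAt (hO.mem_nhds (hB hy).1.1)
  have Qc : ∀ y ∈ B, ContDiffAt ℝ ∞ Q y := fun y hy => hQ.contDiffAt (hO.mem_nhds (hB hy).1.1)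
  have fc : ∀ y ∈ B, ContDiffAt ℝ ∞ f y :=
    fun y hy => f_smooth.contDiffAt (hO₁o.mem_nhds (hB hy).1)
  have η_smooth : ∀ y ∈ B, ContDiffAt ℝ ∞ η y := fun y hy =>
    ((mulL.contDiff.contDiffAt).comp y (s_smooth y hy)).clm_comp (Pc y hy)
  have η_closed : ∀ y ∈ B, ∀ v w, fderiv ℝ η y v w = fderiv ℝ η y w v := by
    intro y hy
    have hyO := (hB hy).1.1
    have Pd := (Pc y hy).differentiableAt (by simp)
    have fd := (fc y hy).differentiableAt (by simp)
    -- The factor s is a function of f, so ds is a multiple of df, and df ∧ P = 0 because P and Q =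
    -- f P are both closed.
    refine smul_closed Pd ((s_smooth y hy).differentiableAt (by simp)) (cP y hyO) ?_
    intro v w
    have hfcl := ratio_closed Pd ((Qc y hy).differentiableAt (by simp)) fd (cP y hyO) (cQ y hyO)
      (Filter.eventually_of_mem (hO₁o.mem_nhds (hB hy).1) fP) v w
    have hsd : HasFDerivAt s _ y :=
      (hasFDerivAt_lift (hr₀d _ (hB hy).2.1) (hr₀d _ (hB hy).2.2)).comp y fd.hasFDerivAt
    rw [hsd.fderiv]
    simp only [ContinuousLinearMap.comp_apply, mulL_apply]
    rw [mul_assoc, hfcl, mul_assoc]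
  obtain ⟨c, hc⟩ := (convex_ball y₀ r).exists_forall_hasFDerivAt_of_fderiv_symmetric hBo
    (fun y hy => ((η_smooth y hy).differentiableAt (by simp)).differentiableWithinAt) η_closed
  have c_smooth : ContDiffOn ℝ ∞ c B := by
    rw [contDiffOn_infty_iff_fderiv_of_isOpen hBo]
    -- The primitive is smooth because its differential η is.
    refine ⟨fun y hy => (hc y hy).differentiableAt.differentiableWithinAt, ?_⟩
    intro y hy
    refine (η_smooth y hy).contDiffWithinAt.congr (fun z hz => (hc z hz).fderiv) (hc y hy).fderiv
  -- the inverse of the integrating factor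
  set q : E → LorentzNum := fun y => lift (fun t => (r₀ t)⁻¹) (f y) with hq
  have hpos : ∀ t : ℝ, t ^ 2 < 1 → r₀ t ≠ 0 := fun t ht =>
    (Real.sqrt_pos.2 (by linarith)).ne'
  have hqs : ∀ y ∈ B, q y * s y = 1 := by
    intro y hy
    have h2 := (hB hy).2
    apply ext_pm <;> simp [hq, hs, hpos _ h2.1, hpos _ h2.2]
  have hqq : ∀ y ∈ B, q y ^ 2 - (f y * q y) ^ 2 = 1 := by
    intro y hy
    have h2 := (hB hy).2
    have h3 : ∀ t : ℝ, t ^ 2 < 1 → (r₀ t)⁻¹ ^ 2 - (t * (r₀ t)⁻¹) ^ 2 = 1 := by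
      intro t ht
      have h4 := hpos t ht
      have h5 : r₀ t ^ 2 = 1 - t ^ 2 := Real.sq_sqrt (by linarith)
      field_simp
      linarith
    apply ext_pm
    · simpa [hq] using h3 _ h2.1
    · simpa [hq] using h3 _ h2.2
  obtain ⟨e, he₀, heB, hec, hesymm⟩ := exists_chart_of_hasFDerivAt hBo c_smooth
    (Metric.mem_ball_self hr) (fun y hy => by
      obtain ⟨M, hM⟩ := (hB hy).1.2
      refine ⟨M.trans (ContinuousLinearEquiv.equivOfInverse (mulL (s y)) (mulL (q y)) ?_ ?_), ?_⟩
      · intro a; simp [← mul_assoc, hqs y hy]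
      · intro a
        simp only [mulL_apply]
        rw [← mul_assoc, mul_comm (s y), hqs y hy, one_mul]
      · refine (hc y hy).congr_fderiv ?_
        ext1 v
        simp [hη, ← hM])
  have hec' : (e : E → LorentzNum) = c := funext hec
  refine ⟨e, he₀, fun y hy => (hB (heB hy)).1.1, ?_, hesymm, q, fun y => f y * q y, ?_⟩
  · rw [hec']; exact c_smooth.mono heB
  · intro y hy
    have hyB := heB hy
    refine ⟨hqq y hyB, fun v => ?_⟩
    rw [hec', (hc y hyB).fderiv]
    have h1 : P y v = q y * η y v := by
      simp only [hη, ContinuousLinearMap.comp_apply, mulL_apply]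
      rw [← mul_assoc, hqs y hyB, one_mul]
    refine ⟨h1, ?_⟩
    rw [fP y (hB hyB).1 v, h1, mul_assoc]

/-! ### The logarithmic derivative of a map into Spin(2,2). -/

namespace QuatLC

open LorentzNum (toC)

theorem mul_neg' (a b : QuatLC) : a * -b = -(a * b) := mul_neg a b

theorem mul_mem_evenPart {ζ ξ : QuatLC} (h : ζ ∈ evenPart) (h' : ξ ∈ evenPart) :
    ζ * ξ ∈ evenPart := by
  rw [eq_even h, eq_even h', even_mul]; exact even_mem _ _ _ _

theorem star_mem_evenPart {ζ : QuatLC} (h : ζ ∈ evenPart) : star ζ ∈ evenPart := by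
  rw [eq_even h, star_even]; exact even_mem _ _ _ _

theorem star_mem_Spin22 {p : QuatLC} (h : p ∈ Spin22) : star p ∈ Spin22 := by
  refine ⟨star_mem_evenPart h.1, ?_⟩
  have h2 := h.2
  rw [eq_even h.1] at h2 ⊢
  rw [star_even, formH_even]
  rw [formH_even] at h2
  rw [← h2]; congr 1; ring

/-- The projection onto `H_0`. -/
def evenProj : QuatLC →L[ℝ] QuatLC := LinearMap.toContinuousLinearMap
  { toFun := fun ζ => even (coef₀ ζ) (coef₁ ζ) (coef₂ ζ) (coef₃ ζ)
    map_add' := fun ζ ξ => by simp [even_add]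
    map_smul' := fun r ζ => by
      have h : ∀ a b c d : LorentzNum, even (r • a) (r • b) (r • c) (r • d) = r • even a b c d := by
        intro a b c d
        ext1 <;> ext1 <;> simp only [Quaternion.re_smul, Quaternion.imI_smul, Quaternion.imJ_smul,
          Quaternion.imK_smul] <;> apply Complex.ext <;> simp [even, toC, LorentzNumC.i]
      simp [h] }

theorem evenProj_mem (ζ : QuatLC) : evenProj ζ ∈ evenPart := even_mem _ _ _ _

theorem evenProj_eq {ζ : QuatLC} (h : ζ ∈ evenPart) : evenProj ζ = ζ := (eq_even h).symm

section Spin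

variable {E : Type*} [NormedAddCommGroup E] [NormedSpace ℝ E] {h : E → QuatLC} {y : E}

theorem hasFDerivAt_mul {f k : E → QuatLC} {f' k' : E →L[ℝ] QuatLC}
    (hf : HasFDerivAt f f' y) (hk : HasFDerivAt k k' y) :
    HasFDerivAt (fun z => f z * k z) ((mulL.flip (k y)).comp f' + (mulL (f y)).comp k') y := by
  have : HasFDerivAt (fun z => mulL (f z) (k z)) _ y :=
    (mulL.hasFDerivAt.comp y hf).clm_apply hk
  refine this.congr_fderiv ?_
  ext1 v
  simp [add_comm]

theorem contDiffAt_star {k : WithTop ℕ∞} (hh : ContDiffAt ℝ k h y) :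
    ContDiffAt ℝ k (fun z => star (h z)) y :=
  (starL.contDiff.contDiffAt).comp y hh

/-- The right logarithmic derivative of a map into `Spin(2,2)` is an imaginary element of `H_0`. -/
theorem logDeriv_eq_even (hh : DifferentiableAt ℝ h y)
    (hS : ∀ᶠ z in nhds y, h z ∈ Spin22) (v : E) :
    fderiv ℝ h y v * star (h y) = even 0 (coef₁ (fderiv ℝ h y v * star (h y)))
      (coef₂ (fderiv ℝ h y v * star (h y))) (coef₃ (fderiv ℝ h y v * star (h y))) := by
  have hy : h y ∈ Spin22 := hS.self_of_nhds
  -- The linear projection onto H₀ fixes h, hence also its derivative.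
  have h1 : fderiv ℝ h y v = evenProj (fderiv ℝ h y v) := by
    have e : h =ᶠ[nhds y] fun z => evenProj (h z) := by
      filter_upwards [hS] with z hz using (evenProj_eq hz.1).symm
    have h2 := (evenProj.hasFDerivAt.comp y hh.hasFDerivAt).congr_of_eventuallyEq e
    conv_lhs => rw [h2.fderiv]
    rfl
  have h3 : fderiv ℝ h y v * star (h y) ∈ evenPart := by
    rw [h1]; exact mul_mem_evenPart (evenProj_mem _) (star_mem_evenPart hy.1)
  -- The derivative of h h̄ = 1. It says that the logarithmic derivative is opposite to its
  -- conjugate, so its scalar part is zero.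
  have h4 : fderiv ℝ h y v * star (h y) + h y * star (fderiv ℝ h y v) = 0 := by
    have e : (fun z => h z * star (h z)) =ᶠ[nhds y] fun _ => 1 := by
      filter_upwards [hS] with z hz using (mul_star_of_mem_Spin22 hz).1
    have h5 := (hasFDerivAt_mul hh.hasFDerivAt (starL.hasFDerivAt.comp y hh.hasFDerivAt))
    have h6 := h5.unique ((hasFDerivAt_const (1 : QuatLC) y).congr_of_eventuallyEq e)
    simpa using DFunLike.congr_fun h6 v
  have h7 : h y * star (fderiv ℝ h y v) = star (fderiv ℝ h y v * star (h y)) := by simp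
  rw [h7] at h4
  set θ := fderiv ℝ h y v * star (h y)
  have h8 := eq_even h3
  rw [h8, star_even, even_add] at h4
  have h9 : coef₀ θ + coef₀ θ = 0 := by
    have := congrArg coef₀ h4
    simpa only [coef₀_even, map_zero] using this
  have h10 : coef₀ θ = 0 := by
    have : (2 : ℝ) • coef₀ θ = 0 := by rw [two_smul]; exact h9
    simpa using this
  rw [h10] at h8
  exact h8

theorem fderiv_eq_logDeriv_mul (hy : h y ∈ Spin22) (v : E) :
    fderiv ℝ h y v = fderiv ℝ h y v * star (h y) * h y := by
  rw [mul_assoc, (mul_star_of_mem_Spin22 hy).2, mul_one]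

/-- The logarithmic derivative of `h`, as a one-form, followed by a linear map. -/
def logForm (ℓ : QuatLC →L[ℝ] LorentzNum) (h : E → QuatLC) (y : E) : E →L[ℝ] LorentzNum :=
  (ℓ.comp (mulL.flip (star (h y)))).comp (fderiv ℝ h y)

@[simp] theorem logForm_apply (ℓ : QuatLC →L[ℝ] LorentzNum) (h : E → QuatLC) (y v : E) :
    logForm ℓ h y v = ℓ (fderiv ℝ h y v * star (h y)) := rfl

theorem contDiffOn_logForm {O : Set E} (hO : IsOpen O) (hh : ContDiffOn ℝ ∞ h O)
    (ℓ : QuatLC →L[ℝ] LorentzNum) : ContDiffOn ℝ ∞ (logForm ℓ h) O := by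
  intro y hy
  have h1 : ContDiffAt ℝ ∞ h y := hh.contDiffAt (hO.mem_nhds hy)
  have h2 : ContDiffAt ℝ ∞ (fderiv ℝ h) y := h1.fderiv_right (by simp)
  have h3 : ContDiffAt ℝ ∞ (fun z => mulL.flip (star (h z))) y :=
    (mulL.flip.contDiff.contDiffAt).comp y (contDiffAt_star h1)
  exact ((contDiffAt_const.clm_comp h3).clm_comp h2).contDiffWithinAt

/-- The structure equation of a map into `Spin(2,2)`. -/
theorem fderiv_logForm {O : Set E} (hO : IsOpen O) (hh : ContDiffOn ℝ ∞ h O)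
    (hS : ∀ z ∈ O, h z ∈ Spin22) (hy : y ∈ O) (ℓ : QuatLC →L[ℝ] LorentzNum) (v w : E) :
    fderiv ℝ (logForm ℓ h) y v w - fderiv ℝ (logForm ℓ h) y w v =
      ℓ (fderiv ℝ h y v * star (h y) * (fderiv ℝ h y w * star (h y)) -
        fderiv ℝ h y w * star (h y) * (fderiv ℝ h y v * star (h y))) := by
  have h1 : ContDiffAt ℝ ∞ h y := hh.contDiffAt (hO.mem_nhds hy)
  have h2 : ContDiffAt ℝ ∞ (fderiv ℝ h) y := h1.fderiv_right (by simp)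
  have hd := h1.differentiableAt (by simp)
  have hd2 := h2.differentiableAt (by simp)
  have key : ∀ v w, fderiv ℝ (logForm ℓ h) y v w =
      ℓ (fderiv ℝ (fderiv ℝ h) y v w * star (h y) + fderiv ℝ h y w * star (fderiv ℝ h y v)) := by
    intro v w
    have e1 : HasFDerivAt (fun z => fderiv ℝ h z w) ((fderiv ℝ (fderiv ℝ h) y).flip w) y := by
      have := hd2.hasFDerivAt.clm_apply (hasFDerivAt_const w y)
      refine this.congr_fderiv ?_
      ext1 v; simp
    have e2 := ℓ.hasFDerivAt.comp y
      (hasFDerivAt_mul e1 (starL.hasFDerivAt.comp y hd.hasFDerivAt))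
    have e3 := LorentzNum.fderiv_clm_apply_const
      (((contDiffOn_logForm hO hh ℓ).contDiffAt (hO.mem_nhds hy)).differentiableAt (by simp)) w
    simpa using DFunLike.congr_fun (e3.unique e2) v
  have sym := (h1.isSymmSndFDerivAt (by
    rw [minSmoothness_of_isRCLikeNormedField]; exact WithTop.coe_le_coe.2 le_top)).eq v w
  -- Since θ̄ = -θ, the conjugate of dh = θ h is -h̄ θ. The first-order term is thus a product of
  -- two values of θ, and the symmetric second derivative drops out of the difference.
  have hlog : ∀ v w, fderiv ℝ h y w * star (fderiv ℝ h y v) =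
      -(fderiv ℝ h y w * star (h y) * (fderiv ℝ h y v * star (h y))) := by
    intro v w
    have e1 := logDeriv_eq_even hd (Filter.eventually_of_mem (hO.mem_nhds hy) hS) v
    have e2 : star (fderiv ℝ h y v * star (h y)) = -(fderiv ℝ h y v * star (h y)) := by
      rw [e1, star_even]
      rw [eq_neg_iff_add_eq_zero, even_add]
      ext1 <;> ext1 <;> apply Complex.ext <;> simp [even, toC]
    have e3 := congrArg star (fderiv_eq_logDeriv_mul (hS y hy) v)
    rw [star_mul, e2] at e3
    rw [e3, mul_assoc]
    exact (congrArg (fderiv ℝ h y w * ·) (mul_neg' (star (h y)) _)).trans (mul_neg' _ _)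
  rw [key v w, key w v, ← map_sub, sym, hlog v w, hlog w v]
  congr 1
  abel

/-- If the logarithmic derivative has no component along `I`, its other components are closed and
proportional. -/
theorem logForm_closed {O : Set E} (hO : IsOpen O) (hh : ContDiffOn ℝ ∞ h O)
    (hS : ∀ z ∈ O, h z ∈ Spin22) (hI : ∀ z ∈ O, ∀ v, coef₁ (fderiv ℝ h z v * star (h z)) = 0)
    (hy : y ∈ O) (v w : E) :
    fderiv ℝ (logForm coef₂ h) y v w = fderiv ℝ (logForm coef₂ h) y w v ∧
    fderiv ℝ (logForm coef₃ h) y v w = fderiv ℝ (logForm coef₃ h) y w v ∧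
    logForm coef₂ h y v * logForm coef₃ h y w = logForm coef₂ h y w * logForm coef₃ h y v := by
  have hd : DifferentiableAt ℝ h y :=
    (hh.contDiffAt (hO.mem_nhds hy)).differentiableAt (by simp)
  have hω : ∀ v, fderiv ℝ h y v * star (h y) =
      even 0 0 (logForm coef₂ h y v) (logForm coef₃ h y v) := by
    intro v
    have := logDeriv_eq_even hd (Filter.eventually_of_mem (hO.mem_nhds hy) hS) v
    rwa [hI y hy v] at this
  have hS1 := fderiv_logForm hO hh hS hy coef₁ v w
  have hS2 := fderiv_logForm hO hh hS hy coef₂ v w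
  have hS3 := fderiv_logForm hO hh hS hy coef₃ v w
  rw [hω v, hω w, even_mul, even_mul, map_sub] at hS1 hS2 hS3
  simp only [coef₁_even, coef₂_even, coef₃_even] at hS1 hS2 hS3
  have hz : fderiv ℝ (logForm coef₁ h) y = 0 := by
    have e : logForm coef₁ h =ᶠ[nhds y] fun _ => 0 := by
      filter_upwards [hO.mem_nhds hy] with z hz
      ext1 v
      exact hI z hz v
    rw [e.fderiv_eq]; simp
  rw [hz] at hS1
  refine ⟨sub_eq_zero.1 (by rw [hS2]; ring), sub_eq_zero.1 (by rw [hS3]; ring), ?_⟩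
  generalize logForm coef₂ h y v = a at *
  generalize logForm coef₂ h y w = b at *
  generalize logForm coef₃ h y v = c at *
  generalize logForm coef₃ h y w = d at *
  -- Elements along J and K have their commutator along I. Its coefficient is 2 (P ∧ Q), and it
  -- vanishes with the I component of the form.
  have e : (2 : ℝ) • (a * d - b * c) = 0 := by
    rw [two_smul]
    simp only [zero_apply, sub_self] at hS1
    rw [hS1]; ring
  have e2 : a * d - b * c = 0 := by simpa using e
  exact sub_eq_zero.1 e2

/-- Local existence of an adapted coordinate. -/
theorem exists_adapted_coordinate [CompleteSpace E] {O : Set E} (hO : IsOpen O)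
    (hh : ContDiffOn ℝ ∞ h O) (hS : ∀ z ∈ O, h z ∈ Spin22)
    (hI : ∀ z ∈ O, ∀ v, coef₁ (fderiv ℝ h z v * star (h z)) = 0) {y₀ : E} (hy₀ : y₀ ∈ O)
    (halt : ∃ (L : E ≃L[ℝ] LorentzNum) (f : LorentzNum),
      LorentzNum.plus f ^ 2 < 1 ∧ LorentzNum.minus f ^ 2 < 1 ∧
      ((∀ v, logForm coef₂ h y₀ v = L v ∧ logForm coef₃ h y₀ v = f * L v) ∨
        (∀ v, logForm coef₃ h y₀ v = L v ∧ logForm coef₂ h y₀ v = f * L v))) :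
    ∃ c : OpenPartialHomeomorph E LorentzNum, y₀ ∈ c.source ∧ c.source ⊆ O ∧
      ContDiffOn ℝ ∞ c c.source ∧ ContDiffOn ℝ ∞ c.symm c.target ∧
      ∃ (m n : E → LorentzNum) (κ : LorentzNum), (κ = 1 ∨ κ = -1) ∧ ∀ y ∈ c.source,
        m y ^ 2 - n y ^ 2 = κ ∧ ∀ v, fderiv ℝ h y v * star (h y) =
          even 0 0 (m y * fderiv ℝ c y v) (n y * fderiv ℝ c y v) := by
  obtain ⟨L, f, hp, hm, hLf⟩ := halt
  have hω : ∀ y ∈ O, ∀ v, fderiv ℝ h y v * star (h y) =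
      even 0 0 (logForm coef₂ h y v) (logForm coef₃ h y v) := by
    intro y hy v
    have hd : DifferentiableAt ℝ h y :=
      (hh.contDiffAt (hO.mem_nhds hy)).differentiableAt (by simp)
    have := logDeriv_eq_even hd (Filter.eventually_of_mem (hO.mem_nhds hy) hS) v
    rwa [hI y hy v] at this
  have cl := fun y (hy : y ∈ O) v w => logForm_closed hO hh hS hI hy v w
  rcases hLf with hLf | hLf
  · obtain ⟨c, hc1, hc2, hc3, hc4, m, n, hmn⟩ := exists_chart_of_closed_forms hO
      (contDiffOn_logForm hO hh coef₂) (contDiffOn_logForm hO hh coef₃)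
      (fun y hy v w => (cl y hy v w).1) (fun y hy v w => (cl y hy v w).2.1)
      (fun y hy v w => (cl y hy v w).2.2) hy₀ L (by ext1 v; exact (hLf v).1) f
      (fun v => by rw [(hLf v).2, (hLf v).1]) hp hm
    refine ⟨c, hc1, hc2, hc3, hc4, m, n, 1, Or.inl rfl, fun y hy => ⟨(hmn y hy).1, fun v => ?_⟩⟩
    rw [hω y (hc2 hy), ((hmn y hy).2 v).1, ((hmn y hy).2 v).2]
  -- With the K component as the dominant form, the coefficients of J and K are interchanged, which
  -- changes the sign of the norm: κ = -1.
  · obtain ⟨c, hc1, hc2, hc3, hc4, m, n, hmn⟩ := exists_chart_of_closed_forms hO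
      (contDiffOn_logForm hO hh coef₃) (contDiffOn_logForm hO hh coef₂)
      (fun y hy v w => (cl y hy v w).2.1) (fun y hy v w => (cl y hy v w).1)
      (fun y hy v w => by rw [mul_comm, ← (cl y hy v w).2.2, mul_comm]) hy₀ L
      (by ext1 v; exact (hLf v).1) f (fun v => by rw [(hLf v).2, (hLf v).1]) hp hm
    refine ⟨c, hc1, hc2, hc3, hc4, n, m, -1, Or.inr rfl, fun y hy => ⟨?_, fun v => ?_⟩⟩
    · rw [← (hmn y hy).1]; ring
    · rw [hω y (hc2 hy), ((hmn y hy).2 v).1, ((hmn y hy).2 v).2]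

end Spin

end QuatLC

/-! ### Conformal functions and the hyperbola over the Lorentz numbers. -/

namespace LorentzNum

theorem eq_re_add_im (k : LorentzNum) : k = k.re • (1 : LorentzNum) + k.im • sigma := by
  ext <;> simp [sigma, QuadraticAlgebra.re_one, QuadraticAlgebra.im_one]

/-- A real linear map commuting with `σ` is linear over the Lorentz numbers. -/
theorem clm_apply_eq_mul {ℓ : LorentzNum →L[ℝ] LorentzNum}
    (h : ∀ k, ℓ (sigma * k) = sigma * ℓ k) (k : LorentzNum) : ℓ k = k * ℓ 1 := by
  have h1 : ℓ sigma = sigma * ℓ 1 := by simpa using h 1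
  conv_lhs => rw [eq_re_add_im k]
  conv_rhs => rw [eq_re_add_im k]
  rw [map_add, map_smul, map_smul, h1, add_mul, smul_mul_assoc, smul_mul_assoc, one_mul]

theorem pos_or_neg_of_isPreconnected {X : Type*} [TopologicalSpace X] {U : Set X}
    (hU : IsPreconnected U) {f : X → ℝ} (hf : ContinuousOn f U) (h0 : ∀ a ∈ U, f a ≠ 0) :
    ∃ e : ℝ, (e = 1 ∨ e = -1) ∧ ∀ a ∈ U, 0 < e * f a := by
  by_cases h : ∀ a ∈ U, 0 < f a
  · exact ⟨1, Or.inl rfl, fun a ha => by simpa using h a ha⟩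
  · push Not at h
    obtain ⟨a, ha, hfa⟩ := h
    refine ⟨-1, Or.inr rfl, fun b hb => ?_⟩
    by_contra hb'
    have h1 : 0 ≤ f b := by linarith
    obtain ⟨c, hc, hc0⟩ := hU.intermediate_value ha hb hf ⟨hfa, h1⟩
    exact h0 c hc hc0

/-- Pairs of signs in null coordinates are the square roots of one. -/
theorem sign_cases {e e' : ℝ} (h : e = 1 ∨ e = -1) (h' : e' = 1 ∨ e' = -1) :
    ofPM e e' = 1 ∨ ofPM e e' = -1 ∨ ofPM e e' = sigma ∨ ofPM e e' = -sigma := by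
  rcases h with rfl | rfl <;> rcases h' with rfl | rfl
  · exact Or.inl (ext_pm (by simp) (by simp))
  · exact Or.inr (Or.inr (Or.inl (ext_pm (by simp) (by simp))))
  · exact Or.inr (Or.inr (Or.inr (ext_pm (by simp) (by simp))))
  · exact Or.inr (Or.inl (ext_pm (by simp) (by simp)))

/-- Conformal parametrization of the branches of the hyperbola `m² - n² = 1`. -/
theorem exists_hyperbolic_param {U : Set LorentzNum} (hU : IsOpen U) (hUc : IsPreconnected U)
    {m n : LorentzNum → LorentzNum} (hm : ContinuousOn m U) (hn : ConformalOn n U)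
    (hmn : ∀ a ∈ U, m a ^ 2 - n a ^ 2 = 1) :
    ∃ (ψ : LorentzNum → LorentzNum) (e : LorentzNum), ConformalOn ψ U ∧
      (e = 1 ∨ e = -1 ∨ e = sigma ∨ e = -sigma) ∧
      ∀ a ∈ U, m a = e * cosh (ψ a) ∧ n a = e * sinh (ψ a) := by
  have hp : ∀ a ∈ U, plus (m a) ^ 2 = 1 + plus (n a) ^ 2 := fun a ha => by
    have := congrArg plus (hmn a ha)
    simp at this; linarith
  have hmi : ∀ a ∈ U, minus (m a) ^ 2 = 1 + minus (n a) ^ 2 := fun a ha => by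
    have := congrArg minus (hmn a ha)
    simp at this; linarith
  -- Each null coordinate of m has square at least 1, so it keeps a constant sign on the connected
  -- set.
  obtain ⟨e₁, he₁, h₁⟩ := pos_or_neg_of_isPreconnected hUc
    (plusL.continuous.comp_continuousOn hm) (fun a ha h0 => by
      have h1 : plus (m a) = 0 := h0
      nlinarith [hp a ha, sq_nonneg (plus (n a))])
  obtain ⟨e₂, he₂, h₂⟩ := pos_or_neg_of_isPreconnected hUc
    (minusL.continuous.comp_continuousOn hm) (fun a ha h0 => by
      have h1 : minus (m a) = 0 := h0
      nlinarith [hmi a ha, sq_nonneg (minus (n a))])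
  have es₁ : e₁ * e₁ = 1 := by rcases he₁ with rfl | rfl <;> norm_num
  have es₂ : e₂ * e₂ = 1 := by rcases he₂ with rfl | rfl <;> norm_num
  set e := ofPM e₁ e₂ with he
  have hee : e * e = 1 := ext_pm (by simp [he, es₁]) (by simp [he, es₂])
  -- As e² = 1, the product e m lies on the positive branch in both null coordinates, where it
  -- equals √(1 + (e n)²). Hence e n = sinh ψ determines ψ.
  refine ⟨fun a => lift Real.arsinh (e * n a), e, ⟨?_, ?_⟩, sign_cases he₁ he₂, ?_⟩
  · intro a ha
    have h1 : ContDiffAt ℝ ∞ n a := hn.1.contDiffAt (hU.mem_nhds ha)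
    exact ((contDiffAt_lift Real.contDiff_arsinh.contDiffAt
      Real.contDiff_arsinh.contDiffAt).comp a
      (contDiff_mul contDiffAt_const h1)).contDiffWithinAt
  · intro a ha k
    have h1 : DifferentiableAt ℝ n a :=
      (hn.1.contDiffAt (hU.mem_nhds ha)).differentiableAt (by simp)
    have h2 := (hasFDerivAt_lift (a := e * n a) (φ' := fun x => (Real.sqrt (1 + x ^ 2))⁻¹) (Real.hasDerivAt_arsinh _)
      (Real.hasDerivAt_arsinh _)).comp a
      ((mulL e).hasFDerivAt.comp a h1.hasFDerivAt)
    have h3 : HasFDerivAt (fun a => lift Real.arsinh (e * n a)) _ a := h2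
    rw [h3.fderiv]
    simp only [ContinuousLinearMap.comp_apply, mulL_apply, hn.2 a ha k]
    ring
  · intro a ha
    have aux : ∀ {x y s : ℝ}, x ^ 2 = 1 + y ^ 2 → s * s = 1 → 0 < s * x →
        x = s * Real.cosh (Real.arsinh (s * y)) ∧ y = s * Real.sinh (Real.arsinh (s * y)) := by
      intro x y s h1 h2 h3
      rw [Real.cosh_arsinh, Real.sinh_arsinh]
      have h4 : 1 + (s * y) ^ 2 = (s * x) ^ 2 := by
        rw [mul_pow, mul_pow, h1, pow_two s, h2]; ring
      rw [h4, Real.sqrt_sq h3.le, ← mul_assoc, ← mul_assoc, h2]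
      simp
    have A := aux (hp a ha) es₁ (h₁ a ha)
    have B := aux (hmi a ha) es₂ (h₂ a ha)
    constructor
    · apply ext_pm
      · simpa [he] using A.1
      · simpa [he] using B.1
    · apply ext_pm
      · simpa [he] using A.2
      · simpa [he] using B.2

end LorentzNum

namespace QuatLC

open LorentzNum (toC)

theorem smul_mul' (k : LorentzNumC) (a b : QuatLC) : (k • a) * b = k • (a * b) := by
  ext1 <;> simp only [Quaternion.re_mul, Quaternion.imI_mul, Quaternion.imJ_mul, Quaternion.imK_mul,
    Quaternion.re_smul, Quaternion.imI_smul, Quaternion.imJ_smul, Quaternion.imK_smul, smul_eq_mul] <;> ring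

theorem mul_smul' (k : LorentzNumC) (a b : QuatLC) : a * (k • b) = k • (a * b) := by
  ext1 <;> simp only [Quaternion.re_mul, Quaternion.imI_mul, Quaternion.imJ_mul, Quaternion.imK_mul,
    Quaternion.re_smul, Quaternion.imI_smul, Quaternion.imJ_smul, Quaternion.imK_smul, smul_eq_mul] <;> ring

theorem formH_mul (p q : QuatLC) : formH (p * q) (p * q) = formH p p * formH q q := by
  simp only [formH, Quaternion.re_mul, Quaternion.imI_mul, Quaternion.imJ_mul, Quaternion.imK_mul]
  ring

/-- Right translation by g⁻¹ preserves the norm, so H(g', g') can be read on the logarithmic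
derivative. -/
theorem formH_logDeriv {p q : QuatLC} (hq : q ∈ Spin22) :
    formH (p * star q) (p * star q) = formH p p := by
  rw [formH_mul, (star_mem_Spin22 hq).2, mul_one]

theorem sigma_smul_even (a b c d : LorentzNum) :
    LorentzNumC.sigma • even a b c d = even (LorentzNum.sigma * a) (LorentzNum.sigma * b)
      (LorentzNum.sigma * c) (LorentzNum.sigma * d) := by
  rw [← toC_sigma, toC_smul_even]

/-- The logarithmic derivative, without component along `I`, of a conformal map into `Spin(2,2)`
whose derivative has constant norm `± 1`. -/
theorem exists_logDeriv_param {U : Set LorentzNum} (hU : IsOpen U) (hUc : IsPreconnected U)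
    {h : LorentzNum → QuatLC} (hh : ContDiffOn ℝ ∞ h U) (hS : ∀ z ∈ U, h z ∈ Spin22)
    (hI : ∀ z ∈ U, ∀ v, coef₁ (fderiv ℝ h z v * star (h z)) = 0)
    (hconf : ∀ z ∈ U, ∀ v,
      fderiv ℝ h z (LorentzNum.sigma * v) = LorentzNumC.sigma • fderiv ℝ h z v)
    (hn : (∀ z ∈ U, formH (fderiv ℝ h z 1) (fderiv ℝ h z 1) = 1) ∨
      (∀ z ∈ U, formH (fderiv ℝ h z 1) (fderiv ℝ h z 1) = -1)) :
    ∃ (ψ : LorentzNum → LorentzNum) (ε : LorentzNum), LorentzNum.ConformalOn ψ U ∧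
      (ε = 1 ∨ ε = -1 ∨ ε = LorentzNum.sigma ∨ ε = -LorentzNum.sigma) ∧
      ((∀ a ∈ U, fderiv ℝ h a 1 * star (h a) = ε.toC • coshSinh (ψ a)) ∨
        (∀ a ∈ U, fderiv ℝ h a 1 * star (h a) = ε.toC • sinhCosh (ψ a))) := by
  have hω : ∀ z ∈ U, ∀ v, fderiv ℝ h z v * star (h z) =
      even 0 0 (logForm coef₂ h z v) (logForm coef₃ h z v) := by
    intro y hy v
    have hd : DifferentiableAt ℝ h y :=
      (hh.contDiffAt (hU.mem_nhds hy)).differentiableAt (by simp)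
    have := logDeriv_eq_even hd (Filter.eventually_of_mem (hU.mem_nhds hy) hS) v
    rwa [hI y hy v] at this
  have hσ : ∀ z ∈ U, ∀ v, logForm coef₂ h z (LorentzNum.sigma * v) =
        LorentzNum.sigma * logForm coef₂ h z v ∧ logForm coef₃ h z (LorentzNum.sigma * v) =
        LorentzNum.sigma * logForm coef₃ h z v := by
    intro z hz v
    have e1 : fderiv ℝ h z (LorentzNum.sigma * v) * star (h z) =
        LorentzNumC.sigma • (fderiv ℝ h z v * star (h z)) := by
      rw [hconf z hz v, smul_mul']
    rw [hω z hz v, sigma_smul_even] at e1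
    constructor
    · rw [logForm_apply, e1, coef₂_even]
    · rw [logForm_apply, e1, coef₃_even]
  -- A closed form θ with θ(w) = w θ(1) has a conformal coefficient: closedness gives D_v θ(1) = D_1
  -- θ(v), and linearity makes this v D_1 θ(1).
  have hconfOn : ∀ ℓ : QuatLC →L[ℝ] LorentzNum,
      (∀ z ∈ U, ∀ v w, fderiv ℝ (logForm ℓ h) z v w = fderiv ℝ (logForm ℓ h) z w v) →
      (∀ z ∈ U, ∀ v, logForm ℓ h z (LorentzNum.sigma * v) =
        LorentzNum.sigma * logForm ℓ h z v) →
      LorentzNum.ConformalOn (fun z => logForm ℓ h z 1) U := by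
    intro ℓ hcl hs
    have hsm := contDiffOn_logForm hU hh ℓ
    refine ⟨fun z hz => ((hsm.contDiffAt (hU.mem_nhds hz)).clm_apply
      contDiffAt_const).contDiffWithinAt, ?_⟩
    intro z hz k
    have hd := (hsm.contDiffAt (hU.mem_nhds hz)).differentiableAt (by simp)
    have e1 := LorentzNum.fderiv_clm_apply_const hd 1
    have e2 : ∀ v w, fderiv ℝ (logForm ℓ h) z v w = w * fderiv ℝ (logForm ℓ h) z v 1 := by
      intro v w
      have e3 := LorentzNum.fderiv_clm_apply_const hd w
      have e4 : (fun z => logForm ℓ h z w) =ᶠ[nhds z]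
          fun z => LorentzNum.mulL w (logForm ℓ h z 1) := by
        filter_upwards [hU.mem_nhds hz] with y hy
        exact LorentzNum.clm_apply_eq_mul (hs y hy) w
      have e5 : HasFDerivAt (fun z => LorentzNum.mulL w (logForm ℓ h z 1)) _ z :=
        (LorentzNum.mulL w).hasFDerivAt.comp z e1
      exact DFunLike.congr_fun (e3.unique (e5.congr_of_eventuallyEq e4)) v
    rw [e1.fderiv]
    simp only [ContinuousLinearMap.flip_apply]
    have e6 : ∀ v, fderiv ℝ (logForm ℓ h) z v 1 = v * fderiv ℝ (logForm ℓ h) z 1 1 := by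
      intro v
      rw [hcl z hz v 1, e2 1 v]
    rw [e6 (LorentzNum.sigma * k), e6 k, mul_assoc]
  have hC₂ := hconfOn coef₂ (fun z hz v w => (logForm_closed hU hh hS hI hz v w).1)
    (fun z hz v => (hσ z hz v).1)
  have hC₃ := hconfOn coef₃ (fun z hz v w => (logForm_closed hU hh hS hI hz v w).2.1)
    (fun z hz v => (hσ z hz v).2)
  have hform : ∀ z ∈ U, formH (fderiv ℝ h z 1) (fderiv ℝ h z 1) =
      toC (logForm coef₂ h z 1 ^ 2 - logForm coef₃ h z 1 ^ 2) := by
    intro z hz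
    rw [← formH_logDeriv (hS z hz), hω z hz, formH_even]
    congr 1; ring
  rcases hn with hn | hn
  · obtain ⟨ψ, ε, h1, h2, h3⟩ := LorentzNum.exists_hyperbolic_param hU hUc
      hC₂.1.continuousOn hC₃ (fun z hz => toC_injective (by
        rw [← hform z hz, hn z hz, toC_one]))
    refine ⟨ψ, ε, h1, h2, Or.inl fun a ha => ?_⟩
    rw [hω a ha, (h3 a ha).1, (h3 a ha).2, coshSinh_eq, toC_smul_even]
    simp
  -- When the norm is -1 the K component plays the part of cosh.
  · obtain ⟨ψ, ε, h1, h2, h3⟩ := LorentzNum.exists_hyperbolic_param hU hUc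
      hC₃.1.continuousOn hC₂ (fun z hz => toC_injective (by
        have e := hform z hz
        rw [hn z hz] at e
        have e' : toC (logForm coef₃ h z 1 ^ 2 - logForm coef₂ h z 1 ^ 2) =
            -toC (logForm coef₂ h z 1 ^ 2 - logForm coef₃ h z 1 ^ 2) := by
          ext1 <;> simp [toC]
        rw [e', ← e, toC_one, neg_neg]))
    refine ⟨ψ, ε, h1, h2, Or.inr fun a ha => ?_⟩
    rw [hω a ha, (h3 a ha).1, (h3 a ha).2, sinhCosh_eq, toC_smul_even]
    simp

end QuatLC

/-! ### Linear algebra of the condition Δ > 0 at a point. -/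

namespace LorentzNum

theorem im_eq (a : LorentzNum) : a.im = (plus a - minus a) / 2 := by
  simp [plus_apply, minus_apply]

/-- A linear map to the Lorentz numbers which is nondegenerate on a pair of vectors is an
isomorphism from the plane. -/
theorem exists_equiv_of_det_ne_zero {V : Type*} [NormedAddCommGroup V] [NormedSpace ℝ V]
    [FiniteDimensional ℝ V] (hV : Module.finrank ℝ V = 2) (P : V →L[ℝ] LorentzNum) (v w : V)
    (h : plus (P v) * minus (P w) - minus (P v) * plus (P w) ≠ 0) :
    ∃ L : V ≃L[ℝ] LorentzNum, ∀ u, L u = P u := by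
  have hs : Function.Surjective (P : V →ₗ[ℝ] LorentzNum) := by
    intro a
    set N := plus (P v) * minus (P w) - minus (P v) * plus (P w) with hN
    -- Cramer's rule in null coordinates.
    refine ⟨((plus a * minus (P w) - minus a * plus (P w)) / N) • v +
      ((plus (P v) * minus a - minus (P v) * plus a) / N) • w, ?_⟩
    apply ext_pm
    · simp only [ContinuousLinearMap.coe_coe, map_add, map_smul, smul_eq_mul]
      field_simp
      rw [hN]; ring
    · simp only [ContinuousLinearMap.coe_coe, map_add, map_smul, smul_eq_mul]
      field_simp
      rw [hN]; ring
  have hf : Module.finrank ℝ V = Module.finrank ℝ LorentzNum := by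
    rw [hV, QuadraticAlgebra.finrank_eq_two]
  have hi := (LinearMap.injective_iff_surjective_of_finrank_eq_finrank hf).2 hs
  exact ⟨(LinearEquiv.ofBijective _ ⟨hi, hs⟩).toContinuousLinearEquiv, fun u => rfl⟩

/-- The ratio is the value of Q at P⁻¹(1); proportionality applied to that vector gives Q = f P. -/
theorem exists_ratio {V : Type*} [NormedAddCommGroup V] [NormedSpace ℝ V]
    (L : V ≃L[ℝ] LorentzNum) {P Q : V →L[ℝ] LorentzNum} (hL : ∀ u, L u = P u)
    (hPQ : ∀ u u', P u * Q u' = P u' * Q u) : ∃ f : LorentzNum, ∀ u, Q u = f * P u := by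
  refine ⟨Q (L.symm 1), fun u => ?_⟩
  have h := hPQ (L.symm 1) u
  rw [← hL, ContinuousLinearEquiv.apply_symm_apply, one_mul] at h
  rw [h, mul_comm]

/-- The pointwise alternative for a pair of proportional forms with indefinite discriminant. -/
theorem forms_alternative {V : Type*} [NormedAddCommGroup V] [NormedSpace ℝ V]
    [FiniteDimensional ℝ V] (hV : Module.finrank ℝ V = 2) {P Q : V →L[ℝ] LorentzNum}
    (hPQ : ∀ u u', P u * Q u' = P u' * Q u) (v w : V)
    (hpos : 0 < (plus (P v) ^ 2 - plus (Q v) ^ 2) * (minus (P w) ^ 2 - minus (Q w) ^ 2)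
      + (plus (P w) ^ 2 - plus (Q w) ^ 2) * (minus (P v) ^ 2 - minus (Q v) ^ 2)
      - 2 * ((plus (P v) * plus (P w) - plus (Q v) * plus (Q w)) *
        (minus (P v) * minus (P w) - minus (Q v) * minus (Q w)))) :
    ∃ (L : V ≃L[ℝ] LorentzNum) (f : LorentzNum), plus f ^ 2 < 1 ∧ minus f ^ 2 < 1 ∧
      ((∀ u, P u = L u ∧ Q u = f * L u) ∨ (∀ u, Q u = L u ∧ P u = f * L u)) := by
  set N := plus (P v) * minus (P w) - minus (P v) * plus (P w) with hN
  set K := plus (Q v) * minus (Q w) - minus (Q v) * plus (Q w) with hK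
  by_cases h0 : N = 0
  · have hK0 : K ≠ 0 := by
      intro hK0
      -- The hypothesis written with 2 × 2 minors: the minors of (P₊, P₋) and (Q₊, Q₋) enter
      -- positively and the mixed ones negatively, so the first two cannot both vanish.
      have : N ^ 2 + K ^ 2 - (plus (P v) * minus (Q w) - plus (P w) * minus (Q v)) ^ 2
          - (plus (Q v) * minus (P w) - plus (Q w) * minus (P v)) ^ 2 > 0 := by
        refine hpos.trans_eq ?_
        rw [hN, hK]; ring
      rw [h0, hK0] at this
      nlinarith [sq_nonneg (plus (P v) * minus (Q w) - plus (P w) * minus (Q v)),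
        sq_nonneg (plus (Q v) * minus (P w) - plus (Q w) * minus (P v))]
    obtain ⟨L, hL⟩ := exists_equiv_of_det_ne_zero hV Q v w hK0
    obtain ⟨f, hf⟩ := exists_ratio L (Q := P) hL
      (fun u u' => by rw [mul_comm, ← hPQ, mul_comm])
    have h1 : 0 < K ^ 2 * ((1 - plus f ^ 2) * (1 - minus f ^ 2)) := by
      refine hpos.trans_eq ?_
      rw [hf v, hf w, hK]; simp only [plus_mul, minus_mul]; ring
    have h2 : N = plus f * minus f * K := by
      rw [hN, hf v, hf w, hK]; simp only [plus_mul, minus_mul]; ring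
    -- Degeneracy of P = f Q forces a null coordinate of f to vanish; positivity of (1 - f₊²)(1 -
    -- f₋²) then bounds the other.
    have h3 : plus f * minus f = 0 := by
      rw [h0] at h2
      exact (mul_eq_zero.1 h2.symm).resolve_right hK0
    have h4 := pos_of_mul_pos_right h1 (sq_nonneg K)
    refine ⟨L, f, ?_, ?_, Or.inr fun u => ⟨(hL u).symm, by rw [hL, hf]⟩⟩
    · rcases mul_eq_zero.1 h3 with h5 | h5 <;> rw [h5] at * <;> nlinarith
    · rcases mul_eq_zero.1 h3 with h5 | h5 <;> rw [h5] at * <;> nlinarith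
  · obtain ⟨L, hL⟩ := exists_equiv_of_det_ne_zero hV P v w h0
    obtain ⟨f, hf⟩ := exists_ratio L hL hPQ
    have h1 : 0 < N ^ 2 * ((1 - plus f ^ 2) * (1 - minus f ^ 2)) := by
      refine hpos.trans_eq ?_
      rw [hf v, hf w, hN]; simp only [plus_mul, minus_mul]; ring
    have h4 := pos_of_mul_pos_right h1 (sq_nonneg N)
    rcases pos_and_pos_or_neg_and_neg_of_mul_pos h4 with ⟨h5, h6⟩ | ⟨h5, h6⟩
    · exact ⟨L, f, by linarith, by linarith, Or.inl fun u => ⟨(hL u).symm, by rw [hL, hf]⟩⟩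
    -- Both |f₊| and |f₋| exceed 1. Then f is invertible, and the ratio f⁻¹ with P and Q exchanged
    -- satisfies the bounds.
    · have hp : plus f ≠ 0 := fun h => by rw [h] at h5; norm_num at h5
      have hm : minus f ≠ 0 := fun h => by rw [h] at h6; norm_num at h6
      obtain ⟨k, hk⟩ := isUnit_of_pm hp hm
      have hkp : plus f * plus k = 1 := by simpa using congrArg plus hk
      have hkm : minus f * minus k = 1 := by simpa using congrArg minus hk
      have hdet : plus (Q v) * minus (Q w) - minus (Q v) * plus (Q w) ≠ 0 := by
        have : plus (Q v) * minus (Q w) - minus (Q v) * plus (Q w) = plus f * minus f * N := by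
          rw [hf v, hf w, hN]; simp only [plus_mul, minus_mul]; ring
        rw [this]
        exact mul_ne_zero (mul_ne_zero hp hm) h0
      obtain ⟨L', hL'⟩ := exists_equiv_of_det_ne_zero hV Q v w hdet
      have aux : ∀ {x y : ℝ}, x * y = 1 → 1 - x ^ 2 < 0 → y ^ 2 < 1 := by
        intro x y h7 h8
        have h9 : x ^ 2 * y ^ 2 = 1 := by rw [← mul_pow, h7, one_pow]
        nlinarith [sq_nonneg y]
      refine ⟨L', k, aux hkp h5, aux hkm h6, Or.inr fun u => ⟨(hL' u).symm, ?_⟩⟩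
      rw [hL', hf, ← mul_assoc, mul_comm k f, hk, one_mul]

end LorentzNum

/-! ### Clifford algebra of the Gauss map and of the Dirac equation. -/

namespace QuatLC

open LorentzNum (toC)

theorem re_hat (ζ : QuatLC) : (hat ζ).re = LorentzNumC.hat ζ.re := rfl
theorem imI_hat (ζ : QuatLC) : (hat ζ).imI = LorentzNumC.hat ζ.imI := rfl
theorem imJ_hat (ζ : QuatLC) : (hat ζ).imJ = LorentzNumC.hat ζ.imJ := rfl
theorem imK_hat (ζ : QuatLC) : (hat ζ).imK = LorentzNumC.hat ζ.imK := rfl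

theorem hat_mul (ζ ξ : QuatLC) : hat (ζ * ξ) = hat ζ * hat ξ := by
  ext1 <;> ext1 <;> simp only [re_hat, imI_hat, imJ_hat, imK_hat, Quaternion.re_mul,
    Quaternion.imI_mul, Quaternion.imJ_mul, Quaternion.imK_mul] <;> simp [LorentzNumC.hat] <;> ring

theorem hat_star (ζ : QuatLC) : hat (star ζ) = star (hat ζ) := by
  ext1 <;> ext1 <;> simp [re_hat, imI_hat, imJ_hat, imK_hat, LorentzNumC.hat]

theorem hat_hat (ζ : QuatLC) : hat (hat ζ) = ζ := by
  ext1 <;> ext1 <;> simp [hat, LorentzNumC.hat]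

theorem hat_one : hat 1 = 1 := by
  ext1 <;> ext1 <;> simp [hat, LorentzNumC.hat, QuadraticAlgebra.re_one, QuadraticAlgebra.im_one]

theorem sigma_i_sq : LorentzNumC.sigma * LorentzNumC.i * (LorentzNumC.sigma * LorentzNumC.i) = -1 := by
  ext1 <;> simp [LorentzNumC.sigma, LorentzNumC.i, QuadraticAlgebra.re_one, QuadraticAlgebra.im_one]

/-- The sign comes from (σi)² = -1. It cancels in the Clifford product of two tangent vectors. -/
theorem pairing_cliffordAct (q g : QuatLC) :
    pairing (cliffordAct q g) g = -(star g * q * hat g) := by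
  rw [pairing, cliffordAct, mul_smul', smul_smul, sigma_i_sq, ← mul_assoc, neg_smul, one_smul]

theorem vec_mul_hat_vec :
    vec ![0, 0, 1, 0] * hat (vec ![0, 0, 0, 1]) = even 0 1 0 0 := by
  ext1 <;> ext1 <;> simp only [Quaternion.re_mul, Quaternion.imI_mul,
    Quaternion.imJ_mul, Quaternion.imK_mul] <;>
    simp [vec, hat, LorentzNumC.hat, even, toC, LorentzNumC.i, QuadraticAlgebra.re_one,
      QuadraticAlgebra.im_one]

theorem neg_mul_neg' (a b : QuatLC) : -a * hat (-b) = a * hat b := by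
  have h : hat (-b) = -hat b := by
    ext1 <;> ext1 <;> simp [re_hat, imI_hat, imJ_hat, imK_hat, LorentzNumC.hat]
  rw [h]; exact neg_mul_neg a _

/-- The inner factors ĝ and the hat of ḡ cancel, and e₂ · e₃ = iI remains between ḡ and g. -/
theorem gauss_product {g : QuatLC} (hg : g ∈ Spin22) :
    pairing (cliffordAct (vec ![0, 0, 1, 0]) g) g *
      hat (pairing (cliffordAct (vec ![0, 0, 0, 1]) g) g) = star g * even 0 1 0 0 * g := by
  have h1 : hat g * star (hat g) = 1 := by
    rw [← hat_star, ← hat_mul, (mul_star_of_mem_Spin22 hg).1, hat_one]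
  rw [pairing_cliffordAct, pairing_cliffordAct, neg_mul_neg', ← vec_mul_hat_vec, hat_mul, hat_mul,
    hat_star, hat_hat]
  calc _ = star g * vec ![0, 0, 1, 0] * (hat g * star (hat g)) * hat (vec ![0, 0, 0, 1]) * g := by
        simp only [mul_assoc]
    _ = _ := by rw [h1, mul_one]; simp only [mul_assoc]

/-- With d = ω g the derivative is ḡ [iI, ω] g. The commutator with iI exchanges the coefficients
along J and iK and doubles them. -/
theorem gauss_derivative {g d : QuatLC} (hg : g ∈ Spin22) {P Q : LorentzNum}
    (hd : d * star g = even 0 0 P Q) :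
    star d * even 0 1 0 0 * g + star g * even 0 1 0 0 * d =
      star g * even 0 0 (Q + Q) (P + P) * g := by
  have h1 : d = even 0 0 P Q * g := by
    rw [← hd, mul_assoc, (mul_star_of_mem_Spin22 hg).2, mul_one]
  have h2 : star d = star g * even 0 0 (-P) (-Q) := by
    rw [h1, star_mul, star_even, neg_zero]
  have h3 : even 0 0 (-P) (-Q) * even 0 1 0 0 + even 0 1 0 0 * even 0 0 P Q =
      even 0 0 (Q + Q) (P + P) := by
    rw [even_mul, even_mul, even_add]; congr 1 <;> ring
  rw [← h3, mul_add, add_mul, h2, h1]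
  simp only [mul_assoc]

theorem formH_mul_left (p q q' : QuatLC) : formH (p * q) (p * q') = formH p p * formH q q' := by
  simp only [formH, Quaternion.re_mul, Quaternion.imI_mul, Quaternion.imJ_mul, Quaternion.imK_mul]
  ring

theorem formH_mul_right (p p' q : QuatLC) : formH (p * q) (p' * q) = formH p p' * formH q q := by
  simp only [formH, Quaternion.re_mul, Quaternion.imI_mul, Quaternion.imJ_mul, Quaternion.imK_mul]
  ring

theorem conj_eq_even {g : QuatLC} (hg : g ∈ Spin22) (a b : LorentzNum) :
    ∃ x y z : LorentzNum, star g * even 0 0 a b * g = even 0 x y z := by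
  rw [eq_even hg.1, star_even, even_mul, even_mul]
  refine ⟨_, _, _, congrArg (fun t => even t _ _ _) ?_⟩
  ring

/-- `formH` is invariant under left and right multiplication by Spin(2,2), and the exterior product
of imaginary elements is minus its σ-part, so the conjugation by g disappears. -/
theorem wedge_conj {g : QuatLC} (hg : g ∈ Spin22) (a b a' b' : LorentzNum) :
    wedge (star g * even 0 0 a b * g) (star g * even 0 0 a' b' * g) =
      (b * b' - a * a').im := by
  have h1 : formH (star g * even 0 0 a b * g) (star g * even 0 0 a' b' * g) =
      formH (even 0 0 a b) (even 0 0 a' b') := by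
    rw [formH_mul_right, formH_mul_left, hg.2, (star_mem_Spin22 hg).2, one_mul, mul_one]
  obtain ⟨x, y, z, h⟩ := conj_eq_even hg a b
  obtain ⟨x', y', z', h'⟩ := conj_eq_even hg a' b'
  rw [h, h', formH_even, formH_even] at h1
  have h2 := toC_injective h1
  rw [h, h', wedge_even]
  have h3 : x * x' - y * y' + z * z' = b * b' - a * a' := by linear_combination -h2
  rw [h3]

/-- The spinor equation, read in components, forces the component of the logarithmic derivative
along `I` to vanish. -/
theorem dirac_component {g d d' : QuatLC} (hg : g ∈ Spin22) {w P Q w' P' Q' : LorentzNum}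
    (hd : d * star g = even 0 w P Q) (hd' : d' * star g = even 0 w' P' Q') {x₀ x₁ : ℝ}
    (h : -cliffordAct (vec ![0, 0, 1, 0]) d + cliffordAct (vec ![0, 0, 0, 1]) d' =
      cliffordAct (vec ![x₀, x₁, 0, 0]) g) : w = 0 ∧ w' = 0 := by
  have hΦ : ∀ q ξ : QuatLC, (LorentzNumC.sigma * LorentzNumC.i) •
      (cliffordAct q ξ * hat (star g)) = -(q * hat (ξ * star g)) := by
    intro q ξ
    rw [cliffordAct, smul_mul', smul_smul, sigma_i_sq, mul_assoc, ← hat_mul, neg_smul, one_smul]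
  -- Multiplication on the right by the hat of ḡ replaces the derivatives of g by the logarithmic
  -- derivatives and removes g from the right side.
  have h1 := congrArg (fun z => (LorentzNumC.sigma * LorentzNumC.i) • (z * hat (star g))) h
  have h2 : ∀ a b : QuatLC, (LorentzNumC.sigma * LorentzNumC.i) • ((-a + b) * hat (star g)) =
      -((LorentzNumC.sigma * LorentzNumC.i) • (a * hat (star g))) +
        (LorentzNumC.sigma * LorentzNumC.i) • (b * hat (star g)) := by
    intro a b
    rw [add_mul, smul_add]
    congr 1
    exact (congrArg _ (neg_mul a _)).trans (smul_neg _ _)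
  simp only [h2, hΦ, hd, hd', (mul_star_of_mem_Spin22 hg).1, hat_one, mul_one] at h1
  -- The right side has only components along 1 and I. On the left, [e₂] = iJ sends the I component
  -- w of ω(e₂) to K, and [e₃] = K sends the I component w' of ω(e₃) to J.
  have hJ := congrArg QuaternionAlgebra.imJ h1
  have hK := congrArg QuaternionAlgebra.imK h1
  have e1 := congrArg (fun z => z.re.im) hJ
  have e2 := congrArg (fun z => z.im.im) hJ
  have e3 := congrArg (fun z => z.re.re) hK
  have e4 := congrArg (fun z => z.im.re) hK
  clear h h1 h2 hΦ hJ hK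
  simp only [Quaternion.imJ_add, Quaternion.imK_add, Quaternion.imJ_neg, Quaternion.imK_neg,
    Quaternion.imJ_mul, Quaternion.imK_mul] at e1 e2 e3 e4
  simp [vec, hat, LorentzNumC.hat, even, toC, LorentzNumC.i] at e1 e2 e3 e4
  refine ⟨?_, ?_⟩
  · ext
    · simpa using e3
    · simpa using e4
  · ext
    · simpa using e1
    · simpa using e2

end QuatLC

/-! ### Differential calculus in smooth charts of M. -/

section SmoothCharts

variable {M : Type*} [TopologicalSpace M] [ChartedSpace Plane M]
  {V W W' : Type*} [NormedAddCommGroup V] [NormedSpace ℝ V] [NormedAddCommGroup W]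
  [NormedSpace ℝ W] [NormedAddCommGroup W'] [NormedSpace ℝ W']

theorem mvfderiv_comp_left {f : M → W} {Φ : W → W'} {x : M}
    (hf : MDifferentiableAt (𝓡 2) 𝓘(ℝ, W) f x) (hΦ : DifferentiableAt ℝ Φ (f x))
    (X : TangentSpace (𝓡 2) x) :
    mvfderiv (𝓡 2) (Φ ∘ f) x X = fderiv ℝ Φ (f x) (mvfderiv (𝓡 2) f x X) := by
  have h := mfderiv_comp_apply x hΦ.mdifferentiableAt hf X
  rw [mfderiv_eq_fderiv] at h
  exact h

theorem mvfderiv_congr_nhds {f f' : M → W} {x : M} (h : f =ᶠ[nhds x] f')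
    (X : TangentSpace (𝓡 2) x) : mvfderiv (𝓡 2) f x X = mvfderiv (𝓡 2) f' x X := by
  have h1 := h.mfderiv_eq (I := 𝓡 2) (I' := 𝓘(ℝ, W))
  exact DFunLike.congr_fun h1 X

/-- A coordinate with values in a normed space which is smooth in both directions. -/
structure SmoothChart (e : OpenPartialHomeomorph M V) : Prop where
  smooth : ContMDiffOn (𝓡 2) 𝓘(ℝ, V) ∞ e e.source
  smooth_symm : ContMDiffOn 𝓘(ℝ, V) (𝓡 2) ∞ e.symm e.target

namespace SmoothChart

variable {e : OpenPartialHomeomorph M V} {x : M}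

theorem mdifferentiableAt (he : SmoothChart e) (hx : x ∈ e.source) :
    MDifferentiableAt (𝓡 2) 𝓘(ℝ, V) e x :=
  (he.smooth.contMDiffAt (e.open_source.mem_nhds hx)).mdifferentiableAt (by simp)

theorem mdifferentiableAt_symm (he : SmoothChart e) {a : V} (ha : a ∈ e.target) :
    MDifferentiableAt 𝓘(ℝ, V) (𝓡 2) e.symm a :=
  (he.smooth_symm.contMDiffAt (e.open_target.mem_nhds ha)).mdifferentiableAt (by simp)

theorem contDiffOn_comp_symm (he : SmoothChart e) {f : M → W}
    (hf : ContMDiffOn (𝓡 2) 𝓘(ℝ, W) ∞ f e.source) : ContDiffOn ℝ ∞ (f ∘ e.symm) e.target := by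
  rw [← contMDiffOn_iff_contDiffOn]
  exact hf.comp he.smooth_symm fun a ha => e.map_target ha

theorem differentiableAt_comp_symm (he : SmoothChart e) {f : M → W} (hx : x ∈ e.source)
    (hf : MDifferentiableAt (𝓡 2) 𝓘(ℝ, W) f x) : DifferentiableAt ℝ (f ∘ e.symm) (e x) := by
  rw [← mdifferentiableAt_iff_differentiableAt]
  refine MDifferentiableAt.comp (I' := 𝓡 2) _ ?_ (he.mdifferentiableAt_symm (e.map_source hx))
  rw [e.left_inv hx]; exact hf

theorem mvfderiv_eq (he : SmoothChart e) {f : M → W} (hx : x ∈ e.source)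
    (hf : MDifferentiableAt (𝓡 2) 𝓘(ℝ, W) f x) (X : TangentSpace (𝓡 2) x) :
    mvfderiv (𝓡 2) f x X = fderiv ℝ (f ∘ e.symm) (e x) (mvfderiv (𝓡 2) e x X) := by
  rw [← mvfderiv_comp_left (he.mdifferentiableAt hx) (he.differentiableAt_comp_symm hx hf)]
  refine mvfderiv_congr_nhds ?_ X
  filter_upwards [e.open_source.mem_nhds hx] with y hy
  simp [e.left_inv hy]

theorem symm_comp (he : SmoothChart e) (hx : x ∈ e.source) (X : TangentSpace (𝓡 2) x) :
    mfderiv 𝓘(ℝ, V) (𝓡 2) e.symm (e x) (mvfderiv (𝓡 2) e x X) = X := by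
  have h := mfderiv_comp_apply x (he.mdifferentiableAt_symm (e.map_source hx))
    (he.mdifferentiableAt hx) X
  have h2 : e.symm ∘ e =ᶠ[nhds x] id := by
    filter_upwards [e.open_source.mem_nhds hx] with y hy
    simp [e.left_inv hy]
  rw [h2.mfderiv_eq, mfderiv_id] at h
  exact h.symm

theorem comp_symm (he : SmoothChart e) (hx : x ∈ e.source) (v : V) :
    mvfderiv (𝓡 2) e x (mfderiv 𝓘(ℝ, V) (𝓡 2) e.symm (e x) v) = v := by
  have hd : MDifferentiableAt (𝓡 2) 𝓘(ℝ, V) e (e.symm (e x)) := by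
    rw [e.left_inv hx]; exact he.mdifferentiableAt hx
  have h := mfderiv_comp_apply (e x) hd (he.mdifferentiableAt_symm (e.map_source hx)) v
  have h2 : e ∘ e.symm =ᶠ[nhds (e x)] id := by
    filter_upwards [e.open_target.mem_nhds (e.map_source hx)] with y hy
    simp [e.right_inv hy]
  rw [h2.mfderiv_eq, mfderiv_id] at h
  -- The base point `e.symm (e x)` equals `x` only propositionally. All tangent spaces are the same
  -- type `Plane`, so the differentials can be compared there.
  have h3 : ∀ y (hy : y = x) (u : Plane), (mfderiv (𝓡 2) 𝓘(ℝ, V) e y : Plane →L[ℝ] V) u =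
    (mfderiv (𝓡 2) 𝓘(ℝ, V) e x : Plane →L[ℝ] V) u := by
    rintro y rfl u; rfl
  have h4 := h3 _ (e.left_inv hx) (mfderiv 𝓘(ℝ, V) (𝓡 2) e.symm (e x) v)
  exact h4.symm.trans h.symm

theorem injective (he : SmoothChart e) (hx : x ∈ e.source) :
    Function.Injective (mvfderiv (𝓡 2) e x) :=
  fun X Y h => by rw [← he.symm_comp hx X, h, he.symm_comp hx Y]

theorem surjective (he : SmoothChart e) (hx : x ∈ e.source) :
    Function.Surjective (mvfderiv (𝓡 2) e x) := fun v => ⟨_, he.comp_symm hx v⟩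

theorem trans (he : SmoothChart e) {c : OpenPartialHomeomorph V W}
    (hc : ContDiffOn ℝ ∞ c c.source) (hc' : ContDiffOn ℝ ∞ c.symm c.target) :
    SmoothChart (e.trans c) := by
  constructor
  · refine (contMDiffOn_iff_contDiffOn.2 hc).comp
      (he.smooth.mono ?_) ?_
    · intro y hy; exact ((OpenPartialHomeomorph.trans_source e c) ▸ hy).1
    · intro y hy; exact ((OpenPartialHomeomorph.trans_source e c) ▸ hy).2
  · refine he.smooth_symm.comp ((contMDiffOn_iff_contDiffOn.2 hc').mono ?_) ?_
    · intro y hy; exact ((OpenPartialHomeomorph.trans_target e c) ▸ hy).1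
    · intro y hy; exact ((OpenPartialHomeomorph.trans_target e c) ▸ hy).2

theorem restrOpen (he : SmoothChart e) {s : Set M} (hs : IsOpen s) :
    SmoothChart (e.restrOpen s hs) := by
  constructor
  · exact he.smooth.mono fun y hy => hy.1
  · exact he.smooth_symm.mono fun y hy => hy.1

theorem mvfderiv_trans (he : SmoothChart e) {c : OpenPartialHomeomorph V W}
    (hc : ContDiffOn ℝ ∞ c c.source) (hx : x ∈ e.source) (hx' : e x ∈ c.source)
    (X : TangentSpace (𝓡 2) x) :
    mvfderiv (𝓡 2) (e.trans c) x X = fderiv ℝ c (e x) (mvfderiv (𝓡 2) e x X) :=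
  mvfderiv_comp_left (he.mdifferentiableAt hx)
    ((hc.contDiffAt (c.open_source.mem_nhds hx')).differentiableAt (by simp)) X

variable [IsManifold (𝓡 2) ∞ M]

theorem chartAt (x : M) : SmoothChart (ChartedSpace.chartAt (H := Plane) x) :=
  ⟨contMDiffOn_chart, contMDiffOn_chart_symm⟩

end SmoothChart

theorem LorentzStructure.IsChart.smoothChart [IsManifold (𝓡 2) ∞ M] {τ : LorentzStructure M}
    {c : OpenPartialHomeomorph M LorentzNum} (h : τ.IsChart c) : SmoothChart c :=
  ⟨h.smooth, h.smooth_symm⟩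

end SmoothCharts

/-! ### Solutions of the Dirac equation and the invariant Δ. -/

namespace FramedLorentzSurface

open QuatLC

variable {M : Type*} [TopologicalSpace M] [ChartedSpace Plane M]
  [IsManifold (𝓡 2) ∞ M] {E : M → Type*} [TopologicalSpace (TotalSpace Plane E)]
  [∀ x, AddCommGroup (E x)] [∀ x, Module ℝ (E x)] [∀ x, TopologicalSpace (E x)]
  [∀ x, IsTopologicalAddGroup (E x)] [∀ x, ContinuousSMul ℝ (E x)]
  [FiberBundle Plane E] [VectorBundle ℝ Plane E]
  {S : FramedLorentzSurface M E}

/-- Pairing a vanishing combination with e₂ and e₃ annihilates its coefficients, and the tangent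
space has dimension 2. -/
theorem exists_frame_coord (S : FramedLorentzSurface M E) (x : M) (X : TangentSpace (𝓡 2) x) :
    ∃ a b : ℝ, X = a • S.e₂ x + b • S.e₃ x := by
  have h1 := S.frameM.left_self x
  have h2 := S.frameM.right_self x
  have h3 := S.frameM.left_right x
  have h4 : S.metM.inner x (S.e₃ x) (S.e₂ x) = 0 := by rw [S.metM.symm, h3]
  have hli : LinearIndependent ℝ ![S.e₂ x, S.e₃ x] := by
    rw [LinearIndependent.pair_iff]
    intro s t hst
    have e2 := congrArg (fun Y => S.metM.inner x Y (S.e₂ x)) hst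
    have e3 := congrArg (fun Y => S.metM.inner x Y (S.e₃ x)) hst
    simp [h1, h2, h3, h4] at e2 e3
    exact ⟨e2, e3⟩
  have hfr : Module.finrank ℝ (TangentSpace (𝓡 2) x) = 2 := finrank_euclideanSpace_fin
  have : FiniteDimensional ℝ (TangentSpace (𝓡 2) x) :=
    inferInstanceAs (FiniteDimensional ℝ Plane)
  have hsp := hli.span_eq_top_of_card_eq_finrank' (by rw [hfr]; rfl)
  have hX : X ∈ Submodule.span ℝ (Set.range ![S.e₂ x, S.e₃ x]) := by rw [hsp]; trivial
  rw [Matrix.range_cons, Matrix.range_cons, Matrix.range_empty, Set.union_empty,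
    Set.singleton_union, Submodule.mem_span_pair] at hX
  obtain ⟨a, b, h⟩ := hX
  exact ⟨a, b, h.symm⟩

theorem tangentCoord_e₂ (x : M) : S.tangentCoord x (S.e₂ x) = vec ![0, 0, 1, 0] := by
  simp [tangentCoord, S.frameM.left_self, S.frameM.left_right]

theorem tangentCoord_e₃ (x : M) : S.tangentCoord x (S.e₃ x) = vec ![0, 0, 0, 1] := by
  have h4 : S.metM.inner x (S.e₃ x) (S.e₂ x) = 0 := by rw [S.metM.symm, S.frameM.left_right]
  simp [tangentCoord, S.frameM.right_self, h4]

theorem spinorDeriv_of_isParallel (hpar : S.IsParallel) (g : M → QuatLC) (x : M)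
    (X : TangentSpace (𝓡 2) x) : S.spinorDeriv g x X = mvfderiv (𝓡 2) g x X := by
  obtain ⟨h0, -, h2, -⟩ := hpar x X
  simp [spinorDeriv, h0, h2]

variable {Hvec : Π x : M, E x} {g : M → QuatLC} {F : M → Fin 4 → ℝ}

theorem IsDiracSolution.mdifferentiableAt (hg : S.IsDiracSolution Hvec g) (x : M) :
    MDifferentiableAt (𝓡 2) 𝓘(ℝ, QuatLC) g x :=
  hg.smooth.contMDiffAt.mdifferentiableAt (by simp)

/-- The components along `J` and `K` are the only ones of the logarithmic derivative of a
solution. -/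
theorem IsDiracSolution.logDeriv_eq (hpar : S.IsParallel) (hg : S.IsDiracSolution Hvec g) (x : M)
    (X : TangentSpace (𝓡 2) x) :
    mvfderiv (𝓡 2) g x X * star (g x) = even 0 0 (coef₂ (mvfderiv (𝓡 2) g x X * star (g x)))
      (coef₃ (mvfderiv (𝓡 2) g x X * star (g x))) := by
  set φ := chartAt Plane x
  have hφ : SmoothChart φ := SmoothChart.chartAt x
  have hx : x ∈ φ.source := mem_chart_source Plane x
  have hev : ∀ X : TangentSpace (𝓡 2) x, mvfderiv (𝓡 2) g x X * star (g x) =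
      even 0 (coef₁ (mvfderiv (𝓡 2) g x X * star (g x)))
        (coef₂ (mvfderiv (𝓡 2) g x X * star (g x)))
        (coef₃ (mvfderiv (𝓡 2) g x X * star (g x))) := by
    intro X
    have h := logDeriv_eq_even (hφ.differentiableAt_comp_symm hx (hg.mdifferentiableAt x))
      (Filter.Eventually.of_forall fun y => hg.mem_spin (φ.symm y)) (mvfderiv (𝓡 2) φ x X)
    rw [← hφ.mvfderiv_eq hx (hg.mdifferentiableAt x), Function.comp_apply, φ.left_inv hx] at h
    exact h
  have hd := hg.eq x
  rw [dirac, spinorDeriv_of_isParallel hpar, spinorDeriv_of_isParallel hpar, tangentCoord_e₂,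
    tangentCoord_e₃, normalCoord] at hd
  have hw := dirac_component (hg.mem_spin x) (hev _) (hev _) hd
  have h0 : coef₁ (mvfderiv (𝓡 2) g x X * star (g x)) = 0 := by
    obtain ⟨a, b, hX⟩ := S.exists_frame_coord x X
    have e : coef₁ (mvfderiv (𝓡 2) g x X * star (g x)) =
        (coef₁.comp ((mulL.flip (star (g x))).comp (mvfderiv (𝓡 2) g x))) X := rfl
    rw [e, hX, map_add, map_smul, map_smul]
    change a • coef₁ (mvfderiv (𝓡 2) g x (S.e₂ x) * star (g x)) +
      b • coef₁ (mvfderiv (𝓡 2) g x (S.e₃ x) * star (g x)) = 0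
    rw [hw.1, hw.2, smul_zero, smul_zero, add_zero]
  have h := hev X
  rwa [h0] at h

theorem gaussMap_eq (hg : S.IsDiracSolution Hvec g) (hF : S.IsImmersionOf g F) :
    S.gaussMap F = (fun q => star q * even 0 1 0 0 * q) ∘ g := by
  funext x
  rw [gaussMap, cliffordMul, hF.eq, hF.eq, weierstrassForm, weierstrassForm, tangentCoord_e₂,
    tangentCoord_e₃, gauss_product (hg.mem_spin x)]
  rfl

theorem mvfderiv_gaussMap (hg : S.IsDiracSolution Hvec g)
    (hF : S.IsImmersionOf g F) {x : M} {X : TangentSpace (𝓡 2) x} {P Q : LorentzNum}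
    (h : mvfderiv (𝓡 2) g x X * star (g x) = even 0 0 P Q) :
    mvfderiv (𝓡 2) (S.gaussMap F) x X = star (g x) * even 0 0 (Q + Q) (P + P) * g x := by
  have hd : HasFDerivAt (fun q : QuatLC => star q * even 0 1 0 0 * q) _ (g x) :=
    hasFDerivAt_mul (hasFDerivAt_mul (starL.hasFDerivAt (x := g x))
      (hasFDerivAt_const (even 0 1 0 0) (g x))) (hasFDerivAt_id (g x))
  rw [gaussMap_eq hg hF, mvfderiv_comp_left (hg.mdifferentiableAt x) hd.differentiableAt,
    hd.fderiv, ← gauss_derivative (hg.mem_spin x) h]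
  simp

theorem deltaForm_eq (hg : S.IsDiracSolution Hvec g)
    (hF : S.IsImmersionOf g F) {x : M} {X Y : TangentSpace (𝓡 2) x} {P Q P' Q' : LorentzNum}
    (h : mvfderiv (𝓡 2) g x X * star (g x) = even 0 0 P Q)
    (h' : mvfderiv (𝓡 2) g x Y * star (g x) = even 0 0 P' Q') :
    S.deltaForm F x X Y = 2 * (P * P' - Q * Q').im := by
  rw [deltaForm, mvfderiv_gaussMap hg hF h, mvfderiv_gaussMap hg hF h',
    wedge_conj (hg.mem_spin x)]
  simp
  ring

/-- The Gram determinant of (e₂, e₃) is -1, which reverses the sign of the determinant of δ. -/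
theorem invariantDelta_eq (hg : S.IsDiracSolution Hvec g)
    (hF : S.IsImmersionOf g F) {x : M} {a b c d : LorentzNum}
    (h : mvfderiv (𝓡 2) g x (S.e₂ x) * star (g x) = even 0 0 a c)
    (h' : mvfderiv (𝓡 2) g x (S.e₃ x) * star (g x) = even 0 0 b d) :
    S.invariantDelta F x = 4 * ((a * b - c * d).im ^ 2 - (a * a - c * c).im * (b * b - d * d).im) := by
  have h4 : S.metM.inner x (S.e₃ x) (S.e₂ x) = 0 := by rw [S.metM.symm, S.frameM.left_right]
  rw [invariantDelta, deltaForm_eq hg hF h h, deltaForm_eq hg hF h h',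
    deltaForm_eq hg hF h' h, deltaForm_eq hg hF h' h', S.frameM.left_self,
    S.frameM.right_self, S.frameM.left_right, h4, mul_comm b a, mul_comm d c]
  ring

/-- Around every point there is a coordinate in which the logarithmic derivative of `g` is
`m J + i n K` with `m² - n² = ± 1`. -/
theorem exists_coordinate (hpar : S.IsParallel) (hg : S.IsDiracSolution Hvec g)
    (hF : S.IsImmersionOf g F) (hΔ : ∀ x, 0 < S.invariantDelta F x) (x₀ : M) :
    ∃ c : OpenPartialHomeomorph M LorentzNum, x₀ ∈ c.source ∧ SmoothChart c ∧
      ∃ (m n : M → LorentzNum) (κ : LorentzNum), (κ = 1 ∨ κ = -1) ∧ ∀ x ∈ c.source,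
        m x ^ 2 - n x ^ 2 = κ ∧ ∀ X, mvfderiv (𝓡 2) g x X * star (g x) =
          even 0 0 (m x * mvfderiv (𝓡 2) c x X) (n x * mvfderiv (𝓡 2) c x X) := by
  set φ := chartAt Plane x₀
  have hφ : SmoothChart φ := SmoothChart.chartAt x₀
  have hx₀ : x₀ ∈ φ.source := mem_chart_source Plane x₀
  set h : Plane → QuatLC := g ∘ φ.symm with hh
  have hsm : ContDiffOn ℝ ∞ h φ.target := hφ.contDiffOn_comp_symm hg.smooth.contMDiffOn
  have hS : ∀ z ∈ φ.target, h z ∈ Spin22 := fun z _ => hg.mem_spin _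
  have hlog : ∀ x ∈ φ.source, ∀ X, fderiv ℝ h (φ x) (mvfderiv (𝓡 2) φ x X) * star (h (φ x)) =
      mvfderiv (𝓡 2) g x X * star (g x) := by
    intro x hx X
    rw [hφ.mvfderiv_eq hx (hg.mdifferentiableAt x), hh, Function.comp_apply, φ.left_inv hx]
  have hI : ∀ z ∈ φ.target, ∀ v, coef₁ (fderiv ℝ h z v * star (h z)) = 0 := by
    intro z hz v
    obtain ⟨X, rfl⟩ := (hφ.surjective (φ.map_target hz)) v
    have e := hlog _ (φ.map_target hz) X
    rw [φ.right_inv hz] at e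
    rw [e, hg.logDeriv_eq hpar, coef₁_even]
  have hy₀ : φ x₀ ∈ φ.target := φ.map_source hx₀
  have hcl := fun v w => (logForm_closed φ.open_target hsm hS hI hy₀ v w).2.2
  have hval : ∀ X, mvfderiv (𝓡 2) g x₀ X * star (g x₀) =
      even 0 0 (logForm coef₂ h (φ x₀) (mvfderiv (𝓡 2) φ x₀ X))
        (logForm coef₃ h (φ x₀) (mvfderiv (𝓡 2) φ x₀ X)) := by
    intro X
    rw [logForm_apply, logForm_apply, hlog x₀ hx₀]
    exact hg.logDeriv_eq hpar x₀ X
  obtain ⟨L, f, hp, hm, hLf⟩ := LorentzNum.forms_alternative (V := Plane)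
    finrank_euclideanSpace_fin hcl (mvfderiv (𝓡 2) φ x₀ (S.e₂ x₀))
    (mvfderiv (𝓡 2) φ x₀ (S.e₃ x₀)) (by
      have hD := hΔ x₀
      rw [invariantDelta_eq hg hF (hval _) (hval _)] at hD
      have hc := hcl (mvfderiv (𝓡 2) φ x₀ (S.e₂ x₀)) (mvfderiv (𝓡 2) φ x₀ (S.e₃ x₀))
      have hcp := congrArg LorentzNum.plus hc
      have hcm := congrArg LorentzNum.minus hc
      simp only [LorentzNum.plus_mul, LorentzNum.minus_mul] at hcp hcm
      simp only [LorentzNum.im_eq, map_sub, LorentzNum.plus_mul, LorentzNum.minus_mul] at hD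
      -- In each null coordinate (ab - cd)² - (a² - c²)(b² - d²) = (ad - bc)², which vanishes since
      -- the two components of ω are proportional. Only terms mixing the two null coordinates remain
      -- in Δ.
      refine hD.trans_eq ?_
      generalize logForm coef₂ h (φ x₀) (mvfderiv (𝓡 2) φ x₀ (S.e₂ x₀)) = a at *
      generalize logForm coef₂ h (φ x₀) (mvfderiv (𝓡 2) φ x₀ (S.e₃ x₀)) = b at *
      generalize logForm coef₃ h (φ x₀) (mvfderiv (𝓡 2) φ x₀ (S.e₂ x₀)) = c at *
      generalize logForm coef₃ h (φ x₀) (mvfderiv (𝓡 2) φ x₀ (S.e₃ x₀)) = d at *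
      linear_combination
        (LorentzNum.plus a * LorentzNum.plus d - LorentzNum.plus b * LorentzNum.plus c) * hcp +
        (LorentzNum.minus a * LorentzNum.minus d - LorentzNum.minus b * LorentzNum.minus c) * hcm)
  obtain ⟨c, hc1, hc2, hc3, hc4, m, n, κ, hκ, hmn⟩ := exists_adapted_coordinate φ.open_target hsm
    hS hI hy₀ ⟨L, f, hp, hm, hLf⟩
  refine ⟨φ.trans c, ?_, hφ.trans hc3 hc4, m ∘ φ, n ∘ φ, κ, hκ, ?_⟩
  · rw [OpenPartialHomeomorph.trans_source]; exact ⟨hx₀, hc1⟩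
  · intro x hx
    rw [OpenPartialHomeomorph.trans_source] at hx
    refine ⟨(hmn _ hx.2).1, fun X => ?_⟩
    rw [hφ.mvfderiv_trans hc3 hx.1 hx.2, ← hlog x hx.1, (hmn _ hx.2).2]
    rfl

end FramedLorentzSurface

/-! ### The Lorentz structure defined by the coordinates. -/

section Structures

variable {M : Type*} [TopologicalSpace M] [ChartedSpace Plane M] [IsManifold (𝓡 2) ∞ M]

theorem continuousLinearMapAt_eq_mvfderiv {x₀ x : M} (hx : x ∈ (chartAt Plane x₀).source)
    (X : TangentSpace (𝓡 2) x) :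
    (trivializationAt Plane (TangentSpace (𝓡 2)) x₀).continuousLinearMapAt ℝ x X =
      mvfderiv (𝓡 2) (chartAt Plane x₀) x X := by
  have : IsManifold (𝓡 2) 1 M := IsManifold.of_le (n := ∞) (by simp)
  rw [TangentBundle.continuousLinearMapAt_trivializationAt hx]
  rfl

/-- A field of endomorphisms which is the multiplication by `σ` in suitable coordinates is smooth. -/
theorem contMDiffAt_of_coordinate
    {T : Π x : M, TangentSpace (𝓡 2) x →L[ℝ] TangentSpace (𝓡 2) x}
    {c : OpenPartialHomeomorph M LorentzNum} (hc : SmoothChart c) {x₀ : M} (hx₀ : x₀ ∈ c.source)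
    (hT : ∀ x ∈ c.source, ∀ X, mvfderiv (𝓡 2) c x (T x X) =
      LorentzNum.sigma * mvfderiv (𝓡 2) c x X) :
    ContMDiffAt (𝓡 2) ((𝓡 2).prod 𝓘(ℝ, Plane →L[ℝ] Plane)) ∞
      (fun x ↦ TotalSpace.mk' (Plane →L[ℝ] Plane)
        (E := fun x : M ↦ TangentSpace (𝓡 2) x →L[ℝ] TangentSpace (𝓡 2) x) x (T x)) x₀ := by
  have : IsManifold (𝓡 2) 1 M := IsManifold.of_le (n := ∞) (by simp)
  rw [contMDiffAt_hom_bundle]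
  refine ⟨contMDiffAt_id, ?_⟩
  set φ := chartAt Plane x₀
  have hφ : SmoothChart φ := SmoothChart.chartAt x₀
  have hφ₀ : x₀ ∈ φ.source := mem_chart_source Plane x₀
  have s1 : ContDiffAt ℝ ∞ (φ ∘ c.symm) (c x₀) := by
    refine ContMDiffAt.contDiffAt (ContMDiffAt.comp (I' := 𝓡 2) _ ?_
      (hc.smooth_symm.contMDiffAt (c.open_target.mem_nhds (c.map_source hx₀))))
    rw [c.left_inv hx₀]
    exact hφ.smooth.contMDiffAt (φ.open_source.mem_nhds hφ₀)
  have s2 : ContDiffAt ℝ ∞ (c ∘ φ.symm) (φ x₀) := by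
    refine ContMDiffAt.contDiffAt (ContMDiffAt.comp (I' := 𝓡 2) _ ?_
      (hφ.smooth_symm.contMDiffAt (φ.open_target.mem_nhds (φ.map_source hφ₀))))
    rw [φ.left_inv hφ₀]
    exact hc.smooth.contMDiffAt (c.open_source.mem_nhds hx₀)
  have m1 : ContMDiffAt (𝓡 2) 𝓘(ℝ, LorentzNum →L[ℝ] Plane) ∞
      (fun x => fderiv ℝ (φ ∘ c.symm) (c x)) x₀ :=
    (s1.fderiv_right (m := ∞) (by simp)).contMDiffAt.comp x₀
      (hc.smooth.contMDiffAt (c.open_source.mem_nhds hx₀))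
  have m2 : ContMDiffAt (𝓡 2) 𝓘(ℝ, Plane →L[ℝ] LorentzNum) ∞
      (fun x => fderiv ℝ (c ∘ φ.symm) (φ x)) x₀ :=
    (s2.fderiv_right (m := ∞) (by simp)).contMDiffAt.comp x₀
      (hφ.smooth.contMDiffAt (φ.open_source.mem_nhds hφ₀))
  -- In the trivialization given by φ, the endomorphism is σ conjugated by the differential of the
  -- transition map between φ and c.
  have m3 : ContMDiffAt (𝓡 2) 𝓘(ℝ, Plane →L[ℝ] Plane) ∞
      (fun x => (fderiv ℝ (φ ∘ c.symm) (c x)).comp ((LorentzNum.mulL LorentzNum.sigma).comp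
        (fderiv ℝ (c ∘ φ.symm) (φ x)))) x₀ :=
    m1.clm_comp (contMDiffAt_const.clm_comp m2)
  refine m3.congr_of_eventuallyEq ?_
  filter_upwards [φ.open_source.mem_nhds hφ₀, c.open_source.mem_nhds hx₀] with x hx hxc
  ext1 w
  set t := trivializationAt Plane (TangentSpace (𝓡 2)) x₀
  have hb : x ∈ t.baseSet := by rw [TangentBundle.trivializationAt_baseSet]; exact hx
  have hX : mvfderiv (𝓡 2) φ x (t.symmL ℝ x w) = w := by
    rw [← continuousLinearMapAt_eq_mvfderiv hx, t.continuousLinearMapAt_symmL hb]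
  have h1 : (fderiv ℝ (φ ∘ c.symm) (c x)).comp ((LorentzNum.mulL LorentzNum.sigma).comp
        (fderiv ℝ (c ∘ φ.symm) (φ x))) w = mvfderiv (𝓡 2) φ x (T x (t.symmL ℝ x w)) := by
    conv_lhs => rw [← hX]
    simp only [ContinuousLinearMap.comp_apply, LorentzNum.mulL_apply]
    rw [← hφ.mvfderiv_eq hx (hc.mdifferentiableAt hxc), ← hT x hxc,
      ← hc.mvfderiv_eq hxc (hφ.mdifferentiableAt hx)]
  rw [h1, ← continuousLinearMapAt_eq_mvfderiv hx]
  rfl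

theorem LorentzStructure.ext_toFun {τ τ' : LorentzStructure M}
    (h : ∀ x X, τ.toFun x X = τ'.toFun x X) : τ = τ' := by
  cases τ; cases τ'
  congr 1
  funext x
  ext1 X
  exact h x X

end Structures

namespace FramedLorentzSurface

open QuatLC

variable {M : Type*} [TopologicalSpace M] [ChartedSpace Plane M]
  [IsManifold (𝓡 2) ∞ M] {E : M → Type*} [TopologicalSpace (TotalSpace Plane E)]
  [∀ x, AddCommGroup (E x)] [∀ x, Module ℝ (E x)] [∀ x, TopologicalSpace (E x)]
  [∀ x, IsTopologicalAddGroup (E x)] [∀ x, ContinuousSMul ℝ (E x)]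
  [FiberBundle Plane E] [VectorBundle ℝ Plane E]
  {S : FramedLorentzSurface M E} {Hvec : Π x : M, E x} {g : M → QuatLC} {F : M → Fin 4 → ℝ}

/-- A coordinate in which the logarithmic derivative of `g` is `m J + i n K` with
`m² - n² = ± 1`. -/
def IsSpinCoordinate (g : M → QuatLC) (c : OpenPartialHomeomorph M LorentzNum) : Prop :=
  SmoothChart c ∧ ∃ (m n : M → LorentzNum) (κ : LorentzNum), (κ = 1 ∨ κ = -1) ∧
    ∀ x ∈ c.source, m x ^ 2 - n x ^ 2 = κ ∧ ∀ X, mvfderiv (𝓡 2) g x X * star (g x) =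
      even 0 0 (m x * mvfderiv (𝓡 2) c x X) (n x * mvfderiv (𝓡 2) c x X)

/-- A spin coordinate has the derivative determined by the logarithmic derivative of `g`. -/
theorem IsSpinCoordinate.sigma_iff {c : OpenPartialHomeomorph M LorentzNum}
    (hc : IsSpinCoordinate g c) {x : M} (hx : x ∈ c.source) (X Y : TangentSpace (𝓡 2) x) :
    mvfderiv (𝓡 2) c x Y = LorentzNum.sigma * mvfderiv (𝓡 2) c x X ↔
      mvfderiv (𝓡 2) g x Y * star (g x) =
        LorentzNumC.sigma • (mvfderiv (𝓡 2) g x X * star (g x)) := by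
  obtain ⟨-, m, n, κ, hκ, h⟩ := hc
  obtain ⟨h1, h2⟩ := h x hx
  rw [h2 X, h2 Y, sigma_smul_even]
  constructor
  · intro e
    rw [e]
    congr 1 <;> ring
  · intro e
    have e2 := congrArg coef₂ e
    have e3 := congrArg coef₃ e
    rw [coef₂_even, coef₂_even] at e2
    rw [coef₃_even, coef₃_even] at e3
    have hκ2 : κ * κ = 1 := by rcases hκ with rfl | rfl <;> ring
    generalize mvfderiv (𝓡 2) c x Y = y at *
    generalize mvfderiv (𝓡 2) c x X = z at *
    -- The coordinate form is κ (m P - n Q), because m² - n² = κ and κ² = 1.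
    linear_combination κ * m x * e2 - κ * n x * e3 - κ * (y - LorentzNum.sigma * z) * h1 -
      (y - LorentzNum.sigma * z) * hκ2

/-- The Lorentz structure defined by the spin coordinates. -/
theorem exists_lorentzStructure (hcov : ∀ x : M, ∃ c, x ∈ c.source ∧ IsSpinCoordinate g c) :
    ∃ τ : LorentzStructure M, ∀ c, IsSpinCoordinate g c → τ.IsChart c := by
  choose c hxc hc using hcov
  -- At each point σ is pulled back by a chosen coordinate. By `sigma_iff` the result does not
  -- depend on the choice, so the local descriptions agree and T is smooth.
  let T : Π x : M, TangentSpace (𝓡 2) x →L[ℝ] TangentSpace (𝓡 2) x := fun x =>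
    (mfderiv 𝓘(ℝ, LorentzNum) (𝓡 2) (c x).symm (c x x) : LorentzNum →L[ℝ] Plane).comp
      ((LorentzNum.mulL LorentzNum.sigma).comp (mvfderiv (𝓡 2) (c x) x))
  have hT₀ : ∀ x X, mvfderiv (𝓡 2) (c x) x (T x X) =
      LorentzNum.sigma * mvfderiv (𝓡 2) (c x) x X := fun x X =>
    (hc x).1.comp_symm (hxc x) (LorentzNum.sigma * mvfderiv (𝓡 2) (c x) x X)
  have hT : ∀ c', IsSpinCoordinate g c' → ∀ x ∈ c'.source, ∀ X, mvfderiv (𝓡 2) c' x (T x X) =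
      LorentzNum.sigma * mvfderiv (𝓡 2) c' x X := fun c' hc' x hx X =>
    (hc'.sigma_iff hx X _).2 (((hc x).sigma_iff (hxc x) X _).1 (hT₀ x X))
  refine ⟨⟨T, ?_, ?_, ?_, ?_⟩, fun c' hc' => ⟨hc'.1.smooth, hc'.1.smooth_symm, hT c' hc'⟩⟩
  · intro x X
    apply (hc x).1.injective (hxc x)
    rw [hT₀, hT₀, ← mul_assoc, LorentzNum.sigma_mul_sigma, one_mul]
  · intro x h
    obtain ⟨X, hX⟩ := (hc x).1.surjective (hxc x) 1
    have e := hT₀ x X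
    rw [h] at e
    change mvfderiv (𝓡 2) (c x) x X = _ at e
    rw [hX, mul_one] at e
    have := congrArg LorentzNum.minus e
    norm_num at this
  · intro x h
    obtain ⟨X, hX⟩ := (hc x).1.surjective (hxc x) 1
    have e := hT₀ x X
    rw [h] at e
    change mvfderiv (𝓡 2) (c x) x (-X) = _ at e
    rw [map_neg, hX, mul_one] at e
    have := congrArg LorentzNum.plus e
    norm_num at this
  · intro x
    exact contMDiffAt_of_coordinate (hc x).1 (hxc x) (hT _ (hc x))

theorem isConformal_of_isChart (hg : S.IsDiracSolution Hvec g) {τ : LorentzStructure M}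
    (hcov : ∀ x : M, ∃ c, x ∈ c.source ∧ IsSpinCoordinate g c)
    (hτ : ∀ c, IsSpinCoordinate g c → τ.IsChart c) : τ.IsConformal g := by
  intro x X
  obtain ⟨c, hx, hc⟩ := hcov x
  have h := (hc.sigma_iff hx X _).1 ((hτ c hc).conformal x hx X)
  have h1 := congrArg (· * g x) h
  simp only [smul_mul', mul_assoc, (mul_star_of_mem_Spin22 (hg.mem_spin x)).2, mul_one] at h1
  exact h1

/-- The differential of G depends linearly over the Lorentz numbers on the J and K components of ω,
so conformality passes from g to G. -/
theorem isConformal_gaussMap (hpar : S.IsParallel) (hg : S.IsDiracSolution Hvec g)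
    (hF : S.IsImmersionOf g F) {τ : LorentzStructure M} (hτ : τ.IsConformal g) :
    τ.IsConformal (S.gaussMap F) := by
  intro x X
  have h1 := hg.logDeriv_eq hpar x X
  have h2 : mvfderiv (𝓡 2) g x (τ.toFun x X) * star (g x) = even 0 0
      (LorentzNum.sigma * coef₂ (mvfderiv (𝓡 2) g x X * star (g x)))
      (LorentzNum.sigma * coef₃ (mvfderiv (𝓡 2) g x X * star (g x))) := by
    rw [hτ x X, smul_mul']
    conv_lhs => rw [h1]
    rw [sigma_smul_even, mul_zero]
  rw [mvfderiv_gaussMap hg hF h1, mvfderiv_gaussMap hg hF h2, ← smul_mul', ← mul_smul',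
    sigma_smul_even]
  congr 3 <;> ring

/-- The image of σ_x X under dG is prescribed to be σ dG(X), and dG is injective. -/
theorem lorentzStructure_unique (hreg : ∀ x, Function.Injective (mvfderiv (𝓡 2) (S.gaussMap F) x))
    {τ τ' : LorentzStructure M} (hτ : τ.IsConformal (S.gaussMap F))
    (hτ' : τ'.IsConformal (S.gaussMap F)) : τ' = τ :=
  LorentzStructure.ext_toFun fun x X => hreg x ((hτ' x X).trans (hτ x X).symm)

end FramedLorentzSurface

/-! ### Derivatives in conformal charts and affine changes of chart. -/

namespace QuatLC

open LorentzNum (toC)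

theorem toC_smul_eq (k : LorentzNum) (z : QuatLC) :
    toC k • z = k.re • z + k.im • (LorentzNumC.sigma • z) := by
  ext1 <;> ext1 <;> simp only [Quaternion.re_add, Quaternion.imI_add, Quaternion.imJ_add,
    Quaternion.imK_add, Quaternion.re_smul, Quaternion.imI_smul, Quaternion.imJ_smul,
    Quaternion.imK_smul] <;> simp [toC, LorentzNumC.sigma]

/-- Applied to the differential of a conformal map read in a chart, this is the relation dg = g' da.
-/
theorem clm_apply_eq_toC_smul {ℓ : LorentzNum →L[ℝ] QuatLC}
    (h : ∀ k, ℓ (LorentzNum.sigma * k) = LorentzNumC.sigma • ℓ k) (k : LorentzNum) :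
    ℓ k = toC k • ℓ 1 := by
  have h1 : ℓ LorentzNum.sigma = LorentzNumC.sigma • ℓ 1 := by simpa using h 1
  conv_lhs => rw [LorentzNum.eq_re_add_im k]
  rw [map_add, map_smul, map_smul, h1, toC_smul_eq]

theorem formH_smul (k : LorentzNumC) (z : QuatLC) : formH (k • z) (k • z) = k * k * formH z z := by
  simp only [formH, Quaternion.re_smul, Quaternion.imI_smul, Quaternion.imJ_smul,
    Quaternion.imK_smul, smul_eq_mul]
  ring

theorem toC_mul (a b : LorentzNum) : toC (a * b) = toC a * toC b := by
  ext1 <;> apply Complex.ext <;> simp [toC]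

end QuatLC

namespace LorentzStructure

open QuatLC LorentzNum

variable {M : Type*} [TopologicalSpace M] [ChartedSpace Plane M] [IsManifold (𝓡 2) ∞ M]
  {τ : LorentzStructure M} {g : M → QuatLC} {c c' : OpenPartialHomeomorph M LorentzNum}

theorem IsChart.fderiv_sigma (hc : τ.IsChart c) (hτ : τ.IsConformal g)
    (hg : MDifferentiable (𝓡 2) 𝓘(ℝ, QuatLC) g) {a : LorentzNum} (ha : a ∈ c.target)
    (k : LorentzNum) : fderiv ℝ (g ∘ c.symm) a (sigma * k) =
      LorentzNumC.sigma • fderiv ℝ (g ∘ c.symm) a k := by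
  have hx := c.map_target ha
  obtain ⟨X, rfl⟩ := (hc.smoothChart.surjective hx) k
  have h1 := hc.smoothChart.mvfderiv_eq hx (hg _) X
  have h2 := hc.smoothChart.mvfderiv_eq hx (hg _) (τ.toFun _ X)
  rw [hc.conformal _ hx, hτ, h1, c.right_inv ha] at h2
  exact h2.symm

theorem IsChart.fderiv_comp_symm (hc : τ.IsChart c) (hτ : τ.IsConformal g)
    (hg : MDifferentiable (𝓡 2) 𝓘(ℝ, QuatLC) g) {a : LorentzNum} (ha : a ∈ c.target)
    (k : LorentzNum) : fderiv ℝ (g ∘ c.symm) a k = toC k • chartDeriv g c a :=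
  clm_apply_eq_toC_smul (fun k => hc.fderiv_sigma hτ hg ha k) k

theorem IsChart.mvfderiv_eq (hc : τ.IsChart c) (hτ : τ.IsConformal g)
    (hg : MDifferentiable (𝓡 2) 𝓘(ℝ, QuatLC) g) {x : M} (hx : x ∈ c.source)
    (X : TangentSpace (𝓡 2) x) :
    mvfderiv (𝓡 2) g x X = toC (mvfderiv (𝓡 2) c x X) • chartDeriv g c (c x) := by
  rw [hc.smoothChart.mvfderiv_eq hx (hg x), hc.fderiv_comp_symm hτ hg (c.map_source hx)]

theorem IsChart.restrOpen (hc : τ.IsChart c) {s : Set M} (hs : IsOpen s) :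
    τ.IsChart (c.restrOpen s hs) :=
  ⟨(hc.smoothChart.restrOpen hs).smooth, (hc.smoothChart.restrOpen hs).smooth_symm,
    fun x hx => hc.conformal x hx.1⟩

section Affine

variable {ε b : LorentzNum}

/-- As ε is its own inverse, the old coordinate is ε (a - b). -/
theorem affine_symm
    (hε : ε * ε = 1) (hsrc : c'.source = c.source)
    (heq : ∀ x ∈ c.source, c' x = ε * c x + b)
    {a : LorentzNum} (ha : a ∈ c'.target) :
    ε * (a - b) ∈ c.target ∧ c'.symm a = c.symm (ε * (a - b)) := by
  have hy : c'.symm a ∈ c.source := hsrc ▸ c'.map_target ha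
  have h1 := heq _ hy
  rw [c'.right_inv ha] at h1
  have h2 : c (c'.symm a) = ε * (a - b) := by
    have h3 : a - b = ε * c (c'.symm a) := by linear_combination h1
    rw [h3, ← mul_assoc, hε, one_mul]
  rw [← h2]
  exact ⟨c.map_source hy, (c.left_inv hy).symm⟩

theorem IsChart.mvfderiv_affine (heq : ∀ x ∈ c.source, c' x = ε * c x + b)
    (hc : τ.IsChart c) {x : M} (hx : x ∈ c.source)
    (X : TangentSpace (𝓡 2) x) :
    mvfderiv (𝓡 2) c' x X = ε * mvfderiv (𝓡 2) c x X := by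
  have h1 : HasFDerivAt (fun a => mulL ε a + b) (mulL ε) (c x) :=
    (mulL ε).hasFDerivAt.add_const b
  have h2 := mvfderiv_comp_left (hc.smoothChart.mdifferentiableAt hx) h1.differentiableAt X
  rw [h1.fderiv] at h2
  refine Eq.trans (mvfderiv_congr_nhds ?_ X) h2
  filter_upwards [c.open_source.mem_nhds hx] with y hy using heq y hy

theorem IsChart.affine
    (hε : ε * ε = 1) (hsrc : c'.source = c.source)
    (heq : ∀ x ∈ c.source, c' x = ε * c x + b)
    (hc : τ.IsChart c) : τ.IsChart c' := by
  have h1 : ContDiff ℝ ∞ (fun a => mulL ε a + b) := (mulL ε).contDiff.add contDiff_const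
  have h2 : ContDiff ℝ ∞ (fun a => mulL ε (a - b)) :=
    (mulL ε).contDiff.comp (contDiff_id.sub contDiff_const)
  refine ⟨?_, ?_, ?_⟩
  · rw [hsrc]
    exact (h1.contMDiff.comp_contMDiffOn hc.smooth).congr heq
  · refine (hc.smooth_symm.comp (h2.contMDiff.contMDiffOn (s := c'.target)) ?_).congr ?_
    · intro a ha; exact (affine_symm hε hsrc heq ha).1
    · intro a ha; exact (affine_symm hε hsrc heq ha).2
  · intro x hx X
    rw [hsrc] at hx
    rw [IsChart.mvfderiv_affine heq hc hx, IsChart.mvfderiv_affine heq hc hx,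
      hc.conformal x hx]
    ring

theorem IsChart.chartDeriv_affine
    (hε : ε * ε = 1) (hsrc : c'.source = c.source)
    (heq : ∀ x ∈ c.source, c' x = ε * c x + b)
    (hc : τ.IsChart c) (hτ : τ.IsConformal g)
    (hg : MDifferentiable (𝓡 2) 𝓘(ℝ, QuatLC) g) {a : LorentzNum} (ha : a ∈ c'.target) :
    chartDeriv g c' a = toC ε • chartDeriv g c (ε * (a - b)) := by
  have h0 := affine_symm hε hsrc heq ha
  have hx : c'.symm a ∈ c.source := hsrc ▸ c'.map_target ha
  -- This X is the unit vector ∂_u of the new chart, since dc'(X) = ε ε = 1.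
  obtain ⟨X, hX⟩ := (hc.smoothChart.surjective hx) ε
  have e1 := hc.mvfderiv_eq hτ hg hx X
  have e2 := (IsChart.affine hε hsrc heq hc).mvfderiv_eq hτ hg (c'.map_target ha) X
  rw [e1, IsChart.mvfderiv_affine heq hc hx, hX, hε, toC_one, one_smul, c'.right_inv ha,
    h0.2, c.right_inv h0.1] at e2
  exact e2.symm

theorem IsChart.chartLogDeriv_affine
    (hε : ε * ε = 1) (hsrc : c'.source = c.source)
    (heq : ∀ x ∈ c.source, c' x = ε * c x + b)
    (hc : τ.IsChart c) (hτ : τ.IsConformal g)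
    (hg : MDifferentiable (𝓡 2) 𝓘(ℝ, QuatLC) g) {a : LorentzNum} (ha : a ∈ c'.target) :
    chartLogDeriv g c' a = toC ε • chartLogDeriv g c (ε * (a - b)) := by
  rw [chartLogDeriv, chartLogDeriv, IsChart.chartDeriv_affine hε hsrc heq hc hτ hg ha,
    (affine_symm hε hsrc heq ha).2, smul_mul']

theorem IsChart.isNormalizedChart_affine
    (hε : ε * ε = 1) (hsrc : c'.source = c.source)
    (heq : ∀ x ∈ c.source, c' x = ε * c x + b)
    (hc : τ.IsChart c) (hτ : τ.IsConformal g)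
    (hg : MDifferentiable (𝓡 2) 𝓘(ℝ, QuatLC) g) (hn : IsNormalizedChart g c) :
    IsNormalizedChart g c' := by
  have h : ∀ a ∈ c'.target, formH (chartDeriv g c' a) (chartDeriv g c' a) =
      formH (chartDeriv g c (ε * (a - b))) (chartDeriv g c (ε * (a - b))) := by
    intro a ha
    rw [IsChart.chartDeriv_affine hε hsrc heq hc hτ hg ha, formH_smul, ← toC_mul, hε, toC_one,
      one_mul]
  rcases hn with hn | hn
  · exact Or.inl fun a ha => (h a ha).trans (hn _ (affine_symm hε hsrc heq ha).1)
  · exact Or.inr fun a ha => (h a ha).trans (hn _ (affine_symm hε hsrc heq ha).1)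

end Affine

theorem _root_.IsNormalizedChart.restrOpen (hn : IsNormalizedChart g c) {s : Set M}
    (hs : IsOpen s) : IsNormalizedChart g (c.restrOpen s hs) :=
  hn.imp (fun h a ha => h a ha.1) (fun h a ha => h a ha.1)

/-- The composition of a coordinate with the multiplication by a Lorentz number of square one. -/
theorem exists_smul_chart (c : OpenPartialHomeomorph M LorentzNum) {ε : LorentzNum}
    (hε : ε * ε = 1) : ∃ c' : OpenPartialHomeomorph M LorentzNum, c'.source = c.source ∧
      ∀ x ∈ c.source, c' x = ε * c x + 0 :=
  ⟨c.transHomeomorph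
    { toFun := mulL ε
      invFun := mulL ε
      left_inv := fun a => by simp [← mul_assoc, hε]
      right_inv := fun a => by simp [← mul_assoc, hε]
      continuous_toFun := (mulL ε).continuous
      continuous_invFun := (mulL ε).continuous }, rfl, fun x _ => (add_zero _).symm⟩

end LorentzStructure

/-! ### Orientation and existence of adapted charts. -/

namespace FramedLorentzSurface

open QuatLC LorentzNum

variable {M : Type*} [TopologicalSpace M] [ChartedSpace Plane M]
  [IsManifold (𝓡 2) ∞ M] {E : M → Type*} [TopologicalSpace (TotalSpace Plane E)]
  [∀ x, AddCommGroup (E x)] [∀ x, Module ℝ (E x)] [∀ x, TopologicalSpace (E x)]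
  [∀ x, IsTopologicalAddGroup (E x)] [∀ x, ContinuousSMul ℝ (E x)]
  [FiberBundle Plane E] [VectorBundle ℝ Plane E]
  {S : FramedLorentzSurface M E} {g : M → QuatLC} {τ : LorentzStructure M}
  {c c' : OpenPartialHomeomorph M LorentzNum}

/-- Multiplication by κ is the diagonal map (plus κ, minus κ) in null coordinates, whence the
determinant. -/
theorem chartDet_of_mul {x : M} {κ : LorentzNum}
    (h : ∀ X, mvfderiv (𝓡 2) c' x X = κ * mvfderiv (𝓡 2) c x X) :
    S.chartDet c' x = plus κ * minus κ * S.chartDet c x := by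
  rw [chartDet, chartDet, h, h]
  simp [plus_apply, minus_apply]
  ring

theorem chartDet_ne_zero (hc : SmoothChart c) {x : M} (hx : x ∈ c.source) : S.chartDet c x ≠ 0 := by
  intro h
  rw [chartDet] at h
  obtain ⟨X, hX⟩ := hc.surjective hx 1
  obtain ⟨Y, hY⟩ := hc.surjective hx sigma
  obtain ⟨a, b, rfl⟩ := S.exists_frame_coord x X
  obtain ⟨a', b', rfl⟩ := S.exists_frame_coord x Y
  rw [map_add, map_smul, map_smul] at hX hY
  have h1 := congrArg QuadraticAlgebra.re hX
  have h2 := congrArg QuadraticAlgebra.im hX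
  have h3 := congrArg QuadraticAlgebra.re hY
  have h4 := congrArg QuadraticAlgebra.im hY
  simp [sigma, QuadraticAlgebra.re_one, QuadraticAlgebra.im_one] at h1 h2 h3 h4
  generalize (mvfderiv (𝓡 2) c x (S.e₂ x)).re = p at *
  generalize (mvfderiv (𝓡 2) c x (S.e₂ x)).im = q at *
  generalize (mvfderiv (𝓡 2) c x (S.e₃ x)).re = r at *
  generalize (mvfderiv (𝓡 2) c x (S.e₃ x)).im = s at *
  have e : (a * p + b * r) * (a' * q + b' * s) - (a * q + b * s) * (a' * p + b' * r) =
    (a * b' - b * a') * (p * s - q * r) := by ring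
  rw [h, h1, h2, h3, h4] at e
  norm_num at e

theorem continuousAt_mvfderiv_section {s : Π x : M, TangentSpace (𝓡 2) x} {x₀ : M}
    (hs : ContMDiff (𝓡 2) ((𝓡 2).prod 𝓘(ℝ, Plane)) ∞ (fun x ↦ TotalSpace.mk' Plane x (s x)))
    (hc : SmoothChart c) (hx₀ : x₀ ∈ c.source) :
    ContinuousAt (fun x => mvfderiv (𝓡 2) c x (s x)) x₀ := by
  have : IsManifold (𝓡 2) 1 M := IsManifold.of_le (n := ∞) (by simp)
  set φ := chartAt Plane x₀
  have hφ : SmoothChart φ := SmoothChart.chartAt x₀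
  have hφ₀ : x₀ ∈ φ.source := mem_chart_source Plane x₀
  have h1 : ContinuousAt (fun x => mvfderiv (𝓡 2) φ x (s x)) x₀ := by
    have h := ((contMDiffAt_section x₀).1 (hs x₀)).continuousAt
    refine h.congr ?_
    filter_upwards [φ.open_source.mem_nhds hφ₀] with x hx
    rw [← continuousLinearMapAt_eq_mvfderiv hx, Bundle.Trivialization.continuousLinearMapAt_apply,
      Bundle.Trivialization.linearMapAt_apply, if_pos]
    rw [TangentBundle.trivializationAt_baseSet]; exact hx
  have s2 : ContDiffAt ℝ ∞ (c ∘ φ.symm) (φ x₀) := by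
    refine ContMDiffAt.contDiffAt (ContMDiffAt.comp (I' := 𝓡 2) _ ?_
      (hφ.smooth_symm.contMDiffAt (φ.open_target.mem_nhds (φ.map_source hφ₀))))
    rw [φ.left_inv hφ₀]
    exact hc.smooth.contMDiffAt (c.open_source.mem_nhds hx₀)
  have h2 : ContinuousAt (fun x => fderiv ℝ (c ∘ φ.symm) (φ x)) x₀ :=
    ContinuousAt.comp (g := fderiv ℝ (c ∘ φ.symm))
      (s2.fderiv_right (m := ∞) (by simp)).continuousAt (φ.continuousAt hφ₀)
  refine (h2.clm_apply h1).congr ?_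
  filter_upwards [φ.open_source.mem_nhds hφ₀, c.open_source.mem_nhds hx₀] with x hx hxc
  exact (hφ.mvfderiv_eq hx (hc.mdifferentiableAt hxc) _).symm

/-- A nonzero determinant therefore keeps its sign near a point, and restricting a chart settles its
orientation. -/
theorem continuousAt_chartDet (hc : SmoothChart c) {x₀ : M} (hx₀ : x₀ ∈ c.source) :
    ContinuousAt (S.chartDet c) x₀ := by
  have h2 := continuousAt_mvfderiv_section S.frameM.smooth_left hc hx₀
  have h3 := continuousAt_mvfderiv_section S.frameM.smooth_right hc hx₀
  have hre : Continuous (fun a : LorentzNum => a.re) :=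
    (LinearMap.toContinuousLinearMap (QuadraticAlgebra.reₗ 1 0 : LorentzNum →ₗ[ℝ] ℝ)).continuous
  have him : Continuous (fun a : LorentzNum => a.im) :=
    (LinearMap.toContinuousLinearMap (QuadraticAlgebra.imₗ 1 0 : LorentzNum →ₗ[ℝ] ℝ)).continuous
  exact ((hre.continuousAt.comp h2).mul (him.continuousAt.comp h3)).sub
    ((him.continuousAt.comp h2).mul (hre.continuousAt.comp h3))

/-- A normalized chart can be made adapted near a point by restricting it and composing it with
the multiplication by `1` or `σ`. -/
theorem exists_isAdaptedChart (hτ : τ.IsConformal g)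
    (hg : MDifferentiable (𝓡 2) 𝓘(ℝ, QuatLC) g) (hc : τ.IsChart c) (hn : IsNormalizedChart g c)
    {x : M} (hx : x ∈ c.source) :
    ∃ c' : OpenPartialHomeomorph M LorentzNum, x ∈ c'.source ∧ S.IsAdaptedChart τ g c' := by
  have hcont := continuousAt_chartDet (S := S) hc.smoothChart hx
  rcases lt_or_gt_of_ne (chartDet_ne_zero (S := S) hc.smoothChart hx) with h | h
  · obtain ⟨s, hs, hso, hxs⟩ := eventually_nhds_iff.1 (hcont.eventually_lt_const h)
    -- Multiplication by σ has determinant -1, so it corrects the orientation; as σ² = 1 it leaves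
    -- H(g', g') unchanged.
    obtain ⟨c', hsrc, heq⟩ := LorentzStructure.exists_smul_chart (c.restrOpen s hso)
      sigma_mul_sigma
    refine ⟨c', by rw [hsrc]; exact ⟨hx, hxs⟩, ?_, ?_, ?_⟩
    · exact LorentzStructure.IsChart.affine sigma_mul_sigma hsrc heq (hc.restrOpen hso)
    · intro y hy
      rw [hsrc] at hy
      rw [chartDet_of_mul (c := c) (κ := sigma) fun X =>
        LorentzStructure.IsChart.mvfderiv_affine heq (hc.restrOpen hso) hy X]
      have := hs y hy.2
      simp only [plus_sigma, minus_sigma]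
      linarith
    · exact LorentzStructure.IsChart.isNormalizedChart_affine sigma_mul_sigma hsrc heq
        (hc.restrOpen hso) hτ hg (hn.restrOpen hso)
  · obtain ⟨s, hs, hso, hxs⟩ := eventually_nhds_iff.1 (hcont.eventually_const_lt h)
    exact ⟨c.restrOpen s hso, ⟨hx, hxs⟩, hc.restrOpen hso, fun y hy => hs y hy.2, hn.restrOpen hso⟩

/-- A spin coordinate is normalized. -/
theorem IsSpinCoordinate.isNormalizedChart (hc : IsSpinCoordinate g c)
    (hg : MDifferentiable (𝓡 2) 𝓘(ℝ, QuatLC) g) (hS : ∀ x, g x ∈ Spin22) :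
    IsNormalizedChart g c := by
  obtain ⟨hsc, m, n, κ, hκ, h⟩ := hc
  have key : ∀ a ∈ c.target, formH (chartDeriv g c a) (chartDeriv g c a) = toC κ := by
    intro a ha
    have hx := c.map_target ha
    obtain ⟨X, hX⟩ := (hsc.surjective hx) 1
    have h1 := hsc.mvfderiv_eq hx (hg _) X
    rw [hX, c.right_inv ha] at h1
    change _ = chartDeriv g c a at h1
    obtain ⟨h2, h3⟩ := h _ hx
    rw [← h1, ← formH_logDeriv (hS (c.symm a)), h3 X, hX, formH_even, ← h2]
    congr 1; ring
  rcases hκ with rfl | rfl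
  · exact Or.inl fun a ha => by rw [key a ha, toC_one]
  · refine Or.inr fun a ha => ?_
    rw [key a ha]
    ext1 <;> simp [toC, QuadraticAlgebra.re_one, QuadraticAlgebra.im_one]

/-- The affine images `± a + b` of adapted charts are adapted. -/
theorem IsAdaptedChart.affine (hc : S.IsAdaptedChart τ g c) (hτ : τ.IsConformal g)
    (hg : MDifferentiable (𝓡 2) 𝓘(ℝ, QuatLC) g) {ε b : LorentzNum} (hε : ε = 1 ∨ ε = -1)
    (hsrc : c'.source = c.source) (heq : ∀ x ∈ c.source, c' x = ε * c x + b) :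
    S.IsAdaptedChart τ g c' := by
  have hε2 : ε * ε = 1 := by rcases hε with rfl | rfl <;> ring
  have hε3 : plus ε * minus ε = 1 := by rcases hε with rfl | rfl <;> simp
  refine ⟨LorentzStructure.IsChart.affine hε2 hsrc heq hc.chart, fun x hx => ?_,
    LorentzStructure.IsChart.isNormalizedChart_affine hε2 hsrc heq hc.chart hτ hg hc.normalized⟩
  rw [hsrc] at hx
  rw [chartDet_of_mul (c := c) (κ := ε) fun X =>
    LorentzStructure.IsChart.mvfderiv_affine heq hc.chart hx X, hε3, one_mul]
  exact hc.orientation x hx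

end FramedLorentzSurface

/-! ### Uniqueness of adapted charts and the form of g' g⁻¹. -/

namespace LorentzNum

/-- A square is nonnegative in each null coordinate, which excludes -1. Among the square roots of
one, those with null coordinates of equal sign are ±1. -/
theorem eq_one_or_eq_neg_one {κ : LorentzNum} (h : κ * κ = 1 ∨ κ * κ = -1)
    (hpos : 0 < plus κ * minus κ) : κ = 1 ∨ κ = -1 := by
  have h1 : κ * κ = 1 := by
    rcases h with h | h
    · exact h
    · have := congrArg plus h
      rw [plus_mul, map_neg, plus_one] at this
      nlinarith [mul_self_nonneg (plus κ)]
  have hp := congrArg plus h1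
  have hm := congrArg minus h1
  rw [plus_mul, plus_one, mul_self_eq_one_iff] at hp
  rw [minus_mul, minus_one, mul_self_eq_one_iff] at hm
  rcases hp with hp | hp <;> rcases hm with hm | hm <;> rw [hp, hm] at hpos <;> norm_num at hpos
  · exact Or.inl (ext_pm (by simp [hp]) (by simp [hm]))
  · exact Or.inr (ext_pm (by simp [hp]) (by simp [hm]))

/-- A map on a ball whose derivative is `± id` at each point is `a ↦ ± a + b`. -/
theorem eq_of_fderiv_eq_one_or_neg_one {a₀ : LorentzNum} {r : ℝ} {t : LorentzNum → LorentzNum}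
    (ht : ContDiffOn ℝ ∞ t (Metric.ball a₀ r))
    (h : ∀ a ∈ Metric.ball a₀ r, ∀ k, fderiv ℝ t a k = k * fderiv ℝ t a 1)
    (h' : ∀ a ∈ Metric.ball a₀ r, fderiv ℝ t a 1 = 1 ∨ fderiv ℝ t a 1 = -1)
    {a : LorentzNum} (ha : a ∈ Metric.ball a₀ r) (ha₀ : a₀ ∈ Metric.ball a₀ r) :
    fderiv ℝ t a 1 = fderiv ℝ t a₀ 1 ∧
      t a - fderiv ℝ t a 1 * a = t a₀ - fderiv ℝ t a₀ 1 * a₀ := by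
  have hcont : ContinuousOn (fun a => plus (fderiv ℝ t a 1)) (Metric.ball a₀ r) :=
    (LinearMap.toContinuousLinearMap (plus : LorentzNum →ₗ[ℝ] ℝ)).continuous.comp_continuousOn
      ((ht.continuousOn_fderiv_of_isOpen Metric.isOpen_ball (by simp)).clm_apply
        continuousOn_const)
  -- The derivative is continuous with two possible values, so it is constant on the ball.
  obtain ⟨e, -, he⟩ := pos_or_neg_of_isPreconnected (convex_ball a₀ r).isPreconnected hcont
    (fun a ha => by rcases h' a ha with h | h <;> simp [h])
  have hconst : ∀ a ∈ Metric.ball a₀ r, fderiv ℝ t a 1 = fderiv ℝ t a₀ 1 := by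
    intro a ha
    have h1 := he a ha
    have h2 := he a₀ ha₀
    rcases h' a ha with h3 | h3 <;> rcases h' a₀ ha₀ with h4 | h4 <;> rw [h3, h4] <;>
      rw [h3] at h1 <;> rw [h4] at h2 <;> simp at h1 h2 <;> linarith
  refine ⟨hconst a ha, ?_⟩
  rw [hconst a ha]
  have hd : ∀ b ∈ Metric.ball a₀ r,
      HasFDerivAt (fun b => t b - mulL (fderiv ℝ t a₀ 1) b) (0 : LorentzNum →L[ℝ] LorentzNum) b := by
    intro b hb
    have h1 : HasFDerivAt t (fderiv ℝ t b) b := ((ht.contDiffAt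
      (Metric.isOpen_ball.mem_nhds hb)).differentiableAt (by simp)).hasFDerivAt
    have h2 : (0 : LorentzNum →L[ℝ] LorentzNum) = fderiv ℝ t b - mulL (fderiv ℝ t a₀ 1) := by
      ext1 k
      rw [sub_apply, h b hb k, hconst b hb, mulL_apply, mul_comm, sub_self]
      rfl
    rw [h2]
    exact h1.sub (mulL _).hasFDerivAt
  have := (convex_ball a₀ r).is_const_of_fderivWithin_eq_zero (𝕜 := ℝ)
    (fun b hb => (hd b hb).differentiableAt.differentiableWithinAt)
    (fun b hb => by
      rw [(hd b hb).hasFDerivWithinAt.fderivWithin (Metric.isOpen_ball.uniqueDiffWithinAt hb)]) ha ha₀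
  exact this

end LorentzNum

namespace FramedLorentzSurface

open QuatLC LorentzNum

variable {M : Type*} [TopologicalSpace M] [ChartedSpace Plane M]
  [IsManifold (𝓡 2) ∞ M] {E : M → Type*} [TopologicalSpace (TotalSpace Plane E)]
  [∀ x, AddCommGroup (E x)] [∀ x, Module ℝ (E x)] [∀ x, TopologicalSpace (E x)]
  [∀ x, IsTopologicalAddGroup (E x)] [∀ x, ContinuousSMul ℝ (E x)]
  [FiberBundle Plane E] [VectorBundle ℝ Plane E]
  {S : FramedLorentzSurface M E} {g : M → QuatLC} {Hvec : Π x : M, E x} {τ : LorentzStructure M}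
  {c c₁ c₂ : OpenPartialHomeomorph M LorentzNum}

/-- The transition map between adapted charts has derivative `± id`. -/
theorem IsAdaptedChart.fderiv_transition (h₁ : S.IsAdaptedChart τ g c₁)
    (h₂ : S.IsAdaptedChart τ g c₂) (hτ : τ.IsConformal g)
    (hg : MDifferentiable (𝓡 2) 𝓘(ℝ, QuatLC) g) {x : M} (hx₁ : x ∈ c₁.source)
    (hx₂ : x ∈ c₂.source) :
    (∀ k, fderiv ℝ (c₂ ∘ c₁.symm) (c₁ x) k = k * fderiv ℝ (c₂ ∘ c₁.symm) (c₁ x) 1) ∧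
      (fderiv ℝ (c₂ ∘ c₁.symm) (c₁ x) 1 = 1 ∨ fderiv ℝ (c₂ ∘ c₁.symm) (c₁ x) 1 = -1) := by
  have hs₁ := h₁.chart.smoothChart
  have hs₂ := h₂.chart.smoothChart
  have hd := hs₁.mvfderiv_eq hx₁ (hs₂.mdifferentiableAt hx₂)
  have hconf : ∀ k, fderiv ℝ (c₂ ∘ c₁.symm) (c₁ x) k =
      k * fderiv ℝ (c₂ ∘ c₁.symm) (c₁ x) 1 := by
    refine clm_apply_eq_mul fun k => ?_
    obtain ⟨X, rfl⟩ := hs₁.surjective hx₁ k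
    rw [← h₁.chart.conformal x hx₁, ← hd, ← hd, h₂.chart.conformal x hx₂]
  refine ⟨hconf, ?_⟩
  set κ := fderiv ℝ (c₂ ∘ c₁.symm) (c₁ x) 1
  have hd' : ∀ X, mvfderiv (𝓡 2) c₂ x X = κ * mvfderiv (𝓡 2) c₁ x X := fun X => by
    rw [hd, hconf, mul_comm]
  have hpos : 0 < plus κ * minus κ := by
    have e := chartDet_of_mul (S := S) hd'
    have p₁ := h₁.orientation x hx₁
    have p₂ := h₂.orientation x hx₂
    rw [e] at p₂
    exact pos_of_mul_pos_left p₂ p₁.le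
  -- From dg = g₁' da₁ = g₂' da₂ and da₂ = κ da₁ one gets g₁' = κ g₂'. Both norms are ±1, so κ² =
  -- ±1.
  have hH : formH (chartDeriv g c₁ (c₁ x)) (chartDeriv g c₁ (c₁ x)) =
      toC (κ * κ) * formH (chartDeriv g c₂ (c₂ x)) (chartDeriv g c₂ (c₂ x)) := by
    obtain ⟨X, hX⟩ := hs₁.surjective hx₁ 1
    have e₁ := h₁.chart.mvfderiv_eq hτ hg hx₁ X
    rw [h₂.chart.mvfderiv_eq hτ hg hx₂ X, hd' X, hX, mul_one, toC_one, one_smul] at e₁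
    rw [← e₁, formH_smul, toC_mul]
  have hneg : toC (-1 : LorentzNum) = -1 := by
    ext1 <;> simp [toC, QuadraticAlgebra.re_one, QuadraticAlgebra.im_one]
  refine eq_one_or_eq_neg_one ?_ hpos
  have ht₁ := c₁.map_source hx₁
  have ht₂ := c₂.map_source hx₂
  rcases h₁.normalized with n₁ | n₁ <;> rcases h₂.normalized with n₂ | n₂ <;>
    rw [n₁ _ ht₁, n₂ _ ht₂] at hH
  · exact Or.inl (toC_injective (by rw [toC_one, hH, mul_one]))
  · exact Or.inr (toC_injective (by rw [hneg, hH]; ring))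
  · exact Or.inr (toC_injective (by rw [hneg, hH, mul_one]))
  · exact Or.inl (toC_injective (by rw [toC_one]; linear_combination hH))

/-- Adapted charts are unique up to `a ↦ ± a + b`. -/
theorem IsAdaptedChart.exists_eq_affine (h₁ : S.IsAdaptedChart τ g c₁)
    (h₂ : S.IsAdaptedChart τ g c₂) (hτ : τ.IsConformal g)
    (hg : MDifferentiable (𝓡 2) 𝓘(ℝ, QuatLC) g) {W : Set M} (hW₁ : W ⊆ c₁.source)
    (hW₂ : W ⊆ c₂.source) (hW : IsPreconnected W) :
    ∃ ε b : LorentzNum, (ε = 1 ∨ ε = -1) ∧ ∀ x ∈ W, c₂ x = ε * c₁ x + b := by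
  rcases W.eq_empty_or_nonempty with rfl | ⟨x₀, hx₀⟩
  · exact ⟨1, 0, Or.inl rfl, fun x hx => absurd hx (Set.notMem_empty x)⟩
  set t : LorentzNum → LorentzNum := c₂ ∘ c₁.symm with ht
  have hloc : ∀ x ∈ W, ∀ᶠ y in nhds x, fderiv ℝ t (c₁ y) 1 = fderiv ℝ t (c₁ x) 1 ∧
      c₂ y - fderiv ℝ t (c₁ y) 1 * c₁ y = c₂ x - fderiv ℝ t (c₁ x) 1 * c₁ x := by
    intro x hx
    have hU : IsOpen (c₁.target ∩ c₁.symm ⁻¹' c₂.source) :=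
      c₁.symm.isOpen_inter_preimage c₂.open_source
    have hxU : c₁ x ∈ c₁.target ∩ c₁.symm ⁻¹' c₂.source :=
      ⟨c₁.map_source (hW₁ hx), by
        rw [Set.mem_preimage, c₁.left_inv (hW₁ hx)]; exact hW₂ hx⟩
    obtain ⟨r, hr, hball⟩ := Metric.isOpen_iff.1 hU _ hxU
    have hts : ContDiffOn ℝ ∞ t (Metric.ball (c₁ x) r) := by
      rw [← contMDiffOn_iff_contDiffOn]
      exact h₂.chart.smooth.comp (h₁.chart.smooth_symm.mono fun a ha => (hball ha).1)
        fun a ha => (hball ha).2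
    have hfd : ∀ a ∈ Metric.ball (c₁ x) r, (∀ k, fderiv ℝ t a k = k * fderiv ℝ t a 1) ∧
        (fderiv ℝ t a 1 = 1 ∨ fderiv ℝ t a 1 = -1) := by
      intro a ha
      have := h₁.fderiv_transition h₂ hτ hg (c₁.map_target (hball ha).1) (hball ha).2
      rwa [c₁.right_inv (hball ha).1] at this
    filter_upwards [c₁.open_source.mem_nhds (hW₁ hx),
      (c₁.continuousAt (hW₁ hx)).preimage_mem_nhds (Metric.ball_mem_nhds _ hr)] with y hy hyb
    have := eq_of_fderiv_eq_one_or_neg_one hts (fun a ha => (hfd a ha).1)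
      (fun a ha => (hfd a ha).2) hyb (Metric.mem_ball_self hr)
    simpa only [ht, Function.comp_apply, c₁.left_inv hy, c₁.left_inv (hW₁ hx)] using this
  have : PreconnectedSpace W := isPreconnected_iff_preconnectedSpace.1 hW
  -- The set W need not be open, so the sign and the translation are made into a function on the
  -- subspace W. It is locally constant because each point of W has a neighbourhood in M where both
  -- are constant.
  have hlc : IsLocallyConstant fun x : W =>
      (fderiv ℝ t (c₁ x) 1, c₂ x - fderiv ℝ t (c₁ x) 1 * c₁ x) := by
    rw [IsLocallyConstant.iff_eventually_eq]
    intro x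
    filter_upwards [continuous_subtype_val.continuousAt.eventually (hloc x x.2)] with y hy
    exact Prod.ext hy.1 hy.2
  refine ⟨fderiv ℝ t (c₁ x₀) 1, c₂ x₀ - fderiv ℝ t (c₁ x₀) 1 * c₁ x₀,
    (h₁.fderiv_transition h₂ hτ hg (hW₁ hx₀) (hW₂ hx₀)).2, fun x hx => ?_⟩
  have e := hlc.apply_eq_of_preconnectedSpace ⟨x, hx⟩ ⟨x₀, hx₀⟩
  have e₁ := congrArg Prod.fst e
  have e₂ := congrArg Prod.snd e
  simp only at e₁ e₂
  rw [← e₂, e₁]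
  ring

/-- The form of `g' g⁻¹` in a normalized chart with connected domain. -/
theorem exists_chartLogDeriv_eq (hpar : S.IsParallel) (hg : S.IsDiracSolution Hvec g)
    (hτ : τ.IsConformal g) (hc : τ.IsChart c) (hn : IsNormalizedChart g c)
    (hcon : IsPreconnected c.source) :
    ∃ (ψ : LorentzNum → LorentzNum) (ε : LorentzNum), LorentzNum.ConformalOn ψ c.target ∧
      (ε = 1 ∨ ε = -1 ∨ ε = sigma ∨ ε = -sigma) ∧
      ((∀ a ∈ c.target, chartLogDeriv g c a = ε.toC • coshSinh (ψ a)) ∨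
        (∀ a ∈ c.target, chartLogDeriv g c a = ε.toC • sinhCosh (ψ a))) := by
  have hgd : MDifferentiable (𝓡 2) 𝓘(ℝ, QuatLC) g := fun x => hg.mdifferentiableAt x
  refine exists_logDeriv_param c.open_target ?_
    (hc.smoothChart.contDiffOn_comp_symm hg.smooth.contMDiffOn) (fun a _ => hg.mem_spin _) ?_
    (fun a ha k => hc.fderiv_sigma hτ hgd ha k) hn
  · rw [← c.image_source_eq_target]
    exact hcon.image _ c.continuousOn
  · intro a ha k
    have hx := c.map_target ha
    obtain ⟨X, rfl⟩ := hc.smoothChart.surjective hx k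
    have e := hc.smoothChart.mvfderiv_eq hx (hgd _) X
    rw [c.right_inv ha] at e
    rw [← e, Function.comp_apply, hg.logDeriv_eq hpar]
    simp

/-- Near each point, a chart of the Lorentz structure in which `ε = 1`. -/
theorem exists_chart_chartLogDeriv_eq (hpar : S.IsParallel) (hg : S.IsDiracSolution Hvec g)
    (hτ : τ.IsConformal g) (hc : S.IsAdaptedChart τ g c) {x : M} (hx : x ∈ c.source) :
    ∃ c' : OpenPartialHomeomorph M LorentzNum,
      x ∈ c'.source ∧ τ.IsChart c' ∧ IsNormalizedChart g c' ∧
        (S.PreservesOrientation c' ∨ S.ReversesOrientation c') ∧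
        ∃ ψ : LorentzNum → LorentzNum, LorentzNum.ConformalOn ψ c'.target ∧
          ((∀ a ∈ c'.target, chartLogDeriv g c' a = coshSinh (ψ a)) ∨
            (∀ a ∈ c'.target, chartLogDeriv g c' a = sinhCosh (ψ a))) := by
  have hgd : MDifferentiable (𝓡 2) 𝓘(ℝ, QuatLC) g := fun x => hg.mdifferentiableAt x
  obtain ⟨r, hr, hball⟩ := Metric.isOpen_iff.1 c.open_target _ (c.map_source hx)
  -- The preimage of a ball is connected, as required for ε to be constant.
  set s : Set M := c.source ∩ c ⁻¹' Metric.ball (c x) r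
  have hs : IsOpen s := c.isOpen_inter_preimage Metric.isOpen_ball
  have hxs : x ∈ s := ⟨hx, Metric.mem_ball_self hr⟩
  set d := c.restrOpen s hs
  have hdsrc : d.source = c.symm '' Metric.ball (c x) r := by
    ext y
    constructor
    · rintro ⟨hy, -, hyb⟩
      exact ⟨c y, hyb, c.left_inv hy⟩
    · rintro ⟨a, ha, rfl⟩
      have h1 := c.map_target (hball ha)
      refine ⟨h1, h1, ?_⟩
      rw [Set.mem_preimage, c.right_inv (hball ha)]
      exact ha
  have hdc : τ.IsChart d := hc.chart.restrOpen hs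
  have hdn : IsNormalizedChart g d := hc.normalized.restrOpen hs
  have hdo : ∀ y ∈ d.source, 0 < S.chartDet d y := fun y hy => hc.orientation y hy.1
  have hdcon : IsPreconnected d.source := by
    rw [hdsrc]
    exact (convex_ball _ _).isPreconnected.image _ (c.symm.continuousOn.mono hball)
  obtain ⟨ψ, ε, hψ, hε, hform⟩ := exists_chartLogDeriv_eq hpar hg hτ hdc hdn hdcon
  have hε2 : ε * ε = 1 := by
    rcases hε with rfl | rfl | rfl | rfl <;> simp [sigma_mul_sigma]
  have hε3 : plus ε * minus ε = 1 ∨ plus ε * minus ε = -1 := by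
    rcases hε with rfl | rfl | rfl | rfl <;> simp
  obtain ⟨c', hsrc, heq⟩ := LorentzStructure.exists_smul_chart d hε2
  have hsym := fun {a} (ha : a ∈ c'.target) => LorentzStructure.affine_symm hε2 hsrc heq ha
  have hdet : ∀ y ∈ d.source, S.chartDet c' y = plus ε * minus ε * S.chartDet d y :=
    fun y hy => chartDet_of_mul fun X =>
      LorentzStructure.IsChart.mvfderiv_affine heq hdc hy X
  have hlog : ∀ {Z : QuatLC}, toC ε • toC ε • Z = Z := fun {Z} => by
    rw [smul_smul, ← toC_mul, hε2, toC_one, one_smul]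
  refine ⟨c', by rw [hsrc]; exact ⟨hx, hxs⟩, LorentzStructure.IsChart.affine hε2 hsrc heq hdc,
    LorentzStructure.IsChart.isNormalizedChart_affine hε2 hsrc heq hdc hτ hgd hdn, ?_,
    -- The old coordinate expressed by the new one; the 0 is the translation part b. The new
    -- derivative carries a second factor ε, and ε² = 1 cancels both.
    fun a => ψ (ε * (a - 0)), ⟨?_, ?_⟩, ?_⟩
  · rcases hε3 with e | e
    · refine Or.inl fun y hy => ?_
      rw [hsrc] at hy
      rw [hdet y hy, e, one_mul]
      exact hdo y hy
    · refine Or.inr fun y hy => ?_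
      rw [hsrc] at hy
      rw [hdet y hy, e]
      linarith [hdo y hy]
  · exact hψ.1.comp (g := ψ) (f := fun a => mulL ε (a - 0))
      ((mulL ε).contDiff.comp (contDiff_id.sub contDiff_const)).contDiffOn fun a ha => (hsym ha).1
  · intro a ha k
    have h1 : HasFDerivAt (fun a => mulL ε (a - 0)) (mulL ε) a :=
      (mulL ε).hasFDerivAt.comp a ((hasFDerivAt_id a).sub_const 0)
    have h2 : HasFDerivAt ψ (fderiv ℝ ψ (ε * (a - 0))) (ε * (a - 0)) :=
      ((hψ.1.contDiffAt (d.open_target.mem_nhds (hsym ha).1)).differentiableAt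
        (by simp)).hasFDerivAt
    have h3 : HasFDerivAt (fun a => ψ (ε * (a - 0))) _ a :=
      HasFDerivAt.comp (g := ψ) (f := fun a => mulL ε (a - 0)) a h2 h1
    rw [h3.fderiv]
    simp only [ContinuousLinearMap.comp_apply, LorentzNum.mulL_apply]
    rw [← hψ.2 _ (hsym ha).1]
    congr 1
    ring
  · refine hform.imp (fun h a ha => ?_) (fun h a ha => ?_) <;>
      rw [LorentzStructure.IsChart.chartLogDeriv_affine hε2 hsrc heq hdc hτ hgd ha,
        h _ (hsym ha).1, hlog]

end FramedLorentzSurface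

end

/-! ### The main theorem. -/

theorem mainTheorem7
    {M : Type*} [TopologicalSpace M] [T2Space M] [ChartedSpace Plane M] [IsManifold (𝓡 2) ∞ M]
    {E : M → Type*} [TopologicalSpace (TotalSpace Plane E)]
    [∀ x, AddCommGroup (E x)] [∀ x, Module ℝ (E x)] [∀ x, TopologicalSpace (E x)]
    [∀ x, IsTopologicalAddGroup (E x)] [∀ x, ContinuousSMul ℝ (E x)]
    [FiberBundle Plane E] [VectorBundle ℝ Plane E] [ContMDiffVectorBundle ∞ Plane E (𝓡 2)]
    (S : FramedLorentzSurface M E) (hpar : S.IsParallel)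
    (Hvec : Π x : M, E x) (g : M → QuatLC) (hg : S.IsDiracSolution Hvec g)
    (F : M → Fin 4 → ℝ) (hF : S.IsImmersionOf g F)
    (hreg : ∀ x, Function.Injective (mvfderiv (𝓡 2) (S.gaussMap F) x))
    (hΔ : ∀ x, 0 < S.invariantDelta F x) :
    -- the Lorentz structure induced by the Gauss map, for which `g` is conformal
    ∃ τ : LorentzStructure M, τ.IsConformal (S.gaussMap F) ∧
      (∀ τ' : LorentzStructure M, τ'.IsConformal (S.gaussMap F) → τ' = τ) ∧
      τ.IsConformal g ∧
      -- existence of adapted charts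
      (∀ x : M, ∃ c : OpenPartialHomeomorph M LorentzNum,
        x ∈ c.source ∧ S.IsAdaptedChart τ g c) ∧
      -- uniqueness up to `a ↦ ± a + b`
      (∀ c₁ c₂ : OpenPartialHomeomorph M LorentzNum,
        S.IsAdaptedChart τ g c₁ → S.IsAdaptedChart τ g c₂ →
        ∀ W : Set M, W ⊆ c₁.source → W ⊆ c₂.source → IsPreconnected W →
          ∃ ε b : LorentzNum, (ε = 1 ∨ ε = -1) ∧ ∀ x ∈ W, c₂ x = ε * c₁ x + b) ∧
      (∀ c₁ c₂ : OpenPartialHomeomorph M LorentzNum,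
        S.IsAdaptedChart τ g c₁ → c₂.source = c₁.source →
        (∃ ε b : LorentzNum, (ε = 1 ∨ ε = -1) ∧ ∀ x ∈ c₁.source, c₂ x = ε * c₁ x + b) →
          S.IsAdaptedChart τ g c₂) ∧
      -- the form of `g' g⁻¹` in every adapted chart
      (∀ c : OpenPartialHomeomorph M LorentzNum,
        S.IsAdaptedChart τ g c → IsPreconnected c.source →
          ∃ (ψ : LorentzNum → LorentzNum) (ε : LorentzNum), LorentzNum.ConformalOn ψ c.target ∧
            (ε = 1 ∨ ε = -1 ∨ ε = LorentzNum.sigma ∨ ε = -LorentzNum.sigma) ∧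
            ((∀ a ∈ c.target, chartLogDeriv g c a = ε.toC • QuatLC.coshSinh (ψ a)) ∨
              (∀ a ∈ c.target, chartLogDeriv g c a = ε.toC • QuatLC.sinhCosh (ψ a)))) ∧
      -- the sign can be removed by the choice of the chart, up to its orientation
      (∀ x : M, ∃ c : OpenPartialHomeomorph M LorentzNum,
        x ∈ c.source ∧ τ.IsChart c ∧ IsNormalizedChart g c ∧
          (S.PreservesOrientation c ∨ S.ReversesOrientation c) ∧
          ∃ ψ : LorentzNum → LorentzNum, LorentzNum.ConformalOn ψ c.target ∧
            ((∀ a ∈ c.target, chartLogDeriv g c a = QuatLC.coshSinh (ψ a)) ∨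
              (∀ a ∈ c.target, chartLogDeriv g c a = QuatLC.sinhCosh (ψ a)))) := by
  have hgd : MDifferentiable (𝓡 2) 𝓘(ℝ, QuatLC) g := fun x => hg.mdifferentiableAt x
  have hcov : ∀ x : M, ∃ c, x ∈ c.source ∧ FramedLorentzSurface.IsSpinCoordinate g c :=
    FramedLorentzSurface.exists_coordinate hpar hg hF hΔ
  obtain ⟨τ, hτ⟩ := FramedLorentzSurface.exists_lorentzStructure hcov
  have hτg := FramedLorentzSurface.isConformal_of_isChart hg hcov hτ
  have hτG := FramedLorentzSurface.isConformal_gaussMap hpar hg hF hτg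
  have hadapted : ∀ x : M, ∃ c : OpenPartialHomeomorph M LorentzNum,
      x ∈ c.source ∧ S.IsAdaptedChart τ g c := fun x => by
    obtain ⟨c, hx, hc⟩ := hcov x
    exact FramedLorentzSurface.exists_isAdaptedChart hτg hgd (hτ c hc)
      (hc.isNormalizedChart hgd hg.mem_spin) hx
  refine ⟨τ, hτG, fun τ' h => FramedLorentzSurface.lorentzStructure_unique hreg hτG h, hτg,
    hadapted, fun c₁ c₂ h₁ h₂ W hW₁ hW₂ hW => h₁.exists_eq_affine h₂ hτg hgd hW₁ hW₂ hW, ?_,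
    fun c hc => FramedLorentzSurface.exists_chartLogDeriv_eq hpar hg hτg hc.chart hc.normalized,
    fun x => ?_⟩
  · rintro c₁ c₂ h₁ hsrc ⟨ε, b, hε, heq⟩
    exact h₁.affine hτg hgd hε hsrc heq
  · obtain ⟨c, hx, hc⟩ := hadapted x
    exact FramedLorentzSurface.exists_chart_chartLogDeriv_eq hpar hg hτg hc hx
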